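/- **Setting.** Let $(\mathbb X,\rho)$ be a compact metric space with a Borel probability measure $\mu^*$, let $0=\lambda_0\le\lambda_1\le\cdots$ with $\lambda_k\to\infty$, and let $\phi_0,\phi_1,\dots:\mathbb X\to\mathbb R$ be continuous functions, orthonormal in $L^2(\mu^*)$. Assume that this is a *compact data space with exponent* $q\ge1$: there are $\kappa,\kappa_1,\kappa_2>0$ with $\mu^*(\{y:\rho(x,y)\le r\})\le\kappa r^q$ for all $x\in\mathbb X$, $r>0$, and $$\Big|\sum_{k}e^{-\lambda_k^2t}\phi_k(x)\phi_k(y)\Big|\le\kappa_1t^{-q/2}\exp\!\big(-\kappa_2\rho(x,y)^2/t\big)\qquad(x,y\in\mathbb X,\ 0<t\le1),$$ where the series converges absolutely. Assume also that the $\phi_k$ have no common zero in $\mathbb X$ (automatic if $\phi_0\equiv1$). $\|\cdot\|_p$ is the norm of $L^p=L^p(\mu^*)$. Put $\Pi_n=\mathrm{span}\{\phi_k:\lambda_k<n\}$, $\mathbf S_0=\{k:\lambda_k<1\}$, $\mathbf S_j=\{k:2^{j-2}\le\lambda_k<2^j\}$ for $j\ge1$, $\mathbf V_j=\mathrm{span}\{\phi_k:k\in\mathbf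 S_j\}$, and $E_{p;n}(f)=\inf_{P\in\Pi_n}\|f-P\|_p$. For $\gamma>0$, $W_{p;\gamma}$ is the space of all $f\in L^p$ with $E_{p;n}(f)\to0$ as $n\to\infty$ and $$\|f\|_{W_{p;\gamma}}=\|f\|_p+\sup_{j\ge0}2^{j\gamma}E_{p;2^j}(f)<\infty .$$ For $0<\alpha\le1$ let $\|g\|_{\mathsf{Lip}(\alpha)}=\|g\|_\infty+\sup_{x\ne x'}|g(x)-g(x')|/\rho(x,x')^\alpha$. Let $(\mathbb Y,\mu_{\mathbb Y}^*)$ be a probability space. A function $G:\mathbb Z_+\times\mathbb X\times\mathbb Y\to\mathbb R$ is an *asymmetric eignet kernel with exponents* $(\alpha,\beta)$, with associated functions $\mathcal D_G\phi_\ell\in L^2(\mu_{\mathbb Y}^*)$, if $\phi_\ell(x)=\int_{\mathbb Y}G(\ell;x,y)\,\mathcal D_G\phi_\ell(y)\,d\mu_{\mathbb Y}^*(y)$ (with integrable integrand) for all $\ell,x$; if $\int_{\mathbb Y}|\mathcal D_G\phi_\ell|^2d\mu_{\mathbb Y}^*\le C2^{2j\beta}$ for all $j\ge0$, $\ell\in\mathbf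 S_j$, with $C$ independent of $j,\ell$; and if $\sup_y\|G(\ell;\cdot,y)\|_{\mathsf{Lip}(\alpha)}<\infty$ for every $\ell$. Let $1\le p\le\infty$. A closed linear operator $\mathcal U$ from a subspace of $L^p$ containing all $\Pi_n$ into $L^p$ is *derivative-like with exponent* $a\in\mathbb R$ if $\|\mathcal UP\|_p\le C2^{ja}\|P\|_p$ for all $j\ge0$, $P\in\mathbf V_j$, with $C$ independent of $j,P$. It is *compatible with $G$* if every $G(\ell;\cdot,y)$ lies in its domain and functions $\mathcal U(G)(\ell;\cdot,y)$ representing $\mathcal U(G(\ell;\cdot,y))$ are given such that $y\mapsto\mathcal U(G)(\ell;x,y)$ is $\mu_{\mathbb Y}^*$-measurable for all $\ell,x$, and $\mathcal U\phi_\ell(x)=\int_{\mathbb Y}\mathcal U(G)(\ell;x,y)\,\mathcal D_G\phi_\ell(y)\,d\mu_{\mathbb Y}^*(y)$ (with integrable integrand) for each $\ell$ and $\mu^*$-almost every $x$. **Theorem.** Let $0<\alpha\le1$, $\beta>0$, let $G$ be an asymmetric eignet kernel with exponents $(\alpha,\beta)$, let $1\le p\le\infty$, $J\ge1$, and let $\mathcal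 U_1,\dots,\mathcal U_J$ be operators compatible with $G$ and derivative-like with exponents $a_1,\dots,a_J$. Put $a_*=\min_ka_k$, $a^*=\max_ka_k$ and let $\gamma>\max(0,a^*)$. For integers $n\ge0$ let $$T_n=\begin{cases}2^{n(q/2+\beta-\gamma)},&\gamma<q/2+\beta,\\ n,&\gamma=q/2+\beta,\\ 1,&\gamma>q/2+\beta,\end{cases}$$ $$\mathbf G_n=\sup_{\lambda_\ell<2^n,\ y\in\mathbb Y,\ k}\|\mathcal U_k(G)(\ell;\cdot,y)\|_\infty,\qquad \mathbf L_n=\sup_{\lambda_\ell<2^n,\ y\in\mathbb Y,\ k}\|\mathcal U_k(G)(\ell;\cdot,y)\|_{\mathsf{Lip}(\alpha)}.$$ Then there are constants $c_1,c_2,c_3,C>0$, independent of $f,n,M$, such that the following holds for all $f\in W_{\max(p,2);\gamma}$, all integers $n\ge0$ with $\mathbf L_n<\infty$, and all integers $M\ge1$ with $$M\ \ge\ c_1\,2^{2n(\gamma-a_*)}(\mathbf G_nT_n)^2\big\{c_2+n(\gamma-a_*)+\log(\mathbf L_nT_n)\big\}$$ (where the right-hand side is read with $\log0=0$ if $\mathbf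 L_nT_n=0$). There exist $(\ell_j,y_j)\in\mathbb Z_+\times\mathbb Y$ and $w_j\in\{-1,1\}$, $j=1,\dots,M$, such that simultaneously for all $k=1,\dots,J$, $f$ belongs to the domain of $\mathcal U_k$ and $$\Big\|\mathcal U_k(f)-c_3\|f\|_{W_{\max(p,2);\gamma}}\frac{T_n}{M}\sum_{j=1}^Mw_j\,\mathcal U_k(G)(\ell_j;\cdot,y_j)\Big\|_p\le C\,2^{-n(\gamma-a_k)}\|f\|_{W_{\max(p,2);\gamma}} .$$ -/

import Mathlib

open MeasureTheory Filter Topology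
open scoped ENNReal

noncomputable section

/-- `(X, dist, μ, lam, φ)` is a compact data space with exponent `q`; the compact metric space and
the Borel probability measure are supplied by the type classes. -/
structure IsDataSpace {X : Type*} [MetricSpace X] [CompactSpace X] [MeasurableSpace X]
    [BorelSpace X] (μ : Measure X) [IsProbabilityMeasure μ] (lam : ℕ → ℝ) (φ : ℕ → X → ℝ)
    (q : ℝ) : Prop where
  lam_zero : lam 0 = 0
  lam_mono : Monotone lam
  lam_tendsto : Tendsto lam atTop atTop
  phi_continuous : ∀ k, Continuous (φ k)
  phi_orthonormal : ∀ j k, ∫ x, φ j x * φ k x ∂μ = if j = k then 1 else 0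
  one_le_exponent : 1 ≤ q
  ball_measure : ∃ κ : ℝ, 0 < κ ∧ ∀ (x : X) (r : ℝ), 0 < r →
    μ (Metric.closedBall x r) ≤ ENNReal.ofReal (κ * r ^ q)
  gaussian_bound : ∃ κ₁ κ₂ : ℝ, 0 < κ₁ ∧ 0 < κ₂ ∧ ∀ (x y : X) (t : ℝ), 0 < t → t ≤ 1 →
    Summable (fun k => Real.exp (-(lam k) ^ 2 * t) * φ k x * φ k y) ∧
    |∑' k, Real.exp (-(lam k) ^ 2 * t) * φ k x * φ k y| ≤
      κ₁ * t ^ (-q / 2) * Real.exp (-(κ₂ * dist x y ^ 2 / t))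

/-- The indices `k` with `2 ^ (j - 2) ≤ lam k < 2 ^ j`; the block `j = 0` also contains the
indices with `lam k < 1 / 4`, so that the blocks cover all indices. -/
def dyadicBlock (lam : ℕ → ℝ) (j : ℕ) : Set ℕ :=
  {k | (j = 0 ∨ (2 : ℝ) ^ ((j : ℝ) - 2) ≤ lam k) ∧ lam k < (2 : ℝ) ^ (j : ℝ)}

/-- The space `Π_n` of diffusion polynomials of order `< n`. -/
def diffusionPoly {X : Type*} (lam : ℕ → ℝ) (φ : ℕ → X → ℝ) (n : ℝ) : Submodule ℝ (X → ℝ) :=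
  Submodule.span ℝ (φ '' {k | lam k < n})

/-- The span of the `φ k` with `k` in the `j`-th dyadic block. -/
def dyadicPoly {X : Type*} (lam : ℕ → ℝ) (φ : ℕ → X → ℝ) (j : ℕ) : Submodule ℝ (X → ℝ) :=
  Submodule.span ℝ (φ '' dyadicBlock lam j)

/-- The degree of approximation `E_{p;n}(f)`. -/
def approxDegree {X : Type*} [MeasurableSpace X] (μ : Measure X) (lam : ℕ → ℝ)
    (φ : ℕ → X → ℝ) (p : ℝ≥0∞) (n : ℝ) (f : X → ℝ) : ℝ≥0∞ :=
  ⨅ P ∈ diffusionPoly lam φ n, eLpNorm (f - P) p μ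

/-- Membership in `X^p`: functions in `L^p` whose degrees of approximation tend to zero. -/
def MemXp {X : Type*} [MeasurableSpace X] (μ : Measure X) (lam : ℕ → ℝ)
    (φ : ℕ → X → ℝ) (p : ℝ≥0∞) (f : X → ℝ) : Prop :=
  MemLp f p μ ∧ Tendsto (fun n : ℝ => approxDegree μ lam φ p n f) atTop (𝓝 0)

/-- The norm of `W_{p;γ}`, with values in `[0, ∞]`. -/
def sobolevNorm {X : Type*} [MeasurableSpace X] (μ : Measure X) (lam : ℕ → ℝ)
    (φ : ℕ → X → ℝ) (p : ℝ≥0∞) (γ : ℝ) (f : X → ℝ) : ℝ≥0∞ :=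
  eLpNorm f p μ +
    ⨆ j : ℕ, ENNReal.ofReal ((2 : ℝ) ^ (j * γ)) * approxDegree μ lam φ p ((2 : ℝ) ^ (j : ℝ)) f

/-- Membership in the smoothness class `W_{p;γ}`. -/
def MemSobolev {X : Type*} [MeasurableSpace X] (μ : Measure X) (lam : ℕ → ℝ)
    (φ : ℕ → X → ℝ) (p : ℝ≥0∞) (γ : ℝ) (f : X → ℝ) : Prop :=
  MemXp μ lam φ p f ∧ sobolevNorm μ lam φ p γ f < ⊤

/-- The norm of `Lip(α)`, with values in `[0, ∞]`. -/
def lipNorm {X : Type*} [MetricSpace X] [MeasurableSpace X] (μ : Measure X) (α : ℝ)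
    (f : X → ℝ) : ℝ≥0∞ :=
  eLpNorm f ⊤ μ +
    ⨆ (x : X) (x' : X) (_ : x ≠ x'), ENNReal.ofReal (|f x - f x'| / dist x x' ^ α)

/-- The class of `f` lies in the domain of the partially defined operator `U` on `L^p`, and `U f`
is the class of `g`. -/
def Sends {X : Type*} [MeasurableSpace X] {μ : Measure X} {p : ℝ≥0∞}
    (U : Lp ℝ p μ →ₗ.[ℝ] Lp ℝ p μ) (f g : X → ℝ) : Prop :=
  ∃ u v : Lp ℝ p μ, (u, v) ∈ U.graph ∧ u =ᵐ[μ] f ∧ v =ᵐ[μ] g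

/-- `U` is a closed linear operator in `L^p`, defined at least on all diffusion polynomials, that
satisfies the Bernstein-type inequality with exponent `a` on the dyadic blocks. -/
structure IsDerivativeLike {X : Type*} [MeasurableSpace X] (μ : Measure X) (lam : ℕ → ℝ)
    (φ : ℕ → X → ℝ) (p : ℝ≥0∞) [Fact (1 ≤ p)] (U : Lp ℝ p μ →ₗ.[ℝ] Lp ℝ p μ) (a : ℝ) :
    Prop where
  closed : U.IsClosed
  defined : ∀ (n : ℝ), ∀ P ∈ diffusionPoly lam φ n, ∃ g, Sends U P g
  bernstein : ∃ C : ℝ, 0 < C ∧ ∀ (j : ℕ), ∀ P ∈ dyadicPoly lam φ j, ∀ g, Sends U P g →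
    eLpNorm g p μ ≤ ENNReal.ofReal (C * (2 : ℝ) ^ (j * a)) * eLpNorm P p μ

/-- `G` is an asymmetric eignet kernel with exponents `(α, β)`, where `D ℓ` is the function
`𝒟_G φ_ℓ` of the connection condition. -/
structure IsAsymmetricEignetKernel {X Y : Type*} [MetricSpace X] [MeasurableSpace X]
    [MeasurableSpace Y] (μ : Measure X) (μY : Measure Y) (lam : ℕ → ℝ) (φ : ℕ → X → ℝ)
    (G : ℕ → X → Y → ℝ) (D : ℕ → Y → ℝ) (α β : ℝ) : Prop where
  connection : ∀ ℓ x, Integrable (fun y => G ℓ x y * D ℓ y) μY ∧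
    φ ℓ x = ∫ y, G ℓ x y * D ℓ y ∂μY
  square_bound : ∃ C : ℝ, 0 < C ∧ ∀ (j : ℕ), ∀ ℓ ∈ dyadicBlock lam j,
    MemLp (D ℓ) 2 μY ∧ ∫ y, |D ℓ y| ^ 2 ∂μY ≤ C * (2 : ℝ) ^ (2 * j * β)
  smooth : ∀ ℓ, ⨆ y, lipNorm μ α (fun x => G ℓ x y) < ⊤

/-- `U` is compatible with `G`, and `UG ℓ x y` stands for `U (G(ℓ; ∘, y)) (x)`. -/
structure IsCompatible {X Y : Type*} [MeasurableSpace X] [MeasurableSpace Y] (μ : Measure X)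
    (μY : Measure Y) (φ : ℕ → X → ℝ) (G : ℕ → X → Y → ℝ) (D : ℕ → Y → ℝ) (p : ℝ≥0∞)
    (U : Lp ℝ p μ →ₗ.[ℝ] Lp ℝ p μ) (UG : ℕ → X → Y → ℝ) : Prop where
  sends : ∀ ℓ y, Sends U (fun x => G ℓ x y) (fun x => UG ℓ x y)
  measurable : ∀ ℓ x, AEStronglyMeasurable (UG ℓ x) μY
  integrable : ∀ ℓ, ∀ᵐ x ∂μ, Integrable (fun y => UG ℓ x y * D ℓ y) μY
  sends_phi : ∀ ℓ, Sends U (φ ℓ) (fun x => ∫ y, UG ℓ x y * D ℓ y ∂μY)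

/-- The quantity `T_n(γ, β)`. -/
def tConst (q β γ : ℝ) (n : ℕ) : ℝ :=
  if γ < q / 2 + β then (2 : ℝ) ^ (n * (q / 2 + β - γ))
  else if γ = q / 2 + β then n
  else 1

/-- `𝐆_n`: supremum of the uniform norms of the `U_k(G)(ℓ; ∘, y)`, over `lam ℓ < 2 ^ n`. -/
def supConst {X Y : Type*} [MeasurableSpace X] (μ : Measure X) (lam : ℕ → ℝ) {J : ℕ}
    (UG : Fin J → ℕ → X → Y → ℝ) (n : ℕ) : ℝ≥0∞ :=
  ⨆ (k : Fin J) (ℓ : ℕ) (_ : lam ℓ < (2 : ℝ) ^ n) (y : Y),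
    eLpNorm (fun x => UG k ℓ x y) ⊤ μ

/-- `𝐋_n`: supremum of the `Lip(α)` norms of the `U_k(G)(ℓ; ∘, y)`, over `lam ℓ < 2 ^ n`. -/
def lipConst {X Y : Type*} [MetricSpace X] [MeasurableSpace X] (μ : Measure X) (lam : ℕ → ℝ)
    (α : ℝ) {J : ℕ} (UG : Fin J → ℕ → X → Y → ℝ) (n : ℕ) : ℝ≥0∞ :=
  ⨆ (k : Fin J) (ℓ : ℕ) (_ : lam ℓ < (2 : ℝ) ^ n) (y : Y),
    lipNorm μ α (fun x => UG k ℓ x y)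

end

/-! Split `f` into dyadic spectral blocks, replace `U f` by the image of finitely many of them, read
that image as integration against a signed measure, and sample the measure at random.

The blocks are differences of smooth spectral cutoffs. Cutoffs are bounded on every `L^p` once their
kernels are bounded in `L^1` uniformly in the scale, and this is extracted from the Gaussian bound
alone (`IsDataSpace.exists_cutoff_kernel_bound`). With `s` the eigenvalue of the heat operator at
time `τ ^ 2`, the cutoff is `Ψ s`, where `Ψ s / s` has a rapidly convergent Chebyshev series. The
kernel of `T_m(s) s` has `L^1` norm polynomial in `m`: an exponentially weighted norm grows
geometrically in `m` but is needed only at distance of order `m τ`, while an `L^2` bound is enough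
inside that ball. Near-best approximation then makes the `j`-th block of size `2 ^ (-jγ)` in
`L^max(p,2)` (`IsDataSpace.exists_block_decomposition`).

The Bernstein inequality gives `U` of the blocks a geometric decay of ratio `2 ^ (-(γ - a))`, and
closedness of `U` sums the series (`IsDerivativeLike.exists_sends_of_blocks`). So `U f` differs from
`U` of the first `n + 1` blocks by the required order.

Compatibility writes the latter as a finite sum of integrals of `U(G)` against coefficients times
`𝒟_G φ_ℓ`. The total variation is at most a constant times `T_n ‖f‖_W`, by Cauchy–Schwarz in each
block, the count of eigenvalues below `2 ^ j`, and the `L^2` bound on `𝒟_G φ_ℓ`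
(`IsDataSpace.exists_sum_coeff_mul_integral_le`). Normalizing gives a probability measure on signed
points; Hoeffding's inequality with a union bound over a finite net of `X`, followed by Hölder
continuity off the net, yields one sample good for all operators at once
(`exists_signed_sample_of_holder`). The net has `O(ε ^ (-q))` points because balls have mass at
least of order `r ^ q`, and this is where the absence of common zeros enters
(`IsDataSpace.exists_le_measure_closedBall`). -/

/-! ### Fourier and Chebyshev series of smooth functions -/

theorem fourierCoeffOn_deriv_of_periodic {g : ℝ → ℂ} (hg : ContDiff ℝ 1 g)
    (hper : Function.Periodic g (2 * Real.pi)) (n : ℤ) :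
    (n : ℂ) * Complex.I * fourierCoeffOn Real.two_pi_pos g n =
      fourierCoeffOn Real.two_pi_pos (deriv g) n := by
  rcases eq_or_ne n 0 with rfl | hn
  · have hint : ∫ x in (0 : ℝ)..(2 * Real.pi), deriv g x = g (2 * Real.pi) - g 0 :=
      intervalIntegral.integral_deriv_eq_sub
        (fun x _ => (hg.differentiable one_ne_zero).differentiableAt)
        ((hg.continuous_deriv le_rfl).intervalIntegrable _ _)
    have h0 : g (2 * Real.pi) = g 0 := by simpa using hper 0
    simp [fourierCoeffOn_eq_integral, hint, h0]
  · have h := fourierCoeffOn_of_hasDerivAt Real.two_pi_pos (f := g) (f' := deriv g) hn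
      (fun x _ => (hg.differentiable one_ne_zero).differentiableAt.hasDerivAt)
      ((hg.continuous_deriv le_rfl).intervalIntegrable _ _)
    have h0 : g (2 * Real.pi) = g 0 := by simpa using hper 0
    have hn' : (n : ℂ) ≠ 0 := by exact_mod_cast hn
    have hpi : (Real.pi : ℂ) ≠ 0 := by exact_mod_cast Real.pi_ne_zero
    rw [h, h0]
    push_cast
    field_simp
    simp

theorem fourierCoeffOn_iteratedDeriv_of_periodic {g : ℝ → ℂ} (N : ℕ) (hg : ContDiff ℝ N g)
    (hper : Function.Periodic g (2 * Real.pi)) (n : ℤ) :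
    ((n : ℂ) * Complex.I) ^ N * fourierCoeffOn Real.two_pi_pos g n =
      fourierCoeffOn Real.two_pi_pos (iteratedDeriv N g) n := by
  induction N generalizing g with
  | zero => simp
  | succ N ih =>
    have h1 : ContDiff ℝ 1 g := hg.of_le (by exact_mod_cast Nat.le_add_left 1 N)
    have h2 : ContDiff ℝ N (deriv g) := by
      have : ContDiff ℝ ((N : WithTop ℕ∞) + 1) g := by exact_mod_cast hg
      exact (contDiff_succ_iff_deriv.1 this).2.2
    have h3 : Function.Periodic (deriv g) (2 * Real.pi) := by
      intro x
      rw [← deriv_comp_add_const]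
      congr 1
      exact funext hper
    rw [iteratedDeriv_succ', ← ih h2 h3, ← fourierCoeffOn_deriv_of_periodic h1 hper]
    ring

theorem exists_norm_fourierCoeffOn_le (g : ℝ → ℂ) :
    ∃ C : ℝ, ∀ n, ‖fourierCoeffOn Real.two_pi_pos g n‖ ≤ C := by
  refine ⟨1 / (2 * Real.pi) * ∫ x in (0 : ℝ)..(2 * Real.pi), ‖g x‖, fun n => ?_⟩
  rw [fourierCoeffOn_eq_integral, norm_smul, sub_zero]
  have hp := Real.two_pi_pos
  rw [Real.norm_of_nonneg (by positivity)]
  gcongr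
  refine (intervalIntegral.norm_integral_le_integral_norm hp.le).trans (le_of_eq ?_)
  congr 1
  ext x
  rw [norm_smul, fourier_apply, Circle.norm_coe, one_mul]

/-- The cosine series of a smooth even periodic function, with rapidly decaying coefficients. -/
theorem exists_rapid_cos_series {F : ℝ → ℝ} (hF : ∀ N : ℕ, ContDiff ℝ N F)
    (hper : Function.Periodic F (2 * Real.pi)) (heven : ∀ θ, F (-θ) = F θ) (N : ℕ) :
    ∃ a : ℤ → ℝ, Summable (fun m : ℤ => |a m| * (1 + (m.natAbs : ℝ)) ^ N) ∧
      ∀ θ, HasSum (fun m : ℤ => a m * Real.cos (m.natAbs * θ)) (F θ) := by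
  have : Fact (0 < 2 * Real.pi) := ⟨Real.two_pi_pos⟩
  set g : ℝ → ℂ := fun θ => (F θ : ℂ) with hgdef
  have hg : ∀ N : ℕ, ContDiff ℝ N g := fun N => Complex.ofRealCLM.contDiff.comp (hF N)
  have hgper : Function.Periodic g (2 * Real.pi) := fun θ => by simp [hgdef, hper θ]
  set c : ℤ → ℂ := fun n => fourierCoeffOn Real.two_pi_pos g n with hc
  have hdecay : ∀ K : ℕ, ∃ C : ℝ, ∀ n : ℤ, (n.natAbs : ℝ) ^ K * ‖c n‖ ≤ C := by
    intro K
    obtain ⟨C, hC⟩ := exists_norm_fourierCoeffOn_le (iteratedDeriv K g)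
    refine ⟨C, fun n => ?_⟩
    have := hC n
    rw [← fourierCoeffOn_iteratedDeriv_of_periodic K (hg K) hgper n] at this
    simpa [norm_mul, norm_pow, Nat.cast_natAbs] using this
  have hsummable : Summable (fun m : ℤ => ‖c m‖ * (1 + (m.natAbs : ℝ)) ^ N) := by
    -- Two powers beyond the weight leave the summable majorant `1 / m ^ 2`; the index `m = 0`,
    -- where it degenerates, is discarded.
    obtain ⟨C, hC⟩ := hdecay (N + 2)
    have hs : Summable (fun m : ℤ => C * 2 ^ N * (1 / (m : ℝ) ^ 2)) :=
      (Real.summable_one_div_int_pow.2 one_lt_two).mul_left _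
    refine Summable.of_norm_bounded_eventually hs ?_
    rw [Filter.eventually_cofinite]
    refine (Set.finite_singleton (0 : ℤ)).subset fun m hm => ?_
    by_contra hm0
    apply hm
    have hm1 : (1 : ℝ) ≤ m.natAbs := by
      exact_mod_cast Nat.one_le_iff_ne_zero.2 (Int.natAbs_ne_zero.2 hm0)
    have hsq : (m : ℝ) ^ 2 = (m.natAbs : ℝ) ^ 2 := by simp [Nat.cast_natAbs]
    rw [Real.norm_of_nonneg (by positivity), hsq, mul_one_div, le_div_iff₀ (by positivity)]
    calc ‖c m‖ * (1 + (m.natAbs : ℝ)) ^ N * (m.natAbs : ℝ) ^ 2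
        ≤ ‖c m‖ * (2 * (m.natAbs : ℝ)) ^ N * (m.natAbs : ℝ) ^ 2 := by gcongr; linarith
      _ = ((m.natAbs : ℝ) ^ (N + 2) * ‖c m‖) * 2 ^ N := by ring
      _ ≤ C * 2 ^ N := by gcongr; exact hC m
  have hnorm : Summable (fun m : ℤ => ‖c m‖) := by
    refine Summable.of_nonneg_of_le (fun m => norm_nonneg _) (fun m => ?_) hsummable
    exact le_mul_of_one_le_right (norm_nonneg _) (one_le_pow₀ (by simp))
  let G : C(AddCircle (2 * Real.pi), ℂ) :=
    ⟨hgper.lift, continuous_coinduced_dom.mpr (hg 0).continuous⟩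
  have hGc : fourierCoeff G = c := by
    ext n
    rw [hc]
    simp only [fourierCoeffOn_eq_integral]
    rw [fourierCoeff_eq_intervalIntegral _ n 0]
    simp [G]
  refine ⟨fun m => (c m).re, ?_, fun θ => ?_⟩
  · refine Summable.of_nonneg_of_le (fun m => by positivity) (fun m => ?_) hsummable
    gcongr
    exact Complex.abs_re_le_norm _
  · have key : ∀ θ : ℝ, HasSum (fun m : ℤ => (c m).re * Real.cos (m * θ)
        - (c m).im * Real.sin (m * θ)) (F θ) := by
      intro θ
      have h := has_pointwise_sum_fourier_series_of_summable (f := G)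
        (by rw [hGc]; exact hnorm.of_norm) (θ : AddCircle (2 * Real.pi))
      have h2 := Complex.hasSum_re h
      rw [hGc] at h2
      convert! h2 using 1
      ext m
      rw [fourier_coe_apply, smul_eq_mul, Complex.mul_re]
      have : 2 * (Real.pi : ℂ) * Complex.I * m * θ / ((2 * Real.pi : ℝ) : ℂ)
          = ((m * θ : ℝ) : ℂ) * Complex.I := by
        have hpi : (Real.pi : ℂ) ≠ 0 := by exact_mod_cast Real.pi_ne_zero
        push_cast
        field_simp
      rw [this, Complex.exp_ofReal_mul_I_re, Complex.exp_ofReal_mul_I_im]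
    -- Evenness of `F`: averaging over `θ` and `-θ` removes the sine terms.
    have h := ((key θ).add (key (-θ))).mul_left (1 / 2)
    rw [heven] at h
    convert! h using 1
    · ext m
      have : Real.cos (m.natAbs * θ) = Real.cos (m * θ) := by
        rcases Int.natAbs_eq m with h | h <;> rw [h] <;> simp [Real.cos_neg]
      rw [this]
      simp only [mul_neg, Real.cos_neg, Real.sin_neg]
      ring
    · ring

/-- A smooth cutoff together with a Chebyshev expansion: `Ψ = 1` on `[exp (-1/4), ∞)`, `Ψ = 0` on
`(-∞, exp (-1)]`, and `Ψ s / s` is a rapidly converging Chebyshev series. -/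
theorem exists_cutoff_chebyshev (N : ℕ) :
    ∃ (Ψ : ℝ → ℝ) (a : ℤ → ℝ), (∀ s, Real.exp (-(1 / 4)) ≤ s → Ψ s = 1) ∧
      (∀ s, s ≤ Real.exp (-1) → Ψ s = 0) ∧ (∀ s, 0 ≤ Ψ s ∧ Ψ s ≤ 1) ∧
      Summable (fun m : ℤ => |a m| * (1 + (m.natAbs : ℝ)) ^ N) ∧
      ∀ s, 0 ≤ s → s ≤ 1 → HasSum
        (fun m : ℤ => a m * (s * (Polynomial.Chebyshev.T ℝ m.natAbs).eval s)) (Ψ s) := by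
  have he : Real.exp (-1) < Real.exp (-(1 / 4)) := Real.exp_lt_exp.2 (by norm_num)
  set d := Real.exp (-(1 / 4)) - Real.exp (-1) with hd
  have hd0 : 0 < d := sub_pos.2 he
  set Ψ : ℝ → ℝ := fun s => Real.smoothTransition ((s - Real.exp (-1)) / d) with hΨ
  have hΨ1 : ∀ s, Real.exp (-(1 / 4)) ≤ s → Ψ s = 1 := fun s hs =>
    Real.smoothTransition.one_of_one_le (by rw [le_div_iff₀ hd0]; linarith)
  have hΨ0 : ∀ s, s ≤ Real.exp (-1) → Ψ s = 0 := fun s hs =>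
    Real.smoothTransition.zero_of_nonpos (div_nonpos_of_nonpos_of_nonneg (by linarith) hd0.le)
  -- The quotient is smooth at the origin because `Ψ` vanishes on a neighbourhood of it.
  have hΦ : ∀ K : ℕ, ContDiff ℝ K (fun s => Ψ s / s) := by
    intro K
    rw [contDiff_iff_contDiffAt]
    intro s
    rcases eq_or_ne s 0 with rfl | hs
    · refine (contDiffAt_const (c := (0 : ℝ))).congr_of_eventuallyEq ?_
      filter_upwards [Iio_mem_nhds (Real.exp_pos (-1))] with s hs
      rw [hΨ0 s (le_of_lt hs), zero_div]
    · refine ContDiffAt.div ?_ contDiffAt_id hs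
      refine (Real.smoothTransition.contDiffAt).comp s ?_
      exact (contDiffAt_id.sub contDiffAt_const).div_const _
  -- Under `s = cos θ` a Chebyshev series is a cosine series. Dividing by `s` first leaves a factor
  -- `s` in every term, so each term will be dominated by the heat kernel and have a convergent
  -- kernel series.
  obtain ⟨a, ha, hsum⟩ := exists_rapid_cos_series (F := fun θ => Ψ (Real.cos θ) / Real.cos θ)
    (fun K => (hΦ K).comp Real.contDiff_cos) (fun θ => by simp) (fun θ => by simp) N
  refine ⟨Ψ, a, hΨ1, hΨ0, fun s => ⟨Real.smoothTransition.nonneg _,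
    Real.smoothTransition.le_one _⟩, ha, fun s hs0 hs1 => ?_⟩
  have h := (hsum (Real.arccos s)).mul_left s
  have hcos : Real.cos (Real.arccos s) = s := Real.cos_arccos (by linarith) hs1
  rw [hcos] at h
  have hval : s * (Ψ s / s) = Ψ s := by
    rcases eq_or_ne s 0 with rfl | hs
    · simp [hΨ0 0 (Real.exp_pos _).le]
    · field_simp
  rw [hval] at h
  convert! h using 1
  ext m
  have := Polynomial.Chebyshev.T_real_cos (Real.arccos s) m.natAbs
  rw [hcos] at this
  rw [this]
  rw [Int.cast_natCast]
  ring

theorem abs_chebyshev_T_eval_le_one (m : ℤ) {s : ℝ} (hs : 0 ≤ s) (hs1 : s ≤ 1) :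
    |(Polynomial.Chebyshev.T ℝ m).eval s| ≤ 1 := by
  have := Polynomial.Chebyshev.T_real_cos (Real.arccos s) m
  rw [Real.cos_arccos (by linarith) hs1] at this
  rw [this]
  exact Real.abs_cos_le_one _

/-! ### Kernels dominated by a diagonal bound -/

/-- The kernel `∑ c k φ k x φ k y`. -/
noncomputable def spectralKernel {X : Type*} (φ : ℕ → X → ℝ) (c : ℕ → ℝ) (x y : X) : ℝ :=
  ∑' k, c k * φ k x * φ k y

/-- The sequence `s` is nonnegative and `∑ s k φ k x ^ 2 ≤ D` for all `x`. -/
structure IsDiagonalBound {X : Type*} (φ : ℕ → X → ℝ) (s : ℕ → ℝ) (D : ℝ) : Prop where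
  nonneg : ∀ k, 0 ≤ s k
  le_one : ∀ k, s k ≤ 1
  sum_le : ∀ (F : Finset ℕ) (x : X), ∑ k ∈ F, s k * φ k x ^ 2 ≤ D

namespace IsDiagonalBound

variable {X : Type*} {φ : ℕ → X → ℝ} {s c c' : ℕ → ℝ} {D : ℝ}

/-- The inequality `2|uv| ≤ u ^ 2 + v ^ 2` reduces everything off the diagonal to the diagonal. All
convergence and domination arguments for these kernels rest on this uniform bound. -/
theorem sum_abs_le (h : IsDiagonalBound φ s D) (hc : ∀ k, |c k| ≤ s k) (F : Finset ℕ) (x y : X) :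
    ∑ k ∈ F, |c k * φ k x * φ k y| ≤ D := by
  have h1 : ∑ k ∈ F, |c k * φ k x * φ k y| ≤
      ∑ k ∈ F, (1 / 2 * (s k * φ k x ^ 2) + 1 / 2 * (s k * φ k y ^ 2)) := by
    refine Finset.sum_le_sum fun k _ => ?_
    rw [abs_mul, abs_mul]
    have h2 : |φ k x| * |φ k y| ≤ 1 / 2 * φ k x ^ 2 + 1 / 2 * φ k y ^ 2 := by
      rw [← sq_abs (φ k x), ← sq_abs (φ k y)]
      nlinarith [sq_nonneg (|φ k x| - |φ k y|)]
    calc |c k| * |φ k x| * |φ k y| = |c k| * (|φ k x| * |φ k y|) := by ring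
      _ ≤ s k * (1 / 2 * φ k x ^ 2 + 1 / 2 * φ k y ^ 2) := by
        gcongr
        · exact h.nonneg k
        · exact hc k
      _ = _ := by ring
  rw [Finset.sum_add_distrib, ← Finset.mul_sum, ← Finset.mul_sum] at h1
  linarith [h.sum_le F x, h.sum_le F y]

theorem summable (h : IsDiagonalBound φ s D) (hc : ∀ k, |c k| ≤ s k) (x y : X) :
    Summable (fun k => c k * φ k x * φ k y) :=
  (summable_of_sum_le (fun _ => abs_nonneg _) (fun F => h.sum_abs_le hc F x y)).of_abs

theorem tendsto_kernel (h : IsDiagonalBound φ s D) (hc : ∀ k, |c k| ≤ s k) (x y : X) :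
    Tendsto (fun N => ∑ k ∈ Finset.range N, c k * φ k x * φ k y) atTop
      (𝓝 (spectralKernel φ c x y)) :=
  (h.summable hc x y).hasSum.tendsto_sum_nat

theorem abs_partial_le (h : IsDiagonalBound φ s D) (hc : ∀ k, |c k| ≤ s k) (F : Finset ℕ)
    (x y : X) : |∑ k ∈ F, c k * φ k x * φ k y| ≤ D :=
  (Finset.abs_sum_le_sum_abs _ _).trans (h.sum_abs_le hc F x y)

theorem abs_kernel_le (h : IsDiagonalBound φ s D) (hc : ∀ k, |c k| ≤ s k) (x y : X) :
    |spectralKernel φ c x y| ≤ D :=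
  le_of_tendsto (h.tendsto_kernel hc x y).abs (Eventually.of_forall fun _ =>
    h.abs_partial_le hc _ x y)

variable [MetricSpace X] [CompactSpace X] [MeasurableSpace X] [BorelSpace X]

theorem measurable_kernel (h : IsDiagonalBound φ s D) (hφ : ∀ k, Continuous (φ k))
    (hc : ∀ k, |c k| ≤ s k) : Measurable (fun z : X × X => spectralKernel φ c z.1 z.2) := by
  refine measurable_of_tendsto_metrizable (f := fun N (z : X × X) =>
    ∑ k ∈ Finset.range N, c k * φ k z.1 * φ k z.2) (fun N => ?_)
    (tendsto_pi_nhds.2 fun z => h.tendsto_kernel hc z.1 z.2)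
  refine Continuous.measurable ?_
  have := fun k => (hφ k)
  fun_prop

theorem measurable_kernel_right (h : IsDiagonalBound φ s D) (hφ : ∀ k, Continuous (φ k))
    (hc : ∀ k, |c k| ≤ s k) (x : X) : Measurable (spectralKernel φ c x) :=
  (h.measurable_kernel hφ hc).comp measurable_prodMk_left

variable {μ : Measure X} [IsProbabilityMeasure μ]

theorem integral_kernel_mul_phi (h : IsDiagonalBound φ s D) (hφ : ∀ k, Continuous (φ k))
    (horth : ∀ j k, ∫ x, φ j x * φ k x ∂μ = if j = k then 1 else 0)
    (hc : ∀ k, |c k| ≤ s k) (x : X) (j : ℕ) :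
    ∫ z, spectralKernel φ c x z * φ j z ∂μ = c j * φ j x := by
  have hlim : Tendsto (fun N => ∫ z, (∑ k ∈ Finset.range N, c k * φ k x * φ k z) * φ j z ∂μ) atTop
      (𝓝 (∫ z, spectralKernel φ c x z * φ j z ∂μ)) := by
    refine tendsto_integral_of_dominated_convergence (fun z => D * |φ j z|) (fun N => ?_) ?_
      (fun N => ?_) ?_
    · refine Continuous.aestronglyMeasurable ?_
      have := fun k => (hφ k)
      fun_prop
    · exact ((continuous_const.mul (hφ j).abs).integrable_of_hasCompactSupport
        (HasCompactSupport.of_compactSpace _))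
    · filter_upwards with z
      rw [Real.norm_eq_abs, abs_mul]
      gcongr
      exact h.abs_partial_le hc _ x z
    · filter_upwards with z
      exact (h.tendsto_kernel hc x z).mul_const _
  refine tendsto_nhds_unique hlim (tendsto_const_nhds.congr' ?_)
  filter_upwards [eventually_gt_atTop j] with N hN
  have hint : ∀ k ∈ Finset.range N, Integrable (fun z => c k * φ k x * (φ k z * φ j z)) μ :=
    fun k _ => ((continuous_const.mul ((hφ k).mul (hφ j))).integrable_of_hasCompactSupport
        (HasCompactSupport.of_compactSpace _))
  have : ∀ z, (∑ k ∈ Finset.range N, c k * φ k x * φ k z) * φ j z =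
      ∑ k ∈ Finset.range N, c k * φ k x * (φ k z * φ j z) := fun z => by
    rw [Finset.sum_mul]
    exact Finset.sum_congr rfl fun k _ => by ring
  simp_rw [this]
  rw [integral_finsetSum _ hint]
  simp_rw [integral_const_mul, horth]
  simp [hN]

/-- Composition of multipliers is multiplication of coefficients. Only the second kernel is
expanded; its partial sums are bounded by `D`, so dominated convergence reduces the claim to the
action of the first kernel on each `φ k`. -/
theorem integral_kernel_mul_kernel (h : IsDiagonalBound φ s D) (hφ : ∀ k, Continuous (φ k))
    (horth : ∀ j k, ∫ x, φ j x * φ k x ∂μ = if j = k then 1 else 0)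
    (hc : ∀ k, |c k| ≤ s k) (hc' : ∀ k, |c' k| ≤ s k) (x y : X) :
    ∫ z, spectralKernel φ c x z * spectralKernel φ c' z y ∂μ =
      spectralKernel φ (fun k => c k * c' k) x y := by
  have hcc : ∀ k, |c k * c' k| ≤ s k := fun k => by
    rw [abs_mul]
    calc |c k| * |c' k| ≤ s k * 1 := by
          gcongr
          · exact h.nonneg k
          · exact hc k
          · exact (hc' k).trans (h.le_one k)
      _ = s k := mul_one _
  have hlim : Tendsto (fun N => ∫ z, spectralKernel φ c x z *
      (∑ k ∈ Finset.range N, c' k * φ k z * φ k y) ∂μ) atTop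
      (𝓝 (∫ z, spectralKernel φ c x z * spectralKernel φ c' z y ∂μ)) := by
    refine tendsto_integral_of_dominated_convergence (fun z => D * D) (fun N => ?_) ?_
      (fun N => ?_) ?_
    · refine (h.measurable_kernel_right hφ hc x).aestronglyMeasurable.mul
        (Continuous.aestronglyMeasurable ?_)
      have := fun k => (hφ k)
      fun_prop
    · exact integrable_const _
    · filter_upwards with z
      rw [Real.norm_eq_abs, abs_mul]
      have := h.abs_kernel_le hc x z
      gcongr
      · exact (abs_nonneg _).trans this
      · exact h.abs_partial_le hc' _ z y
    · filter_upwards with z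
      exact (h.tendsto_kernel hc' z y).const_mul _
  refine tendsto_nhds_unique hlim ?_
  refine (h.tendsto_kernel hcc x y).congr fun N => ?_
  have hint : ∀ k ∈ Finset.range N,
      Integrable (fun z => c' k * φ k y * (spectralKernel φ c x z * φ k z)) μ := fun k _ => by
    refine Integrable.const_mul ?_ _
    refine Integrable.bdd_mul (c := D) ((hφ k).integrable_of_hasCompactSupport
      (HasCompactSupport.of_compactSpace _))
      (h.measurable_kernel_right hφ hc x).aestronglyMeasurable ?_
    filter_upwards with z
    exact h.abs_kernel_le hc x z
  have : ∀ z, spectralKernel φ c x z * (∑ k ∈ Finset.range N, c' k * φ k z * φ k y) =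
      ∑ k ∈ Finset.range N, c' k * φ k y * (spectralKernel φ c x z * φ k z) := fun z => by
    rw [Finset.mul_sum]
    exact Finset.sum_congr rfl fun k _ => by ring
  simp_rw [this]
  rw [integral_finsetSum _ hint]
  simp_rw [integral_const_mul, h.integral_kernel_mul_phi hφ horth hc]
  exact Finset.sum_congr rfl fun k _ => by ring

/-- By symmetry and composition the integral is the diagonal value at `x` of the kernel with
coefficients `c k ^ 2`, and `c k ^ 2 ≤ s k` because `s k ≤ 1`. -/
theorem lintegral_sq_kernel_le (h : IsDiagonalBound φ s D) (hφ : ∀ k, Continuous (φ k))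
    (horth : ∀ j k, ∫ x, φ j x * φ k x ∂μ = if j = k then 1 else 0)
    (hc : ∀ k, |c k| ≤ s k) (x : X) :
    ∫⁻ z, ‖spectralKernel φ c x z‖ₑ ^ 2 ∂μ ≤ ENNReal.ofReal D := by
  have hsq : ∀ k, c k * c k ≤ s k := fun k => by
    have h1 := hc k
    have h2 := h.le_one k
    have h3 := abs_nonneg (c k)
    rw [← abs_mul_abs_self]
    nlinarith
  have hb : ∀ z, ‖spectralKernel φ c x z‖ₑ ^ 2 =
      ENNReal.ofReal (spectralKernel φ c x z * spectralKernel φ c z x) := fun z => by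
    have : spectralKernel φ c z x = spectralKernel φ c x z := by
      unfold spectralKernel
      congr 1
      ext k
      ring
    rw [this, ← abs_mul_abs_self, ENNReal.ofReal_mul (abs_nonneg _), Real.enorm_eq_ofReal_abs, sq]
  simp_rw [hb]
  have hint : Integrable (fun z => spectralKernel φ c x z * spectralKernel φ c z x) μ := by
    refine Integrable.of_bound (C := D * D) ?_ ?_
    · exact ((h.measurable_kernel_right hφ hc x).mul
        ((h.measurable_kernel hφ hc).comp measurable_prodMk_right)).aestronglyMeasurable
    · filter_upwards with z
      rw [Real.norm_eq_abs, abs_mul]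
      have := h.abs_kernel_le hc x z
      have := h.abs_kernel_le hc z x
      gcongr
      exact (abs_nonneg _).trans this
  have hnn : ∀ z, 0 ≤ spectralKernel φ c x z * spectralKernel φ c z x := fun z => by
    have : spectralKernel φ c z x = spectralKernel φ c x z := by
      unfold spectralKernel
      congr 1
      ext k
      ring
    rw [this]
    exact mul_self_nonneg _
  rw [← ofReal_integral_eq_lintegral_ofReal hint (ae_of_all _ hnn),
    h.integral_kernel_mul_kernel hφ horth hc hc]
  refine ENNReal.ofReal_le_ofReal ((le_abs_self _).trans (h.abs_kernel_le (fun k => ?_) x x))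
  rw [abs_mul_self]
  exact hsq k

end IsDiagonalBound

/-! ### Chebyshev polynomials of the heat operator and the cutoff kernel -/

/-- The triangle inequality makes the weight `exp (dist x y / τ)` submultiplicative along `x, z, y`,
so the weighted `L^1` norm is submultiplicative under composition of kernels. -/
theorem lintegral_weight_integral_comp_le {X : Type*} [MetricSpace X] [CompactSpace X]
    [MeasurableSpace X] [BorelSpace X] {μ : Measure X} [IsProbabilityMeasure μ]
    {K u : X → X → ℝ} (hK : Measurable (fun z : X × X => K z.1 z.2))
    (hu : Measurable (fun z : X × X => u z.1 z.2)) {τ : ℝ} (hτ : 0 < τ) {A B : ℝ≥0∞}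
    (hA : ∀ x, ∫⁻ y, ‖K x y‖ₑ * ENNReal.ofReal (Real.exp (dist x y / τ)) ∂μ ≤ A)
    (hB : ∀ x, ∫⁻ y, ‖u x y‖ₑ * ENNReal.ofReal (Real.exp (dist x y / τ)) ∂μ ≤ B) (x : X) :
    ∫⁻ y, ‖∫ z, K x z * u z y ∂μ‖ₑ * ENNReal.ofReal (Real.exp (dist x y / τ)) ∂μ ≤ A * B := by
  set w : X → X → ℝ≥0∞ := fun x y => ENNReal.ofReal (Real.exp (dist x y / τ)) with hw
  have hwm : Measurable (fun z : X × X => w z.1 z.2) := by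
    refine Measurable.ennreal_ofReal (Continuous.measurable ?_)
    fun_prop
  have hws : ∀ y z, w x y ≤ w x z * w z y := fun y z => by
    simp only [hw]
    rw [← ENNReal.ofReal_mul (Real.exp_pos _).le, ← Real.exp_add, ← add_div]
    gcongr
    exact dist_triangle _ _ _
  have hmx : Measurable fun z => ‖K x z‖ₑ * w x z :=
    ((hK.comp measurable_prodMk_left).enorm).mul (hwm.comp measurable_prodMk_left)
  have hmu : Measurable fun z : X × X => ‖u z.1 z.2‖ₑ * w z.1 z.2 := hu.enorm.mul hwm
  calc ∫⁻ y, ‖∫ z, K x z * u z y ∂μ‖ₑ * w x y ∂μ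
      ≤ ∫⁻ y, (∫⁻ z, (‖K x z‖ₑ * w x z) * (‖u z y‖ₑ * w z y) ∂μ) ∂μ := by
        refine lintegral_mono fun y => ?_
        calc ‖∫ z, K x z * u z y ∂μ‖ₑ * w x y
            ≤ (∫⁻ z, ‖K x z * u z y‖ₑ ∂μ) * w x y := by
              gcongr
              exact enorm_integral_le_lintegral_enorm _
          _ = ∫⁻ z, ‖K x z * u z y‖ₑ * w x y ∂μ := by
              rw [lintegral_mul_const]
              exact ((hK.comp measurable_prodMk_left).mul (hu.comp measurable_prodMk_right)).enorm
          _ ≤ _ := by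
              refine lintegral_mono fun z => ?_
              rw [enorm_mul]
              calc ‖K x z‖ₑ * ‖u z y‖ₑ * w x y ≤ ‖K x z‖ₑ * ‖u z y‖ₑ * (w x z * w z y) := by
                    gcongr
                    exact hws y z
                _ = _ := by ring
    _ = ∫⁻ z, (∫⁻ y, (‖K x z‖ₑ * w x z) * (‖u z y‖ₑ * w z y) ∂μ) ∂μ := by
        rw [lintegral_lintegral_swap]
        refine Measurable.aemeasurable ?_
        exact (hmx.comp measurable_snd).mul (hmu.comp measurable_swap)
    _ = ∫⁻ z, (‖K x z‖ₑ * w x z) * (∫⁻ y, ‖u z y‖ₑ * w z y ∂μ) ∂μ := by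
        refine lintegral_congr fun z => ?_
        rw [lintegral_const_mul]
        exact hmu.comp measurable_prodMk_left
    _ ≤ ∫⁻ z, (‖K x z‖ₑ * w x z) * B ∂μ := by
        gcongr with z
        exact hB z
    _ = (∫⁻ z, ‖K x z‖ₑ * w x z ∂μ) * B := by rw [lintegral_mul_const _ hmx]
    _ ≤ A * B := by
        gcongr
        exact hA x

/-- The eigenvalue `exp (-lam k ^ 2 τ ^ 2)` of the heat operator at time `τ ^ 2`. -/
noncomputable def heatCoeff (lam : ℕ → ℝ) (τ : ℝ) (k : ℕ) : ℝ := Real.exp (-(lam k) ^ 2 * τ ^ 2)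

theorem heatCoeff_pos (lam : ℕ → ℝ) (τ : ℝ) (k : ℕ) : 0 < heatCoeff lam τ k := Real.exp_pos _

theorem heatCoeff_le_one (lam : ℕ → ℝ) (τ : ℝ) (k : ℕ) : heatCoeff lam τ k ≤ 1 := by
  rw [heatCoeff, Real.exp_le_one_iff]
  nlinarith [mul_nonneg (sq_nonneg (lam k)) (sq_nonneg τ)]

theorem abs_heatCoeff_le (lam : ℕ → ℝ) (τ : ℝ) (k : ℕ) :
    |heatCoeff lam τ k| ≤ heatCoeff lam τ k := (abs_of_pos (heatCoeff_pos lam τ k)).le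

/-- The coefficients of the `m`-th Chebyshev polynomial of the heat operator, applied to the heat
kernel. -/
noncomputable def chebCoeff (lam : ℕ → ℝ) (τ : ℝ) (m : ℕ) (k : ℕ) : ℝ :=
  (Polynomial.Chebyshev.T ℝ m).eval (heatCoeff lam τ k) * heatCoeff lam τ k

theorem abs_chebCoeff_le (lam : ℕ → ℝ) (τ : ℝ) (m k : ℕ) :
    |chebCoeff lam τ m k| ≤ heatCoeff lam τ k := by
  rw [chebCoeff, abs_mul, abs_of_pos (heatCoeff_pos lam τ k)]
  exact mul_le_of_le_one_left (heatCoeff_pos lam τ k).le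
    (abs_chebyshev_T_eval_le_one _ (heatCoeff_pos lam τ k).le (heatCoeff_le_one lam τ k))

theorem summable_gaussian_mul_rpow {b q : ℝ} (hb : 0 < b) (hq : 0 ≤ q) :
    Summable (fun i : ℕ => Real.exp (-b * (i : ℝ) ^ 2 + i + 1) * ((i : ℝ) + 1) ^ q) := by
  refine Summable.of_nonneg_of_le (fun i => by positivity) (fun i => ?_)
    (Real.summable_exp_neg_nat.mul_left (Real.exp (1 + (2 + q) ^ 2 / (4 * b))))
  have h1 : ((i : ℝ) + 1) ^ q ≤ Real.exp (i * q) := by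
    rw [Real.exp_mul]
    gcongr
    exact Real.add_one_le_exp _
  calc Real.exp (-b * (i : ℝ) ^ 2 + i + 1) * ((i : ℝ) + 1) ^ q
      ≤ Real.exp (-b * (i : ℝ) ^ 2 + i + 1) * Real.exp (i * q) := by gcongr
    _ = Real.exp (-b * (i : ℝ) ^ 2 + i + 1 + i * q) := (Real.exp_add _ _).symm
    _ ≤ Real.exp (1 + (2 + q) ^ 2 / (4 * b) + -(i : ℝ)) := by
      rw [Real.exp_le_exp]
      -- Completing the square absorbs all linear growth into the Gaussian, with one more `i` to
      -- spare for the geometric majorant.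
      have : (2 + q) ^ 2 / (4 * b) - (2 + q) * i + b * (i : ℝ) ^ 2 =
          ((2 + q) - 2 * b * i) ^ 2 / (4 * b) := by
        field_simp
        ring
      have h2 : 0 ≤ ((2 + q) - 2 * b * i) ^ 2 / (4 * b) := by positivity
      linarith
    _ = _ := Real.exp_add _ _

namespace IsDataSpace

variable {X : Type*} [MetricSpace X] [CompactSpace X] [MeasurableSpace X] [BorelSpace X]
  {μ : Measure X} [IsProbabilityMeasure μ] {lam : ℕ → ℝ} {φ : ℕ → X → ℝ} {q : ℝ}

theorem lam_nonneg (hX : IsDataSpace μ lam φ q) (k : ℕ) : 0 ≤ lam k :=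
  hX.lam_zero ▸ hX.lam_mono (Nat.zero_le k)

theorem exponent_pos (hX : IsDataSpace μ lam φ q) : 0 < q := one_pos.trans_le hX.one_le_exponent

/-- The Gaussian hypothesis at `t = τ ^ 2`. On the diagonal the exponential factor is `1` and the
terms are nonnegative, so the bound on the full sum bounds every finite one. -/
theorem exists_heat_bound (hX : IsDataSpace μ lam φ q) :
    ∃ κ₁ κ₂ : ℝ, 0 < κ₁ ∧ 0 < κ₂ ∧ ∀ τ : ℝ, 0 < τ → τ ≤ 1 →
      IsDiagonalBound φ (heatCoeff lam τ) (κ₁ * τ ^ (-q)) ∧ ∀ x y,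
        |spectralKernel φ (heatCoeff lam τ) x y| ≤
          κ₁ * τ ^ (-q) * Real.exp (-(κ₂ * (dist x y / τ) ^ 2)) := by
  obtain ⟨κ₁, κ₂, h1, h2, h⟩ := hX.gaussian_bound
  refine ⟨κ₁, κ₂, h1, h2, fun τ hτ hτ1 => ?_⟩
  have hpow : (τ ^ 2) ^ (-q / 2) = τ ^ (-q) := by
    rw [← Real.rpow_natCast, ← Real.rpow_mul hτ.le]
    congr 1
    push_cast
    ring
  have hh : ∀ x y, Summable (fun k => heatCoeff lam τ k * φ k x * φ k y) ∧
      |spectralKernel φ (heatCoeff lam τ) x y| ≤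
          κ₁ * τ ^ (-q) * Real.exp (-(κ₂ * (dist x y / τ) ^ 2)) := fun x y => by
    have := h x y (τ ^ 2) (by positivity) (pow_le_one₀ hτ.le hτ1)
    rw [hpow, mul_div_assoc, ← div_pow] at this
    exact this
  refine ⟨⟨fun k => (heatCoeff_pos _ _ _).le, heatCoeff_le_one lam τ, fun F x => ?_⟩,
    fun x y => (hh x y).2⟩
  have h3 := (hh x x).2
  simp only [dist_self, zero_div, ne_eq, OfNat.ofNat_ne_zero, not_false_eq_true, zero_pow,
    mul_zero, neg_zero, Real.exp_zero, mul_one] at h3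
  refine le_trans ?_ ((le_abs_self _).trans h3)
  have hterm : ∀ k, heatCoeff lam τ k * φ k x * φ k x = heatCoeff lam τ k * φ k x ^ 2 :=
    fun k => by ring
  unfold spectralKernel
  simp_rw [hterm]
  refine Summable.sum_le_tsum F (fun k _ => mul_nonneg (heatCoeff_pos _ _ _).le (sq_nonneg _)) ?_
  exact (hh x x).1.congr hterm

/-- Where `dist x y / τ` has integer part `i`, the weighted kernel is at most `τ ^ (-q)` times a
Gaussian in `i`, and the enclosing ball has mass at most of order `((i + 1) τ) ^ q`. The powers of
`τ` cancel and the sum over `i` converges. -/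
theorem exists_lintegral_heat_weight_le (hX : IsDataSpace μ lam φ q) :
    ∃ A : ℝ, 1 ≤ A ∧ ∀ τ : ℝ, 0 < τ → τ ≤ 1 → ∀ x,
      ∫⁻ y, ‖spectralKernel φ (heatCoeff lam τ) x y‖ₑ * ENNReal.ofReal (Real.exp (dist x y / τ)) ∂μ
        ≤ ENNReal.ofReal A := by
  obtain ⟨κ₁, κ₂, h1, h2, h⟩ := hX.exists_heat_bound
  obtain ⟨κ, hκ, hball⟩ := hX.ball_measure
  have hq := hX.exponent_pos
  have hsum := summable_gaussian_mul_rpow h2 hq.le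
  set S := ∑' i : ℕ, Real.exp (-κ₂ * (i : ℝ) ^ 2 + i + 1) * ((i : ℝ) + 1) ^ q with hS
  have hS0 : 0 ≤ S := tsum_nonneg fun i => by positivity
  -- The added `1` provides `1 ≤ A`, which the Chebyshev recursion needs.
  refine ⟨1 + κ₁ * κ * S, by have : 0 ≤ κ₁ * κ * S := by positivity
                             linarith, fun τ hτ hτ1 x => ?_⟩
  have hpt : ∀ y, ‖spectralKernel φ (heatCoeff lam τ) x y‖ₑ *
      ENNReal.ofReal (Real.exp (dist x y / τ)) ≤ ∑' i : ℕ,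
        (Metric.closedBall x (((i : ℝ) + 1) * τ)).indicator (fun _ => ENNReal.ofReal
          (κ₁ * τ ^ (-q) * Real.exp (-κ₂ * (i : ℝ) ^ 2 + i + 1))) y := by
    intro y
    set r := dist x y / τ with hr
    have hr0 : 0 ≤ r := by positivity
    refine le_trans ?_ (ENNReal.le_tsum ⌊r⌋₊)
    have hmem : y ∈ Metric.closedBall x (((⌊r⌋₊ : ℝ) + 1) * τ) := by
      rw [Metric.mem_closedBall, dist_comm, ← div_le_iff₀ hτ]
      exact (Nat.lt_floor_add_one r).le
    rw [Set.indicator_of_mem hmem, Real.enorm_eq_ofReal_abs, ← ENNReal.ofReal_mul (abs_nonneg _)]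
    refine ENNReal.ofReal_le_ofReal ?_
    calc |spectralKernel φ (heatCoeff lam τ) x y| * Real.exp r
        ≤ κ₁ * τ ^ (-q) * Real.exp (-(κ₂ * r ^ 2)) * Real.exp r := by
          gcongr
          exact (h τ hτ hτ1).2 x y
      _ = κ₁ * τ ^ (-q) * Real.exp (-κ₂ * r ^ 2 + r) := by
          rw [mul_assoc, ← Real.exp_add]
          ring_nf
      _ ≤ _ := by
          have hf := Nat.floor_le hr0
          have hf' := (Nat.lt_floor_add_one r).le
          have : (⌊r⌋₊ : ℝ) ^ 2 ≤ r ^ 2 := by gcongr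
          gcongr κ₁ * τ ^ (-q) * Real.exp ?_
          nlinarith
  calc _ ≤ ∫⁻ y, ∑' i : ℕ, (Metric.closedBall x (((i : ℝ) + 1) * τ)).indicator
          (fun _ => ENNReal.ofReal (κ₁ * τ ^ (-q) * Real.exp (-κ₂ * (i : ℝ) ^ 2 + i + 1))) y ∂μ :=
        lintegral_mono hpt
    _ = ∑' i : ℕ, ENNReal.ofReal (κ₁ * τ ^ (-q) * Real.exp (-κ₂ * (i : ℝ) ^ 2 + i + 1)) *
          μ (Metric.closedBall x (((i : ℝ) + 1) * τ)) := by
        rw [lintegral_tsum fun i => (measurable_const.indicator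
          Metric.isClosed_closedBall.measurableSet).aemeasurable]
        congr 1
        ext i
        rw [lintegral_indicator_const Metric.isClosed_closedBall.measurableSet]
    _ ≤ ∑' i : ℕ, ENNReal.ofReal (κ₁ * κ *
          (Real.exp (-κ₂ * (i : ℝ) ^ 2 + i + 1) * ((i : ℝ) + 1) ^ q)) := by
        refine ENNReal.tsum_le_tsum fun i => ?_
        refine (mul_le_mul_right (hball x _ (by positivity)) _).trans ?_
        rw [← ENNReal.ofReal_mul (by positivity)]
        refine ENNReal.ofReal_le_ofReal (le_of_eq ?_)
        rw [Real.mul_rpow (by positivity) hτ.le, Real.rpow_neg hτ.le]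
        have : τ ^ q ≠ 0 := (Real.rpow_pos_of_pos hτ q).ne'
        field_simp
    _ = ENNReal.ofReal (κ₁ * κ * S) := by
        rw [← ENNReal.ofReal_tsum_of_nonneg (fun i => by positivity) (hsum.mul_left _),
          tsum_mul_left]
    _ ≤ _ := ENNReal.ofReal_le_ofReal (by linarith)

/-- The recursion `T_{m+2} = 2 s T_{m+1} - T_m` costs one composition with the heat kernel, hence a
factor `2 A`, plus an earlier term. The ratio `3 A` closes the induction since `6 A ^ 2 + 1 ≤ 9 A ^
2`. -/
theorem lintegral_chebyshev_weight_le (hX : IsDataSpace μ lam φ q) {D τ A : ℝ} (hτ : 0 < τ)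
    (hA : 1 ≤ A) (hD : IsDiagonalBound φ (heatCoeff lam τ) D)
    (h : ∀ x, ∫⁻ y, ‖spectralKernel φ (heatCoeff lam τ) x y‖ₑ *
      ENNReal.ofReal (Real.exp (dist x y / τ)) ∂μ ≤ ENNReal.ofReal A) (m : ℕ) :
    ∀ x, ∫⁻ y, ‖spectralKernel φ (chebCoeff lam τ m) x y‖ₑ *
      ENNReal.ofReal (Real.exp (dist x y / τ)) ∂μ ≤ ENNReal.ofReal (A * (3 * A) ^ m) := by
  have hφ := hX.phi_continuous
  have horth := hX.phi_orthonormal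
  have hcomp : ∀ (m : ℕ) (x y : X), spectralKernel φ
      (fun k => heatCoeff lam τ k * chebCoeff lam τ m k) x y =
      ∫ z, spectralKernel φ (heatCoeff lam τ) x z * spectralKernel φ (chebCoeff lam τ m) z y ∂μ :=
    fun m x y => (hD.integral_kernel_mul_kernel hφ horth (abs_heatCoeff_le lam τ)
      (abs_chebCoeff_le lam τ m) x y).symm
  have hstep : ∀ (m : ℕ) (B : ℝ≥0∞), (∀ x, ∫⁻ y, ‖spectralKernel φ (chebCoeff lam τ m) x y‖ₑ *
      ENNReal.ofReal (Real.exp (dist x y / τ)) ∂μ ≤ B) → ∀ x, ∫⁻ y, ‖spectralKernel φ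
      (fun k => heatCoeff lam τ k * chebCoeff lam τ m k) x y‖ₑ *
      ENNReal.ofReal (Real.exp (dist x y / τ)) ∂μ ≤ ENNReal.ofReal A * B := fun m B hB x => by
    simp_rw [hcomp]
    exact lintegral_weight_integral_comp_le (hD.measurable_kernel hφ (abs_heatCoeff_le lam τ))
      (hD.measurable_kernel hφ (abs_chebCoeff_le lam τ m)) hτ h hB x
  have h0 : chebCoeff lam τ 0 = heatCoeff lam τ := by
    ext k
    simp [chebCoeff]
  have h1 : chebCoeff lam τ 1 = fun k => heatCoeff lam τ k * chebCoeff lam τ 0 k := by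
    ext k
    simp [chebCoeff]
  have hrec : ∀ m k, chebCoeff lam τ (m + 2) k =
      2 * (heatCoeff lam τ k * chebCoeff lam τ (m + 1) k) - chebCoeff lam τ m k := fun m k => by
    simp only [chebCoeff, Nat.cast_add, Nat.cast_ofNat, Nat.cast_one,
      Polynomial.Chebyshev.T_add_two]
    simp
    ring
  induction m using Nat.strong_induction_on with
  | _ m ih =>
    match m, ih with
    | 0, _ => simpa [h0] using h
    | 1, ih =>
      rw [h1]
      intro x
      refine (hstep 0 _ (ih 0 one_pos) x).trans ?_
      rw [← ENNReal.ofReal_mul (by positivity)]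
      refine ENNReal.ofReal_le_ofReal ?_
      simp only [pow_zero, mul_one, pow_one]
      nlinarith
    | m + 2, ih =>
      intro x
      have hsc : ∀ k, |heatCoeff lam τ k * chebCoeff lam τ (m + 1) k| ≤ heatCoeff lam τ k := by
        intro k
        rw [abs_mul, abs_of_pos (heatCoeff_pos lam τ k)]
        exact mul_le_of_le_one_right (heatCoeff_pos lam τ k).le
          ((abs_chebCoeff_le lam τ _ k).trans (heatCoeff_le_one lam τ k))
      have hker : ∀ y, spectralKernel φ (chebCoeff lam τ (m + 2)) x y =
          2 * spectralKernel φ (fun k => heatCoeff lam τ k * chebCoeff lam τ (m + 1) k) x y -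
            spectralKernel φ (chebCoeff lam τ m) x y := fun y => by
        unfold spectralKernel
        rw [← tsum_mul_left, ← Summable.tsum_sub ((hD.summable hsc x y).mul_left 2)
          (hD.summable (abs_chebCoeff_le lam τ m) x y)]
        congr 1
        ext k
        rw [hrec]
        ring
      set w : X → ℝ≥0∞ := fun y => ENNReal.ofReal (Real.exp (dist x y / τ)) with hw
      have hwm : Measurable w := by
        refine Measurable.ennreal_ofReal (Continuous.measurable ?_)
        fun_prop
      calc ∫⁻ y, ‖spectralKernel φ (chebCoeff lam τ (m + 2)) x y‖ₑ * w y ∂μ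
          ≤ ∫⁻ y, (2 * (‖spectralKernel φ
              (fun k => heatCoeff lam τ k * chebCoeff lam τ (m + 1) k) x y‖ₑ * w y) +
              ‖spectralKernel φ (chebCoeff lam τ m) x y‖ₑ * w y) ∂μ := by
            refine lintegral_mono fun y => ?_
            rw [← mul_assoc, ← add_mul]
            gcongr
            rw [hker, sub_eq_add_neg]
            refine (enorm_add_le _ _).trans (le_of_eq ?_)
            rw [enorm_mul, enorm_neg]
            congr 2
            simp [Real.enorm_eq_ofReal_abs]
        _ = 2 * (∫⁻ y, ‖spectralKernel φ
              (fun k => heatCoeff lam τ k * chebCoeff lam τ (m + 1) k) x y‖ₑ * w y ∂μ) +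
              ∫⁻ y, ‖spectralKernel φ (chebCoeff lam τ m) x y‖ₑ * w y ∂μ := by
            have hm1 : Measurable fun y => ‖spectralKernel φ (chebCoeff lam τ m) x y‖ₑ * w y :=
              ((hD.measurable_kernel_right hφ (abs_chebCoeff_le lam τ m) x).enorm).mul hwm
            rw [lintegral_add_right _ hm1, lintegral_const_mul]
            exact ((hD.measurable_kernel_right hφ hsc x).enorm).mul hwm
        _ ≤ 2 * (ENNReal.ofReal A * ENNReal.ofReal (A * (3 * A) ^ (m + 1))) +
              ENNReal.ofReal (A * (3 * A) ^ m) := by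
            gcongr
            · exact hstep (m + 1) _ (ih (m + 1) (by omega)) x
            · exact ih m (by omega) x
        _ = ENNReal.ofReal (2 * (A * (A * (3 * A) ^ (m + 1))) + A * (3 * A) ^ m) := by
            rw [ENNReal.ofReal_add (by positivity) (by positivity),
              ENNReal.ofReal_mul (p := 2) (by positivity), ENNReal.ofReal_ofNat,
              ← ENNReal.ofReal_mul (p := A) (by positivity)]
        _ ≤ _ := by
            refine ENNReal.ofReal_le_ofReal ?_
            have hp : 0 ≤ A * (3 * A) ^ m := by positivity
            have : 0 ≤ A * (3 * A) ^ m * (3 * A ^ 2 - 1) := mul_nonneg hp (by nlinarith)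
            calc 2 * (A * (A * (3 * A) ^ (m + 1))) + A * (3 * A) ^ m
                = A * (3 * A) ^ m * (6 * A ^ 2 + 1) := by ring
              _ ≤ A * (3 * A) ^ m * (9 * A ^ 2) := by linarith
              _ = _ := by ring

/-- Geometric growth would defeat every polynomially weighted coefficient sum. It is avoided by
using the weighted bound only outside the ball of radius `R (m + 1) τ`, where the weight itself pays
for it. Inside, the `L^2` bound and the mass of the ball give the polynomial growth `(1 + m) ^ q`.
-/
theorem exists_lintegral_chebyshev_le (hX : IsDataSpace μ lam φ q) :
    ∃ (C : ℝ) (N : ℕ), 0 ≤ C ∧ ∀ τ : ℝ, 0 < τ → τ ≤ 1 → ∀ (m : ℕ) (x : X),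
      ∫⁻ y, ‖spectralKernel φ (chebCoeff lam τ m) x y‖ₑ ∂μ ≤
        ENNReal.ofReal (C * (1 + (m : ℝ)) ^ N) := by
  obtain ⟨κ₁, κ₂, h1, h2, h⟩ := hX.exists_heat_bound
  obtain ⟨κ, hκ, hball⟩ := hX.ball_measure
  obtain ⟨A, hA, hAw⟩ := hX.exists_lintegral_heat_weight_le
  have hq := hX.exponent_pos
  -- This value makes `exp (-R (m + 1))` equal to `(3 A) ^ (-(m + 1))`, cancelling the growth of the
  -- weighted norm.
  set R := Real.log (3 * A) with hR
  have hR0 : 0 < R := Real.log_pos (by linarith)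
  refine ⟨κ * R ^ q + κ₁ + A, ⌈q⌉₊, by positivity, fun τ hτ hτ1 m x => ?_⟩
  obtain ⟨hD, -⟩ := h τ hτ hτ1
  have hu := hX.lintegral_chebyshev_weight_le hτ hA hD (hAw τ hτ hτ1) m x
  have hsq := hD.lintegral_sq_kernel_le hX.phi_continuous hX.phi_orthonormal
    (abs_chebCoeff_le lam τ m) x
  have hmeas := hD.measurable_kernel_right hX.phi_continuous (abs_chebCoeff_le lam τ m) x
  set u := spectralKernel φ (chebCoeff lam τ m) x with hudef
  set r := R * (m + 1) * τ with hr
  have hr0 : 0 < r := by positivity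
  have hτq : 0 < τ ^ q := Real.rpow_pos_of_pos hτ q
  have hτq' : τ ^ (-q) = (τ ^ q)⁻¹ := Real.rpow_neg hτ.le q
  -- In the ball, `|u| ≤ τ ^ (-q) + τ ^ q u ^ 2` stands in for Cauchy–Schwarz, balanced so that both
  -- integrals are independent of `τ`. Outside it, the exponential weight exceeds `exp (R (m + 1))`.
  have hpt : ∀ y, ‖u y‖ₑ ≤ (Metric.closedBall x r).indicator (fun _ => ENNReal.ofReal (τ ^ (-q))) y +
      ENNReal.ofReal (τ ^ q) * ‖u y‖ₑ ^ 2 + ENNReal.ofReal (Real.exp (-(R * (m + 1)))) *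
        (‖u y‖ₑ * ENNReal.ofReal (Real.exp (dist x y / τ))) := by
    intro y
    by_cases hy : y ∈ Metric.closedBall x r
    · rw [Set.indicator_of_mem hy]
      refine le_trans ?_ le_self_add
      rw [Real.enorm_eq_ofReal_abs, ← ENNReal.ofReal_pow (abs_nonneg _),
        ← ENNReal.ofReal_mul hτq.le, ← ENNReal.ofReal_add (by positivity) (by positivity)]
      refine ENNReal.ofReal_le_ofReal ?_
      rw [hτq', ← sub_nonneg]
      have : (τ ^ q)⁻¹ + τ ^ q * |u y| ^ 2 - |u y| =
          (τ ^ q)⁻¹ * ((τ ^ q * |u y| - 1 / 2) ^ 2 + 3 / 4) := by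
        field_simp
        ring
      rw [this]
      positivity
    · refine le_trans ?_ le_add_self
      rw [mul_left_comm, ← ENNReal.ofReal_mul (Real.exp_pos _).le, ← Real.exp_add]
      refine le_mul_of_one_le_right (zero_le) ?_
      rw [ENNReal.one_le_ofReal, Real.one_le_exp_iff]
      rw [Metric.mem_closedBall, not_le, dist_comm] at hy
      have : R * (m + 1) ≤ dist x y / τ := by
        rw [le_div_iff₀ hτ]
        exact hy.le
      linarith
  have hexp : Real.exp (-(R * (m + 1))) * (A * (3 * A) ^ m) ≤ A := by
    have : Real.exp (R * (m + 1)) = (3 * A) ^ (m + 1) := by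
      rw [mul_comm, ← Nat.cast_succ, Real.exp_nat_mul, hR, Real.exp_log (by linarith)]
    rw [Real.exp_neg, this, inv_mul_le_iff₀ (by positivity)]
    have hp : 0 ≤ A * (3 * A) ^ m := by positivity
    calc A * (3 * A) ^ m ≤ A * (3 * A) ^ m * (3 * A) := le_mul_of_one_le_right hp (by linarith)
      _ = _ := by ring
  have hN : (1 + (m : ℝ)) ^ q ≤ (1 + (m : ℝ)) ^ ⌈q⌉₊ := by
    rw [← Real.rpow_natCast]
    exact Real.rpow_le_rpow_of_exponent_le (by linarith [Nat.cast_nonneg (α := ℝ) m])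
      (Nat.le_ceil q)
  have hN1 : 1 ≤ (1 + (m : ℝ)) ^ ⌈q⌉₊ := one_le_pow₀ (by linarith [Nat.cast_nonneg (α := ℝ) m])
  calc ∫⁻ y, ‖u y‖ₑ ∂μ ≤ _ := lintegral_mono hpt
    _ = ENNReal.ofReal (τ ^ (-q)) * μ (Metric.closedBall x r) +
        ENNReal.ofReal (τ ^ q) * (∫⁻ y, ‖u y‖ₑ ^ 2 ∂μ) + ENNReal.ofReal (Real.exp (-(R * (m + 1)))) *
        ∫⁻ y, (‖u y‖ₑ * ENNReal.ofReal (Real.exp (dist x y / τ))) ∂μ := by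
      have hm1 : Measurable fun y => ‖u y‖ₑ * ENNReal.ofReal (Real.exp (dist x y / τ)) := by
        refine hmeas.enorm.mul (Measurable.ennreal_ofReal (Continuous.measurable ?_))
        fun_prop
      rw [lintegral_add_right _ (hm1.const_mul _), lintegral_add_right _
        ((hmeas.enorm.pow_const 2).const_mul _), lintegral_const_mul _ hm1, lintegral_const_mul _
        (hmeas.enorm.pow_const 2), lintegral_indicator_const Metric.isClosed_closedBall.measurableSet]
    _ ≤ ENNReal.ofReal (τ ^ (-q)) * ENNReal.ofReal (κ * r ^ q) +
        ENNReal.ofReal (τ ^ q) * ENNReal.ofReal (κ₁ * τ ^ (-q)) +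
        ENNReal.ofReal (Real.exp (-(R * (m + 1)))) * ENNReal.ofReal (A * (3 * A) ^ m) := by
      gcongr
      exact hball x r hr0
    _ = ENNReal.ofReal (κ * R ^ q * (1 + m) ^ q + κ₁ +
          Real.exp (-(R * (m + 1))) * (A * (3 * A) ^ m)) := by
      rw [ENNReal.ofReal_add (by positivity) (by positivity),
        ENNReal.ofReal_add (by positivity) (by positivity), ← ENNReal.ofReal_mul (by positivity),
        ← ENNReal.ofReal_mul (by positivity), ← ENNReal.ofReal_mul (by positivity), hr,
        Real.mul_rpow (by positivity) hτ.le, Real.mul_rpow hR0.le (by positivity), hτq']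
      congr 3
      · field_simp
        ring_nf
      · field_simp
    _ ≤ _ := by
      refine ENNReal.ofReal_le_ofReal ?_
      have e1 : κ * R ^ q * (1 + (m : ℝ)) ^ q ≤ κ * R ^ q * (1 + (m : ℝ)) ^ ⌈q⌉₊ := by gcongr
      have e2 : κ₁ ≤ κ₁ * (1 + (m : ℝ)) ^ ⌈q⌉₊ := le_mul_of_one_le_right h1.le hN1
      have e3 : A ≤ A * (1 + (m : ℝ)) ^ ⌈q⌉₊ := le_mul_of_one_le_right (by linarith) hN1
      rw [add_mul, add_mul]
      linarith

/-- The polynomial bound on the `m`-th Chebyshev kernel fixes the exponent `N`, and the coefficients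
`a m` are then chosen summable against that weight. Interchanging the sums over `m` and `k` is
legitimate because the terms are dominated by `|a m|` times those of the heat kernel. -/
theorem exists_cutoff_kernel_bound (hX : IsDataSpace μ lam φ q) :
    ∃ (Ψ : ℝ → ℝ) (C : ℝ), 0 ≤ C ∧ (∀ s, Real.exp (-(1 / 4)) ≤ s → Ψ s = 1) ∧
      (∀ s, s ≤ Real.exp (-1) → Ψ s = 0) ∧ (∀ s, 0 ≤ Ψ s ∧ Ψ s ≤ 1) ∧
      ∀ τ : ℝ, 0 < τ → τ ≤ 1 → ∀ x,
        ∫⁻ y, ‖spectralKernel φ (fun k => Ψ (heatCoeff lam τ k)) x y‖ₑ ∂μ ≤ ENNReal.ofReal C := by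
  obtain ⟨C, N, hC, hbound⟩ := hX.exists_lintegral_chebyshev_le
  obtain ⟨Ψ, a, hΨ1, hΨ0, hΨ01, ha, hsum⟩ := exists_cutoff_chebyshev N
  obtain ⟨κ₁, κ₂, -, -, h⟩ := hX.exists_heat_bound
  refine ⟨Ψ, C * ∑' m : ℤ, |a m| * (1 + (m.natAbs : ℝ)) ^ N,
    mul_nonneg hC (tsum_nonneg fun m => by positivity), hΨ1, hΨ0, hΨ01, fun τ hτ hτ1 x => ?_⟩
  obtain ⟨hD, -⟩ := h τ hτ hτ1
  have ha' : Summable (fun m => |a m|) := by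
    refine Summable.of_nonneg_of_le (fun m => abs_nonneg _) (fun m => ?_) ha
    exact le_mul_of_one_le_right (abs_nonneg _) (one_le_pow₀ (by simp))
  have hker : ∀ y, spectralKernel φ (fun k => Ψ (heatCoeff lam τ k)) x y =
      ∑' m : ℤ, a m * spectralKernel φ (chebCoeff lam τ m.natAbs) x y := by
    intro y
    have hs : Summable (fun k => |heatCoeff lam τ k * φ k x * φ k y|) :=
      (hD.summable (abs_heatCoeff_le lam τ) x y).abs
    have hprod : Summable (Function.uncurry fun (m : ℤ) (k : ℕ) =>
        a m * (chebCoeff lam τ m.natAbs k * φ k x * φ k y)) := by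
      refine Summable.of_norm_bounded (ha'.mul_of_nonneg hs (fun _ => abs_nonneg _)
        (fun _ => abs_nonneg _)) fun z => ?_
      simp only [Function.uncurry, Real.norm_eq_abs, abs_mul]
      rw [abs_of_pos (heatCoeff_pos lam τ _)]
      gcongr
      exact abs_chebCoeff_le lam τ _ _
    unfold spectralKernel
    simp_rw [← tsum_mul_left]
    rw [← hprod.tsum_comm]
    congr 1
    ext k
    rw [← (hsum _ (heatCoeff_pos lam τ k).le (heatCoeff_le_one lam τ k)).tsum_eq, mul_assoc,
      ← tsum_mul_right]
    congr 1
    ext m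
    rw [chebCoeff]
    ring
  calc ∫⁻ y, ‖spectralKernel φ (fun k => Ψ (heatCoeff lam τ k)) x y‖ₑ ∂μ
      ≤ ∫⁻ y, ∑' m : ℤ, ‖a m‖ₑ * ‖spectralKernel φ (chebCoeff lam τ m.natAbs) x y‖ₑ ∂μ := by
        refine lintegral_mono fun y => ?_
        rw [hker]
        refine enorm_tsum_le_tsum_enorm.trans (le_of_eq ?_)
        simp_rw [enorm_mul]
    _ = ∑' m : ℤ, ‖a m‖ₑ * ∫⁻ y, ‖spectralKernel φ (chebCoeff lam τ m.natAbs) x y‖ₑ ∂μ := by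
        have hm : ∀ m : ℤ, Measurable fun y => ‖spectralKernel φ (chebCoeff lam τ m.natAbs) x y‖ₑ :=
          fun m => (hD.measurable_kernel_right hX.phi_continuous (abs_chebCoeff_le lam τ _) x).enorm
        rw [lintegral_tsum fun m => ((hm m).const_mul _).aemeasurable]
        congr 1
        ext m
        rw [lintegral_const_mul _ (hm m)]
    _ ≤ ∑' m : ℤ, ENNReal.ofReal (C * (|a m| * (1 + (m.natAbs : ℝ)) ^ N)) := by
        refine ENNReal.tsum_le_tsum fun m => ?_
        refine (mul_le_mul_right (hbound τ hτ hτ1 m.natAbs x) _).trans (le_of_eq ?_)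
        rw [Real.enorm_eq_ofReal_abs, ← ENNReal.ofReal_mul (abs_nonneg _)]
        congr 1
        ring
    _ = _ := by
        rw [← ENNReal.ofReal_tsum_of_nonneg (fun m => by positivity) (ha.mul_left _),
          tsum_mul_left]

end IsDataSpace

/-! ### Schur's test and spectral multipliers on `L^p` -/

/-- Comparison of the `L^1` and `L^r` norms for the finite-mass density `k` with respect to `μ`. -/
theorem lintegral_mul_enorm_rpow_le {X : Type*} [MeasurableSpace X] {μ : Measure X}
    [SFinite μ] {k : X → ℝ≥0∞} (hk : Measurable k) {g : X → ℝ} (hg : Measurable g)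
    {r : ℝ} (hr : 1 ≤ r) {C : ℝ≥0∞} (hC : ∫⁻ y, k y ∂μ ≤ C) :
    (∫⁻ y, k y * ‖g y‖ₑ ∂μ) ^ r ≤ C ^ (r - 1) * ∫⁻ y, k y * ‖g y‖ₑ ^ r ∂μ := by
  have hr0 : 0 < r := by linarith
  have h := eLpNorm'_le_eLpNorm'_mul_rpow_measure_univ (μ := μ.withDensity k) one_pos hr
    hg.aestronglyMeasurable
  rw [eLpNorm'_eq_lintegral_enorm, eLpNorm'_eq_lintegral_enorm] at h
  simp only [ENNReal.rpow_one, div_one] at h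
  rw [lintegral_withDensity_eq_lintegral_mul _ hk hg.enorm,
    lintegral_withDensity_eq_lintegral_mul _ hk (hg.enorm.pow_const r),
    withDensity_apply _ MeasurableSet.univ, Measure.restrict_univ] at h
  calc (∫⁻ y, k y * ‖g y‖ₑ ∂μ) ^ r
      ≤ ((∫⁻ y, k y * ‖g y‖ₑ ^ r ∂μ) ^ (1 / r) * C ^ (1 - 1 / r)) ^ r := by
        refine ENNReal.rpow_le_rpow (h.trans ?_) hr0.le
        gcongr
        · exact le_rfl
        · rw [sub_nonneg, div_le_one hr0]
          exact hr
    _ = _ := by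
        rw [ENNReal.mul_rpow_of_nonneg _ _ hr0.le, ← ENNReal.rpow_mul, ← ENNReal.rpow_mul,
          one_div_mul_cancel hr0.ne', ENNReal.rpow_one, mul_comm]
        congr 2
        field_simp

/-- **Schur's test** for symmetric kernels. -/
theorem eLpNorm_integral_kernel_le {X : Type*} [MeasurableSpace X] {μ : Measure X}
    [SFinite μ] {K : X → X → ℝ} (hK : Measurable (fun z : X × X => K z.1 z.2))
    (hsymm : ∀ x y, K x y = K y x) {C : ℝ≥0∞} (hC : ∀ x, ∫⁻ y, ‖K x y‖ₑ ∂μ ≤ C)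
    {p : ℝ≥0∞} (hp : 1 ≤ p) {f : X → ℝ} (hf : AEStronglyMeasurable f μ) :
    eLpNorm (fun x => ∫ y, K x y * f y ∂μ) p μ ≤ C * eLpNorm f p μ := by
  have hKx : ∀ x, Measurable (fun y => ‖K x y‖ₑ) := fun x =>
    (hK.comp measurable_prodMk_left).enorm
  have hb : ∀ x, ‖∫ y, K x y * f y ∂μ‖ₑ ≤ ∫⁻ y, ‖K x y‖ₑ * ‖f y‖ₑ ∂μ := fun x => by
    refine (enorm_integral_le_lintegral_enorm _).trans (le_of_eq ?_)
    simp_rw [enorm_mul]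
  rcases eq_or_ne p ∞ with rfl | hp'
  · simp only [eLpNorm_exponent_top]
    refine eLpNormEssSup_le_of_ae_enorm_bound (ae_of_all _ fun x => (hb x).trans ?_)
    calc ∫⁻ y, ‖K x y‖ₑ * ‖f y‖ₑ ∂μ ≤ ∫⁻ y, ‖K x y‖ₑ * eLpNormEssSup f μ ∂μ := by
          refine lintegral_mono_ae ?_
          filter_upwards [enorm_ae_le_eLpNormEssSup f μ] with y hy
          gcongr
      _ = (∫⁻ y, ‖K x y‖ₑ ∂μ) * eLpNormEssSup f μ := lintegral_mul_const _ (hKx x)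
      _ ≤ _ := by
          gcongr
          exact hC x
  · have hp0 : p ≠ 0 := (one_pos.trans_le hp).ne'
    set r := p.toReal with hr
    have hr1 : 1 ≤ r := by
      rw [hr, ← ENNReal.toReal_one]
      exact (ENNReal.toReal_le_toReal ENNReal.one_ne_top hp').2 hp
    have hr0 : 0 < r := by linarith
    set g := hf.mk f with hgdef
    have hg : Measurable g := hf.stronglyMeasurable_mk.measurable
    have hfg : f =ᵐ[μ] g := hf.ae_eq_mk
    rw [eLpNorm_congr_ae hfg, eLpNorm_eq_lintegral_rpow_enorm_toReal hp0 hp',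
      eLpNorm_eq_lintegral_rpow_enorm_toReal hp0 hp', ← hr]
    have hmain : ∫⁻ x, ‖∫ y, K x y * f y ∂μ‖ₑ ^ r ∂μ ≤ C ^ r * ∫⁻ y, ‖g y‖ₑ ^ r ∂μ := by
      calc ∫⁻ x, ‖∫ y, K x y * f y ∂μ‖ₑ ^ r ∂μ
          ≤ ∫⁻ x, C ^ (r - 1) * ∫⁻ y, ‖K x y‖ₑ * ‖g y‖ₑ ^ r ∂μ ∂μ := by
            refine lintegral_mono fun x => ?_
            refine le_trans ?_ (lintegral_mul_enorm_rpow_le (hKx x) hg hr1 (hC x))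
            refine ENNReal.rpow_le_rpow ((hb x).trans (le_of_eq ?_)) hr0.le
            refine lintegral_congr_ae ?_
            filter_upwards [hfg] with y hy
            rw [hy]
        _ = C ^ (r - 1) * ∫⁻ x, ∫⁻ y, ‖K x y‖ₑ * ‖g y‖ₑ ^ r ∂μ ∂μ := by
            rw [lintegral_const_mul]
            exact Measurable.lintegral_prod_right
              (hK.enorm.mul ((hg.enorm.pow_const r).comp measurable_snd))
        _ = C ^ (r - 1) * ∫⁻ y, ∫⁻ x, ‖K x y‖ₑ * ‖g y‖ₑ ^ r ∂μ ∂μ := by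
            rw [lintegral_lintegral_swap]
            exact (hK.enorm.mul ((hg.enorm.pow_const r).comp measurable_snd)).aemeasurable
        _ ≤ C ^ (r - 1) * ∫⁻ y, C * ‖g y‖ₑ ^ r ∂μ := by
            gcongr with y
            simp_rw [fun x => hsymm x y]
            rw [lintegral_mul_const _ (hKx y)]
            gcongr
            exact hC y
        _ = C ^ (r - 1) * C * ∫⁻ y, ‖g y‖ₑ ^ r ∂μ := by
            rw [lintegral_const_mul _ (hg.enorm.pow_const r), mul_assoc]
        _ = _ := by
            congr 1
            nth_rw 2 [← ENNReal.rpow_one C]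
            rw [← ENNReal.rpow_add_of_nonneg _ _ (by linarith) zero_le_one, sub_add_cancel]
    calc (∫⁻ x, ‖∫ y, K x y * f y ∂μ‖ₑ ^ r ∂μ) ^ (1 / r)
        ≤ (C ^ r * ∫⁻ y, ‖g y‖ₑ ^ r ∂μ) ^ (1 / r) :=
          ENNReal.rpow_le_rpow hmain (by positivity)
      _ = _ := by
          rw [ENNReal.mul_rpow_of_nonneg _ _ (by positivity), ← ENNReal.rpow_mul,
            mul_one_div_cancel hr0.ne', ENNReal.rpow_one]

/-- The spectral multiplier `f ↦ ∑ c k ⟨f, φ k⟩ φ k`. -/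
noncomputable def spectralMult {X : Type*} [MeasurableSpace X] (μ : Measure X) (φ : ℕ → X → ℝ)
    (c : ℕ → ℝ) (f : X → ℝ) (x : X) : ℝ :=
  ∑' k, c k * (∫ y, f y * φ k y ∂μ) * φ k x

theorem continuous_of_mem_span {X : Type*} [TopologicalSpace X] {φ : ℕ → X → ℝ}
    (hφ : ∀ k, Continuous (φ k)) {S : Set ℕ} {P : X → ℝ}
    (hP : P ∈ Submodule.span ℝ (φ '' S)) : Continuous P := by
  induction hP using Submodule.span_induction with
  | mem x hx =>
    obtain ⟨k, -, rfl⟩ := hx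
    exact hφ k
  | zero => exact continuous_const
  | add x y _ _ hx hy => exact hx.add hy
  | smul a x _ hx => exact hx.const_smul a

section

variable {X : Type*} [MeasurableSpace X] {μ : Measure X} {φ : ℕ → X → ℝ} {c c' : ℕ → ℝ}

theorem spectralMult_eq_sum {F : Finset ℕ} (hF : ∀ k ∉ F, c k = 0) (f : X → ℝ) :
    spectralMult μ φ c f = ∑ k ∈ F, (c k * ∫ y, f y * φ k y ∂μ) • φ k := by
  ext x
  rw [spectralMult, tsum_eq_sum (s := F) fun k hk => by simp [hF k hk]]
  simp

theorem spectralMult_mem_span {S : Set ℕ} (hc : (Function.support c).Finite)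
    (hS : ∀ k, c k ≠ 0 → k ∈ S) (f : X → ℝ) :
    spectralMult μ φ c f ∈ Submodule.span ℝ (φ '' S) := by
  rw [spectralMult_eq_sum (F := hc.toFinset) (fun k hk => by simpa using hk)]
  refine Submodule.sum_mem _ fun k hk => Submodule.smul_mem _ _ (Submodule.subset_span ?_)
  exact ⟨k, hS k (by simpa using hk), rfl⟩

theorem spectralMult_sub_coeff (hc : (Function.support c).Finite)
    (hc' : (Function.support c').Finite) (f : X → ℝ) :
    spectralMult μ φ (fun k => c k - c' k) f = spectralMult μ φ c f - spectralMult μ φ c' f := by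
  classical
  set F := hc.toFinset ∪ hc'.toFinset with hF
  have h1 : ∀ k ∉ F, c k = 0 := fun k hk => by
    simp only [hF, Finset.mem_union, Set.Finite.mem_toFinset, not_or, Function.mem_support,
      not_not] at hk
    exact hk.1
  have h2 : ∀ k ∉ F, c' k = 0 := fun k hk => by
    simp only [hF, Finset.mem_union, Set.Finite.mem_toFinset, not_or, Function.mem_support,
      not_not] at hk
    exact hk.2
  rw [spectralMult_eq_sum h1, spectralMult_eq_sum h2, spectralMult_eq_sum (F := F)
    fun k hk => by rw [h1 k hk, h2 k hk, sub_self], ← Finset.sum_sub_distrib]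
  refine Finset.sum_congr rfl fun k _ => ?_
  rw [sub_mul, sub_smul]

variable [MetricSpace X] [CompactSpace X] [BorelSpace X]

theorem integrable_mul_phi (hφ : ∀ k, Continuous (φ k)) {f : X → ℝ} (hf : Integrable f μ) (k : ℕ) :
    Integrable (fun y => f y * φ k y) μ := by
  obtain ⟨C, hC⟩ := isCompact_univ.exists_bound_of_continuousOn (hφ k).continuousOn
  exact hf.mul_bdd (c := C) (hφ k).aestronglyMeasurable (ae_of_all _ fun x => hC x (Set.mem_univ x))

theorem spectralMult_sub (hφ : ∀ k, Continuous (φ k)) (hc : (Function.support c).Finite)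
    {f g : X → ℝ} (hf : Integrable f μ) (hg : Integrable g μ) :
    spectralMult μ φ c (f - g) = spectralMult μ φ c f - spectralMult μ φ c g := by
  have h : ∀ k ∉ hc.toFinset, c k = 0 := fun k hk => by simpa using hk
  rw [spectralMult_eq_sum h, spectralMult_eq_sum h, spectralMult_eq_sum h,
    ← Finset.sum_sub_distrib]
  refine Finset.sum_congr rfl fun k _ => ?_
  rw [← sub_smul, ← mul_sub, ← integral_sub (integrable_mul_phi hφ hf k)
    (integrable_mul_phi hφ hg k)]
  simp only [Pi.sub_apply, sub_mul]

theorem spectralMult_eq_integral (hφ : ∀ k, Continuous (φ k)) (hc : (Function.support c).Finite)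
    {f : X → ℝ} (hf : Integrable f μ) (x : X) :
    spectralMult μ φ c f x = ∫ y, spectralKernel φ c x y * f y ∂μ := by
  have h : ∀ k ∉ hc.toFinset, c k = 0 := fun k hk => by simpa using hk
  have hker : ∀ y, spectralKernel φ c x y * f y =
      ∑ k ∈ hc.toFinset, c k * φ k x * (f y * φ k y) := fun y => by
    rw [spectralKernel, tsum_eq_sum (s := hc.toFinset) fun k hk => by simp [h k hk],
      Finset.sum_mul]
    exact Finset.sum_congr rfl fun k _ => by ring
  simp_rw [hker]
  rw [integral_finsetSum _ fun k _ => (integrable_mul_phi hφ hf k).const_mul _,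
    spectralMult_eq_sum h]
  simp only [Finset.sum_apply, Pi.smul_apply, smul_eq_mul, integral_const_mul]
  exact Finset.sum_congr rfl fun k _ => by ring

variable [IsProbabilityMeasure μ]

/-- Orthonormality makes a cutoff that equals `1` on `S` reproduce the span; this is what turns
boundedness into near-best approximation. -/
theorem spectralMult_eq_self (hφ : ∀ k, Continuous (φ k))
    (horth : ∀ j k, ∫ x, φ j x * φ k x ∂μ = if j = k then 1 else 0)
    (hc : (Function.support c).Finite) {S : Set ℕ} (hS : ∀ k ∈ S, c k = 1) {P : X → ℝ}
    (hP : P ∈ Submodule.span ℝ (φ '' S)) : spectralMult μ φ c P = P := by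
  have h : ∀ k ∉ hc.toFinset, c k = 0 := fun k hk => by simpa using hk
  have hint : ∀ P ∈ Submodule.span ℝ (φ '' S), Integrable P μ := fun P hP =>
    (continuous_of_mem_span hφ hP).integrable_of_hasCompactSupport
      (HasCompactSupport.of_compactSpace _)
  induction hP using Submodule.span_induction with
  | mem x hx =>
    obtain ⟨k, hk, rfl⟩ := hx
    rw [spectralMult_eq_sum h]
    simp_rw [horth]
    rw [Finset.sum_eq_single_of_mem k (by simp [hS k hk])]
    · simp [hS k hk]
    · intro j _ hj
      simp [hj.symm]
  | zero =>
    rw [spectralMult_eq_sum h]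
    simp
  | add x y hx hy hx' hy' =>
    have := spectralMult_sub (c := c) hφ hc (hint _ (Submodule.add_mem _ hx hy)) (hint y hy)
    rw [add_sub_cancel_right, hx', hy'] at this
    exact sub_eq_iff_eq_add.1 this.symm
  | smul a x hx hx' =>
    rw [spectralMult_eq_sum h] at hx' ⊢
    nth_rw 2 [← hx']
    rw [Finset.smul_sum]
    refine Finset.sum_congr rfl fun k _ => ?_
    simp only [Pi.smul_apply, smul_eq_mul, mul_assoc, integral_const_mul, smul_smul]
    congr 1
    ring

theorem eLpNorm_spectralMult_le (hφ : ∀ k, Continuous (φ k)) (hc : (Function.support c).Finite)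
    {C : ℝ≥0∞} (hC : ∀ x, ∫⁻ y, ‖spectralKernel φ c x y‖ₑ ∂μ ≤ C) {p : ℝ≥0∞} (hp : 1 ≤ p)
    {f : X → ℝ} (hf : MemLp f p μ) :
    eLpNorm (spectralMult μ φ c f) p μ ≤ C * eLpNorm f p μ := by
  have h : ∀ k ∉ hc.toFinset, c k = 0 := fun k hk => by simpa using hk
  have hker : ∀ x y, spectralKernel φ c x y = ∑ k ∈ hc.toFinset, c k * φ k x * φ k y :=
    fun x y => tsum_eq_sum (s := hc.toFinset) fun k hk => by simp [h k hk]
  have hm : Measurable (fun z : X × X => spectralKernel φ c z.1 z.2) := by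
    simp_rw [hker]
    refine Continuous.measurable ?_
    have := fun k => (hφ k)
    fun_prop
  have he : spectralMult μ φ c f = fun x => ∫ y, spectralKernel φ c x y * f y ∂μ :=
    funext fun x => spectralMult_eq_integral hφ hc (hf.integrable hp) x
  rw [he]
  refine eLpNorm_integral_kernel_le hm (fun x y => ?_) hC hp hf.1
  rw [hker, hker]
  exact Finset.sum_congr rfl fun k _ => by ring

end

/-! ### Dyadic decomposition of the smoothness class -/

theorem heatCoeff_le_exp_neg_one {lam : ℕ → ℝ} {j k : ℕ} (h : (2 : ℝ) ^ j ≤ lam k) :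
    heatCoeff lam ((2 : ℝ) ^ j)⁻¹ k ≤ Real.exp (-1) := by
  rw [heatCoeff, Real.exp_le_exp, inv_pow, ← div_eq_mul_inv, neg_div, neg_le_neg_iff,
    one_le_div (by positivity)]
  gcongr

theorem exp_neg_quarter_le_heatCoeff {lam : ℕ → ℝ} {j k : ℕ} (h0 : 0 ≤ lam k)
    (h : lam k ≤ (2 : ℝ) ^ j / 2) :
    Real.exp (-(1 / 4)) ≤ heatCoeff lam ((2 : ℝ) ^ j)⁻¹ k := by
  rw [heatCoeff, Real.exp_le_exp, inv_pow, ← div_eq_mul_inv, neg_div, neg_le_neg_iff,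
    div_le_iff₀ (by positivity)]
  calc lam k ^ 2 ≤ ((2 : ℝ) ^ j / 2) ^ 2 := by gcongr
    _ = _ := by ring

theorem approxDegree_le_mul_sobolevNorm {X : Type*} [MeasurableSpace X] (μ : Measure X)
    (lam : ℕ → ℝ) (φ : ℕ → X → ℝ) (p : ℝ≥0∞) (γ : ℝ) (f : X → ℝ) (j : ℕ) :
    approxDegree μ lam φ p ((2 : ℝ) ^ j) f ≤
      ENNReal.ofReal ((2 : ℝ) ^ (-(j * γ))) * sobolevNorm μ lam φ p γ f := by
  have h : ENNReal.ofReal ((2 : ℝ) ^ (j * γ)) * approxDegree μ lam φ p ((2 : ℝ) ^ (j : ℝ)) f ≤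
      sobolevNorm μ lam φ p γ f :=
    (le_iSup (fun j : ℕ => ENNReal.ofReal ((2 : ℝ) ^ (j * γ)) *
      approxDegree μ lam φ p ((2 : ℝ) ^ (j : ℝ)) f) j).trans le_add_self
  rw [Real.rpow_natCast] at h
  refine le_trans (le_of_eq ?_) (mul_le_mul_right h _)
  rw [← mul_assoc, ← ENNReal.ofReal_mul (by positivity), ← Real.rpow_add two_pos,
    neg_add_cancel, Real.rpow_zero, ENNReal.ofReal_one, one_mul]

theorem eLpNorm_le_sobolevNorm {X : Type*} [MeasurableSpace X] (μ : Measure X)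
    (lam : ℕ → ℝ) (φ : ℕ → X → ℝ) (p : ℝ≥0∞) (γ : ℝ) (f : X → ℝ) :
    eLpNorm f p μ ≤ sobolevNorm μ lam φ p γ f := le_self_add

namespace IsDataSpace

variable {X : Type*} [MetricSpace X] [CompactSpace X] [MeasurableSpace X] [BorelSpace X]
  {μ : Measure X} [IsProbabilityMeasure μ] {lam : ℕ → ℝ} {φ : ℕ → X → ℝ} {q : ℝ}

theorem finite_lam_lt (hX : IsDataSpace μ lam φ q) (n : ℝ) : {k | lam k < n}.Finite := by
  have h := hX.lam_tendsto.eventually (eventually_ge_atTop n)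
  rw [← Nat.cofinite_eq_atTop, Filter.eventually_cofinite] at h
  simpa only [not_le] using h

/-- For any competitor `P`, the error for `f` equals the error for `f - P`, since `P` is reproduced;
boundedness of the multiplier and the infimum over `P` finish. -/
theorem eLpNorm_sub_spectralMult_le (hX : IsDataSpace μ lam φ q) {c : ℕ → ℝ}
    (hc : (Function.support c).Finite) {n : ℝ} (hn : ∀ k, lam k < n → c k = 1) {C : ℝ≥0∞}
    (hC' : C ≠ ∞) (hC : ∀ x, ∫⁻ y, ‖spectralKernel φ c x y‖ₑ ∂μ ≤ C) {p : ℝ≥0∞} (hp : 1 ≤ p)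
    {f : X → ℝ} (hf : MemLp f p μ) :
    eLpNorm (f - spectralMult μ φ c f) p μ ≤ (1 + C) * approxDegree μ lam φ p n f := by
  have hφ := hX.phi_continuous
  have hbound : ∀ P ∈ diffusionPoly lam φ n,
      eLpNorm (f - spectralMult μ φ c f) p μ ≤ (1 + C) * eLpNorm (f - P) p μ := by
    intro P hP
    have hPc : Continuous P := continuous_of_mem_span hφ hP
    have hPm : MemLp P p μ := hPc.memLp_of_hasCompactSupport (HasCompactSupport.of_compactSpace _)
    have hfP := hf.sub hPm
    have h1 : f - spectralMult μ φ c f = (f - P) - spectralMult μ φ c (f - P) := by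
      rw [spectralMult_sub hφ hc (hf.integrable hp) (hPm.integrable hp),
        spectralMult_eq_self hφ hX.phi_orthonormal hc hn hP]
      abel
    have hcont : Continuous (spectralMult μ φ c (f - P)) :=
      continuous_of_mem_span (S := Set.univ) hφ (spectralMult_mem_span hc (fun _ _ => trivial) _)
    rw [h1]
    calc eLpNorm ((f - P) - spectralMult μ φ c (f - P)) p μ
        ≤ eLpNorm (f - P) p μ + eLpNorm (spectralMult μ φ c (f - P)) p μ :=
          eLpNorm_sub_le hfP.1 hcont.aestronglyMeasurable hp
      _ ≤ eLpNorm (f - P) p μ + C * eLpNorm (f - P) p μ := by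
          gcongr
          exact eLpNorm_spectralMult_le hφ hc hC hp hfP
      _ = _ := by rw [add_mul, one_mul]
  unfold approxDegree
  rw [ENNReal.mul_iInf_of_ne (by simp) (by simp [hC'])]
  refine le_iInf fun P => ?_
  rw [ENNReal.mul_iInf_of_ne (by simp) (by simp [hC'])]
  exact le_iInf fun hP => hbound P hP

/-- Decomposition of a function into dyadic blocks by smooth spectral cutoffs. -/
theorem exists_block_decomposition (hX : IsDataSpace μ lam φ q) {γ : ℝ} (hγ : 0 < γ) :
    ∃ (b : ℕ → ℕ → ℝ) (C : ℝ), 0 < C ∧ (∀ j k, b j k ≠ 0 → k ∈ dyadicBlock lam j) ∧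
      ∀ p : ℝ≥0∞, 1 ≤ p → ∀ f : X → ℝ, MemLp f p μ → ∀ j : ℕ,
        eLpNorm (spectralMult μ φ (b j) f) p μ ≤
          ENNReal.ofReal (C * (2 : ℝ) ^ (-(j * γ))) * sobolevNorm μ lam φ p γ f ∧
        eLpNorm (f - ∑ i ∈ Finset.range (j + 1), spectralMult μ φ (b i) f) p μ ≤
          ENNReal.ofReal (C * (2 : ℝ) ^ (-(j * γ))) * sobolevNorm μ lam φ p γ f := by
  obtain ⟨Ψ, C, hC, hΨ1, hΨ0, -, hker⟩ := hX.exists_cutoff_kernel_bound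
  set c : ℕ → ℕ → ℝ := fun j k => Ψ (heatCoeff lam ((2 : ℝ) ^ j)⁻¹ k) with hcdef
  have hc0 : ∀ j k, (2 : ℝ) ^ j ≤ lam k → c j k = 0 := fun j k h =>
    hΨ0 _ (heatCoeff_le_exp_neg_one h)
  have hc1 : ∀ j k, lam k ≤ (2 : ℝ) ^ j / 2 → c j k = 1 := fun j k h =>
    hΨ1 _ (exp_neg_quarter_le_heatCoeff (hX.lam_nonneg k) h)
  have hcfin : ∀ j, (Function.support (c j)).Finite := fun j =>
    (hX.finite_lam_lt ((2 : ℝ) ^ j)).subset fun k hk => by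
      by_contra h
      exact hk (hc0 j k (not_lt.1 h))
  have hK : ∀ j x, ∫⁻ y, ‖spectralKernel φ (c j) x y‖ₑ ∂μ ≤ ENNReal.ofReal C := fun j x =>
    hker _ (by positivity) (inv_le_one_of_one_le₀ (one_le_pow₀ one_le_two)) x
  -- Differences of consecutive cutoffs: partial sums telescope to `c j`, and the difference
  -- vanishes where both cutoffs are `1` or both are `0`, which leaves the dyadic block.
  set b : ℕ → ℕ → ℝ := fun j k => match j with
    | 0 => c 0 k
    | j + 1 => c (j + 1) k - c j k with hbdef
  have hb : ∀ f : X → ℝ, ∀ j, spectralMult μ φ (b (j + 1)) f =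
      spectralMult μ φ (c (j + 1)) f - spectralMult μ φ (c j) f := fun f j =>
    spectralMult_sub_coeff (hcfin _) (hcfin _) f
  have hsum : ∀ f : X → ℝ, ∀ j, ∑ i ∈ Finset.range (j + 1), spectralMult μ φ (b i) f =
      spectralMult μ φ (c j) f := by
    intro f j
    induction j with
    | zero => simp [hbdef]
    | succ j ih => rw [Finset.sum_range_succ, ih, hb, add_sub_cancel]
  -- One factor `2 ^ γ` arises because cutoff `j + 1` reproduces only orders below `2 ^ j`; the
  -- other from measuring the error of cutoff `j` on the scale of block `j + 1`. The `2` adds the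
  -- two errors that make up a block.
  refine ⟨b, 2 * ((1 + C) * (2 : ℝ) ^ γ * (2 : ℝ) ^ γ), by positivity, ?_, ?_⟩
  · intro j k hjk
    rcases j with _ | j
    · refine ⟨Or.inl rfl, ?_⟩
      by_contra h
      exact hjk (hc0 0 k (by simpa using h))
    · have hpow : (2 : ℝ) ^ (((j + 1 : ℕ) : ℝ) - 2) = 2 ^ j / 2 := by
        rw [show ((j + 1 : ℕ) : ℝ) - 2 = (j : ℝ) - 1 by push_cast; ring, Real.rpow_sub two_pos,
          Real.rpow_one, Real.rpow_natCast]
      refine ⟨Or.inr ?_, ?_⟩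
      · rw [hpow]
        by_contra h
        refine hjk ?_
        have h1 : lam k ≤ (2 : ℝ) ^ j / 2 := (not_le.1 h).le
        have h2 : lam k ≤ (2 : ℝ) ^ (j + 1) / 2 := h1.trans (by
          rw [pow_succ]
          have : (0 : ℝ) < 2 ^ j := by positivity
          linarith)
        simp only [hbdef, hc1 _ _ h1, hc1 _ _ h2, sub_self]
      · rw [Real.rpow_natCast]
        by_contra h
        refine hjk ?_
        have h1 : (2 : ℝ) ^ (j + 1) ≤ lam k := not_lt.1 h
        have h2 : (2 : ℝ) ^ j ≤ lam k := (pow_le_pow_right₀ one_le_two (Nat.le_succ j)).trans h1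
        simp only [hbdef, hc0 _ _ h1, hc0 _ _ h2, sub_self]
  · intro p hp f hf
    set W := sobolevNorm μ lam φ p γ f with hW
    have h2γ : 1 ≤ (2 : ℝ) ^ γ := Real.one_le_rpow one_le_two hγ.le
    have hcont : ∀ j, Continuous (spectralMult μ φ (c j) f) := fun j =>
      continuous_of_mem_span (S := Set.univ) hX.phi_continuous
        (spectralMult_mem_span (hcfin j) (fun _ _ => trivial) _)
    have herr : ∀ j : ℕ, eLpNorm (f - spectralMult μ φ (c j) f) p μ ≤
        ENNReal.ofReal ((1 + C) * (2 : ℝ) ^ γ * (2 : ℝ) ^ (-(j * γ))) * W := by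
      intro j
      match j with
      -- There is no dyadic degree of approximation below level `0`, so the norm of `f` itself is
      -- used.
      | 0 =>
        calc eLpNorm (f - spectralMult μ φ (c 0) f) p μ
            ≤ eLpNorm f p μ + eLpNorm (spectralMult μ φ (c 0) f) p μ :=
              eLpNorm_sub_le hf.1 (hcont 0).aestronglyMeasurable hp
          _ ≤ eLpNorm f p μ + ENNReal.ofReal C * eLpNorm f p μ := by
              gcongr
              exact eLpNorm_spectralMult_le hX.phi_continuous (hcfin 0) (hK 0) hp hf
          _ = ENNReal.ofReal (1 + C) * eLpNorm f p μ := by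
              rw [ENNReal.ofReal_add zero_le_one hC, ENNReal.ofReal_one, add_mul, one_mul]
          _ ≤ _ := by
              gcongr
              · simp only [Nat.cast_zero, zero_mul, neg_zero, Real.rpow_zero, mul_one]
                exact le_mul_of_one_le_right (by positivity) h2γ
              · exact eLpNorm_le_sobolevNorm μ lam φ p γ f
      | j + 1 =>
        calc eLpNorm (f - spectralMult μ φ (c (j + 1)) f) p μ
            ≤ (1 + ENNReal.ofReal C) * approxDegree μ lam φ p ((2 : ℝ) ^ j) f :=
              hX.eLpNorm_sub_spectralMult_le (hcfin _) (fun k hk => hc1 _ _ (by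
                rw [pow_succ, mul_div_cancel_right₀ _ two_ne_zero]
                exact hk.le)) ENNReal.ofReal_ne_top (hK _) hp hf
          _ ≤ (1 + ENNReal.ofReal C) * (ENNReal.ofReal ((2 : ℝ) ^ (-(j * γ))) * W) := by
              gcongr
              exact approxDegree_le_mul_sobolevNorm μ lam φ p γ f j
          _ = _ := by
              rw [← ENNReal.ofReal_one, ← ENNReal.ofReal_add zero_le_one hC, ← mul_assoc,
                ← ENNReal.ofReal_mul (by positivity), mul_assoc (1 + C), ← Real.rpow_add two_pos]
              congr 4
              push_cast
              ring
    have hmono : ∀ j : ℕ, ENNReal.ofReal ((1 + C) * (2 : ℝ) ^ γ * (2 : ℝ) ^ (-(j * γ))) * W ≤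
        ENNReal.ofReal ((1 + C) * (2 : ℝ) ^ γ * (2 : ℝ) ^ γ * (2 : ℝ) ^ (-(j * γ))) * W := by
      intro j
      gcongr
      exact le_mul_of_one_le_right (by positivity) h2γ
    intro j
    constructor
    · rw [mul_assoc 2, two_mul, ENNReal.ofReal_add (by positivity) (by positivity), add_mul]
      match j with
      | 0 =>
        calc eLpNorm (spectralMult μ φ (c 0) f) p μ
            = eLpNorm (f - (f - spectralMult μ φ (c 0) f)) p μ := by rw [sub_sub_cancel]
          _ ≤ eLpNorm f p μ + eLpNorm (f - spectralMult μ φ (c 0) f) p μ :=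
              eLpNorm_sub_le hf.1 (hf.1.sub (hcont 0).aestronglyMeasurable) hp
          _ ≤ _ := by
              refine add_le_add ?_ ((herr 0).trans (hmono 0))
              refine (eLpNorm_le_sobolevNorm μ lam φ p γ f).trans ?_
              refine le_mul_of_one_le_left zero_le ?_
              rw [ENNReal.one_le_ofReal]
              simp only [Nat.cast_zero, zero_mul, neg_zero, Real.rpow_zero, mul_one]
              exact one_le_mul_of_one_le_of_one_le
                (one_le_mul_of_one_le_of_one_le (by linarith) h2γ) h2γ
      | j + 1 =>
        calc eLpNorm (spectralMult μ φ (b (j + 1)) f) p μ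
            = eLpNorm ((f - spectralMult μ φ (c j) f) -
                (f - spectralMult μ φ (c (j + 1)) f)) p μ := by
              rw [hb, sub_sub_sub_cancel_left]
          _ ≤ eLpNorm (f - spectralMult μ φ (c j) f) p μ +
                eLpNorm (f - spectralMult μ φ (c (j + 1)) f) p μ :=
              eLpNorm_sub_le (hf.1.sub (hcont _).aestronglyMeasurable)
                (hf.1.sub (hcont _).aestronglyMeasurable) hp
          _ ≤ _ := by
              refine add_le_add ((herr j).trans (le_of_eq ?_)) ((herr (j + 1)).trans (hmono (j + 1)))
              rw [mul_assoc ((1 + C) * (2 : ℝ) ^ γ), ← Real.rpow_add two_pos]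
              congr 4
              push_cast
              ring
    · rw [hsum]
      refine (herr j).trans ((hmono j).trans ?_)
      gcongr ENNReal.ofReal ?_ * _
      rw [mul_assoc 2]
      exact le_mul_of_one_le_left (by positivity) one_le_two

end IsDataSpace

/-! ### Eigenvalue counts, masses of balls and finite nets -/

namespace IsDataSpace

variable {X : Type*} [MetricSpace X] [CompactSpace X] [MeasurableSpace X] [BorelSpace X]
  {μ : Measure X} [IsProbabilityMeasure μ] {lam : ℕ → ℝ} {φ : ℕ → X → ℝ} {q : ℝ}

theorem integral_sq_sum (hX : IsDataSpace μ lam φ q) (F : Finset ℕ) (d : ℕ → ℝ) :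
    ∫ x, (∑ k ∈ F, d k * φ k x) ^ 2 ∂μ = ∑ k ∈ F, d k ^ 2 := by
  have hexp : ∀ x, (∑ k ∈ F, d k * φ k x) ^ 2 =
      ∑ j ∈ F, ∑ k ∈ F, d j * d k * (φ j x * φ k x) := fun x => by
    rw [sq, Finset.sum_mul_sum]
    refine Finset.sum_congr rfl fun j _ => Finset.sum_congr rfl fun k _ => ?_
    ring
  have hint : ∀ j k, Integrable (fun x => d j * d k * (φ j x * φ k x)) μ := fun j k =>
    (continuous_const.mul ((hX.phi_continuous j).mul
      (hX.phi_continuous k))).integrable_of_hasCompactSupport (HasCompactSupport.of_compactSpace _)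
  simp_rw [hexp]
  rw [integral_finsetSum _ fun j _ => integrable_finsetSum _ fun k _ => hint j k]
  refine Finset.sum_congr rfl fun j hj => ?_
  rw [integral_finsetSum _ fun k _ => hint j k]
  simp_rw [integral_const_mul, hX.phi_orthonormal]
  simp [hj, sq]

theorem sum_sq_le_of_eLpNorm_le (hX : IsDataSpace μ lam φ q) (F : Finset ℕ) (d : ℕ → ℝ) {B : ℝ}
    (hB : 0 ≤ B) (h : eLpNorm (∑ k ∈ F, d k • φ k) 2 μ ≤ ENNReal.ofReal B) :
    ∑ k ∈ F, d k ^ 2 ≤ B ^ 2 := by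
  have hcont : Continuous (∑ k ∈ F, d k • φ k) :=
    Finset.sum_induction _ Continuous (fun _ _ h h' => h.add h') continuous_const
      fun k _ => (hX.phi_continuous k).const_smul (d k)
  have hm : MemLp (∑ k ∈ F, d k • φ k) 2 μ :=
    hcont.memLp_of_hasCompactSupport (HasCompactSupport.of_compactSpace _)
  rw [hm.eLpNorm_eq_integral_rpow_norm two_ne_zero ENNReal.ofNat_ne_top,
    ENNReal.ofReal_le_ofReal_iff hB] at h
  have he : ∫ x, ‖(∑ k ∈ F, d k • φ k) x‖ ^ (2 : ℝ≥0∞).toReal ∂μ = ∑ k ∈ F, d k ^ 2 := by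
    rw [← hX.integral_sq_sum F d]
    refine integral_congr_ae (ae_of_all _ fun x => ?_)
    simp [Finset.sum_apply]
  rw [he] at h
  have h0 : 0 ≤ ∑ k ∈ F, d k ^ 2 := Finset.sum_nonneg fun k _ => sq_nonneg _
  calc ∑ k ∈ F, d k ^ 2 = ((∑ k ∈ F, d k ^ 2) ^ ((2 : ℝ≥0∞).toReal)⁻¹) ^ 2 := by
        rw [← Real.rpow_natCast, ← Real.rpow_mul h0]
        simp
    _ ≤ B ^ 2 := by gcongr

/-- Integrating the diagonal heat bound at `τ = 2 ^ (-j)` bounds the trace by a multiple of `2 ^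
(jq)`, and each counted index contributes at least `exp (-1)`. -/
theorem exists_card_le (hX : IsDataSpace μ lam φ q) :
    ∃ C : ℝ, 0 < C ∧ ∀ (j : ℕ) (F : Finset ℕ), (∀ k ∈ F, lam k < (2 : ℝ) ^ j) →
      (F.card : ℝ) ≤ C * (2 : ℝ) ^ (j * q) := by
  obtain ⟨κ₁, κ₂, h1, -, h⟩ := hX.exists_heat_bound
  refine ⟨Real.exp 1 * κ₁, by positivity, fun j F hF => ?_⟩
  obtain ⟨hD, -⟩ := h ((2 : ℝ) ^ j)⁻¹ (by positivity) (inv_le_one_of_one_le₀ (one_le_pow₀ one_le_two))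
  have hpow : (((2 : ℝ) ^ j)⁻¹) ^ (-q) = (2 : ℝ) ^ (j * q) := by
    rw [Real.inv_rpow (by positivity), Real.rpow_neg (by positivity), inv_inv,
      ← Real.rpow_natCast, ← Real.rpow_mul two_pos.le]
  rw [hpow] at hD
  have hint : ∀ k ∈ F, Integrable (fun x => heatCoeff lam ((2 : ℝ) ^ j)⁻¹ k * φ k x ^ 2) μ :=
    fun k _ => (continuous_const.mul ((hX.phi_continuous k).pow 2)).integrable_of_hasCompactSupport
      (HasCompactSupport.of_compactSpace _)
  have hle : ∑ k ∈ F, heatCoeff lam ((2 : ℝ) ^ j)⁻¹ k ≤ κ₁ * (2 : ℝ) ^ (j * q) := by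
    have := integral_mono (integrable_finsetSum F hint) (integrable_const (κ₁ * (2 : ℝ) ^ (j * q)))
      (fun x => hD.sum_le F x)
    rw [integral_finsetSum _ hint] at this
    simp_rw [integral_const_mul, sq, hX.phi_orthonormal] at this
    simpa using this
  have hge : ∀ k ∈ F, Real.exp (-1) ≤ heatCoeff lam ((2 : ℝ) ^ j)⁻¹ k := by
    intro k hk
    rw [heatCoeff, Real.exp_le_exp, inv_pow, ← div_eq_mul_inv, neg_div, neg_le_neg_iff,
      div_le_one (by positivity)]
    have := hX.lam_nonneg k
    have := (hF k hk).le
    gcongr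
  have hcard : (F.card : ℝ) * Real.exp (-1) ≤ κ₁ * (2 : ℝ) ^ (j * q) := by
    rw [← nsmul_eq_mul]
    exact (Finset.card_nsmul_le_sum F _ _ hge).trans hle
  rw [Real.exp_neg, ← div_eq_mul_inv, div_le_iff₀ (Real.exp_pos 1)] at hcard
  linarith

/-- By compactness finitely many `φ k` have no common zero, so `∑ exp (-lam k ^ 2) |φ k|` over them
has a positive minimum `c₀`. The heat operator multiplies `φ k` by at least `exp (-lam k ^ 2)`,
hence the heat kernel at `x` has `L^1` norm bounded below. Its tail beyond `R τ` is small and its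
height is `O(τ ^ (-q))`, so the ball must carry mass of order `τ ^ q`. -/
theorem exists_le_measure_closedBall (hX : IsDataSpace μ lam φ q)
    (hφ : ∀ x : X, ∃ k, φ k x ≠ 0) :
    ∃ c R : ℝ, 0 < c ∧ 1 ≤ R ∧ ∀ τ : ℝ, 0 < τ → τ ≤ 1 → ∀ x,
      c * τ ^ q ≤ μ.real (Metric.closedBall x (R * τ)) := by
  obtain ⟨κ₁, κ₂, h1, -, h⟩ := hX.exists_heat_bound
  obtain ⟨A, hA1, hA⟩ := hX.exists_lintegral_heat_weight_le
  have hne : Nonempty X := nonempty_of_isProbabilityMeasure μ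
  obtain ⟨t, ht⟩ := isCompact_univ.elim_finite_subcover (fun k => {x : X | φ k x ≠ 0})
    (fun k => isOpen_ne_fun (hX.phi_continuous k) continuous_const)
    (fun x _ => Set.mem_iUnion.2 (hφ x))
  set g : X → ℝ := fun x => ∑ k ∈ t, Real.exp (-(lam k) ^ 2) * |φ k x| with hg
  have hφc := hX.phi_continuous
  have hgc : Continuous g := by
    have := fun k => hφc k
    fun_prop
  have hgpos : ∀ x, 0 < g x := by
    intro x
    obtain ⟨k, hk, hkx⟩ := Set.mem_iUnion₂.1 (ht (Set.mem_univ x))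
    exact Finset.sum_pos' (fun _ _ => by positivity)
      ⟨k, hk, mul_pos (Real.exp_pos _) (abs_pos.2 hkx)⟩
  obtain ⟨x₀, -, hx₀⟩ := isCompact_univ.exists_isMinOn Set.univ_nonempty hgc.continuousOn
  set c₀ := g x₀ with hc₀
  have hmin : ∀ x, c₀ ≤ g x := fun x => hx₀ (Set.mem_univ x)
  have hc₀pos : 0 < c₀ := hgpos x₀
  obtain ⟨B₀, hB₀⟩ := isCompact_univ.exists_bound_of_continuousOn
    (f := fun x => ∑ k ∈ t, |φ k x|) (by
      have := fun k => hφc k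
      fun_prop)
  set B := |B₀| + 1 with hB
  have hBpos : 0 < B := by positivity
  have hBle : ∀ x, ∑ k ∈ t, |φ k x| ≤ B := fun x => by
    have := hB₀ x (Set.mem_univ x)
    have h2 := le_abs_self B₀
    have h3 := (le_abs_self _).trans this
    linarith
  -- Large enough that the tail accounts for at most `c₀ / 2`; the added terms also give `1 ≤ R`.
  set R := Real.log (2 * A * B / c₀ + 1) + 1 with hR
  have hR1 : 1 ≤ R := by
    have : 0 ≤ Real.log (2 * A * B / c₀ + 1) := Real.log_nonneg (by
      have : 0 ≤ 2 * A * B / c₀ := by positivity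
      linarith)
    linarith
  have hRexp : B * (Real.exp (-R) * A) ≤ c₀ / 2 := by
    have h2 : 2 * A * B / c₀ ≤ Real.exp R := by
      rw [hR, Real.exp_add, Real.exp_log (by positivity)]
      have h3 : 1 ≤ Real.exp 1 := Real.one_le_exp zero_le_one
      have h4 : 0 ≤ 2 * A * B / c₀ := by positivity
      nlinarith
    rw [div_le_iff₀ hc₀pos] at h2
    rw [Real.exp_neg]
    have := Real.exp_pos R
    field_simp
    linarith
  refine ⟨c₀ / (2 * B * κ₁), R, by positivity, hR1, fun τ hτ hτ1 x => ?_⟩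
  obtain ⟨hD, hK⟩ := h τ hτ hτ1
  set K := spectralKernel φ (heatCoeff lam τ) x with hKdef
  have hKm : Measurable K := hD.measurable_kernel_right hφc (abs_heatCoeff_le lam τ) x
  have hKint : Integrable K μ := by
    refine Integrable.of_bound hKm.aestronglyMeasurable (κ₁ * τ ^ (-q)) (ae_of_all _ fun y => ?_)
    exact hD.abs_kernel_le (abs_heatCoeff_le lam τ) x y
  set m := μ.real (Metric.closedBall x (R * τ)) with hm
  have hτq : 0 < τ ^ q := Real.rpow_pos_of_pos hτ q
  have hL1 : ∫⁻ y, ‖K y‖ₑ ∂μ ≤ ENNReal.ofReal (κ₁ * τ ^ (-q) * m + Real.exp (-R) * A) := by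
    have hpt : ∀ y, ‖K y‖ₑ ≤ (Metric.closedBall x (R * τ)).indicator
        (fun _ => ENNReal.ofReal (κ₁ * τ ^ (-q))) y + ENNReal.ofReal (Real.exp (-R)) *
          (‖K y‖ₑ * ENNReal.ofReal (Real.exp (dist x y / τ))) := by
      intro y
      by_cases hy : y ∈ Metric.closedBall x (R * τ)
      · rw [Set.indicator_of_mem hy]
        refine le_trans ?_ le_self_add
        rw [Real.enorm_eq_ofReal_abs]
        exact ENNReal.ofReal_le_ofReal (hD.abs_kernel_le (abs_heatCoeff_le lam τ) x y)
      · refine le_trans ?_ le_add_self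
        rw [mul_left_comm, ← ENNReal.ofReal_mul (Real.exp_pos _).le, ← Real.exp_add]
        refine le_mul_of_one_le_right zero_le ?_
        rw [ENNReal.one_le_ofReal, Real.one_le_exp_iff]
        rw [Metric.mem_closedBall, not_le, dist_comm] at hy
        have : R ≤ dist x y / τ := by
          rw [le_div_iff₀ hτ]
          exact hy.le
        linarith
    have hm1 : Measurable fun y => ‖K y‖ₑ * ENNReal.ofReal (Real.exp (dist x y / τ)) := by
      refine hKm.enorm.mul (Measurable.ennreal_ofReal (Continuous.measurable ?_))
      fun_prop
    refine (lintegral_mono hpt).trans ?_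
    rw [lintegral_add_right _ (hm1.const_mul _), lintegral_const_mul _ hm1,
      lintegral_indicator_const Metric.isClosed_closedBall.measurableSet,
      ENNReal.ofReal_add (by positivity) (by positivity),
      ENNReal.ofReal_mul (p := κ₁ * τ ^ (-q)) (by positivity),
      ENNReal.ofReal_mul (p := Real.exp (-R)) (by positivity), hm, ofReal_measureReal]
    gcongr
    exact hA τ hτ hτ1 x
  have hL1' : ∫ y, |K y| ∂μ ≤ κ₁ * τ ^ (-q) * m + Real.exp (-R) * A := by
    have := ofReal_integral_norm_eq_lintegral_enorm hKint
    rw [← this, ENNReal.ofReal_le_ofReal_iff (by positivity)] at hL1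
    exact hL1
  have hmain : g x ≤ B * ∫ y, |K y| ∂μ := by
    have hterm : ∀ k ∈ t, Real.exp (-(lam k) ^ 2) * |φ k x| ≤ ∫ y, |K y| * |φ k y| ∂μ := by
      intro k _
      have he := hD.integral_kernel_mul_phi hφc hX.phi_orthonormal (abs_heatCoeff_le lam τ) x k
      calc Real.exp (-(lam k) ^ 2) * |φ k x| ≤ heatCoeff lam τ k * |φ k x| := by
            gcongr
            rw [heatCoeff, Real.exp_le_exp, neg_mul, neg_le_neg_iff]
            exact mul_le_of_le_one_right (sq_nonneg _) (pow_le_one₀ hτ.le hτ1)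
        _ = |∫ y, K y * φ k y ∂μ| := by rw [he, abs_mul, abs_of_pos (heatCoeff_pos lam τ k)]
        _ ≤ ∫ y, |K y * φ k y| ∂μ := abs_integral_le_integral_abs
        _ = _ := by simp_rw [abs_mul]
    have hint : ∀ k ∈ t, Integrable (fun y => |K y| * |φ k y|) μ := fun k _ => by
      simp_rw [← abs_mul]
      exact (integrable_mul_phi hφc hKint k).abs
    calc g x ≤ ∑ k ∈ t, ∫ y, |K y| * |φ k y| ∂μ := Finset.sum_le_sum hterm
      _ = ∫ y, ∑ k ∈ t, |K y| * |φ k y| ∂μ := (integral_finsetSum _ hint).symm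
      _ ≤ ∫ y, B * |K y| ∂μ := by
          refine integral_mono (integrable_finsetSum _ hint) (hKint.abs.const_mul B) fun y => ?_
          simp only
          rw [← Finset.mul_sum, mul_comm]
          gcongr
          exact hBle y
      _ = _ := integral_const_mul _ _
  have hfin : c₀ / 2 ≤ B * (κ₁ * τ ^ (-q) * m) := by
    have h5 := (hmin x).trans (hmain.trans (mul_le_mul_of_nonneg_left hL1' hBpos.le))
    rw [mul_add] at h5
    linarith
  rw [Real.rpow_neg hτ.le] at hfin
  rw [div_mul_eq_mul_div, div_le_iff₀ (by positivity)]
  have h6 : B * (κ₁ * (τ ^ q)⁻¹ * m) * τ ^ q = B * κ₁ * m := by field_simp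
  have h7 := mul_le_mul_of_nonneg_right hfin hτq.le
  rw [h6] at h7
  linarith

/-- Needed to turn essential suprema of continuous functions into pointwise bounds, since sampling
evaluates the kernels at individual net points. -/
theorem isOpenPosMeasure (hX : IsDataSpace μ lam φ q) (hφ : ∀ x : X, ∃ k, φ k x ≠ 0) :
    μ.IsOpenPosMeasure := by
  obtain ⟨c, R, hc, hR, h⟩ := hX.exists_le_measure_closedBall hφ
  refine ⟨fun V hV ⟨x, hx⟩ h0 => ?_⟩
  obtain ⟨r, hr, hrV⟩ := Metric.nhds_basis_closedBall.mem_iff.1 (hV.mem_nhds hx)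
  have hR0 : 0 < R := by linarith
  set τ := min 1 (r / R) with hτ
  have hτ0 : 0 < τ := lt_min one_pos (by positivity)
  have h1 := h τ hτ0 (min_le_left _ _) x
  have h2 : Metric.closedBall x (R * τ) ⊆ V := by
    refine (Metric.closedBall_subset_closedBall ?_).trans hrV
    rw [mul_comm, ← le_div_iff₀ hR0]
    exact min_le_right _ _
  have h3 : μ.real (Metric.closedBall x (R * τ)) = 0 := by
    rw [measureReal_def, measure_mono_null h2 h0, ENNReal.toReal_zero]
  have h4 : 0 < c * τ ^ q := mul_pos hc (Real.rpow_pos_of_pos hτ0 q)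
  linarith

/-- Packing: around an `ε`-separated set the balls of radius `ε / 2` are disjoint, and their masses,
each of order at least `ε ^ q`, add up to at most `1`. A separated set of maximal cardinality is a
net. -/
theorem exists_finite_net (hX : IsDataSpace μ lam φ q) (hφ : ∀ x : X, ∃ k, φ k x ≠ 0) :
    ∃ C : ℝ, 0 < C ∧ ∀ ε : ℝ, 0 < ε → ε ≤ 1 → ∃ t : Finset X,
      (t.card : ℝ) ≤ C * ε ^ (-q) ∧ ∀ x, ∃ y ∈ t, dist x y ≤ ε := by
  obtain ⟨c, R, hc, hR, h⟩ := hX.exists_le_measure_closedBall hφ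
  have hR0 : 0 < R := by linarith
  refine ⟨(2 * R) ^ q / c, by positivity, fun ε hε hε1 => ?_⟩
  let Sep : Finset X → Prop := fun t => ∀ x ∈ t, ∀ y ∈ t, x ≠ y → ε < dist x y
  have hcard : ∀ t, Sep t → (t.card : ℝ) ≤ (2 * R) ^ q / c * ε ^ (-q) := by
    intro t ht
    set τ := ε / (2 * R) with hτ
    have hτ0 : 0 < τ := by positivity
    have hτ1 : τ ≤ 1 := by
      rw [hτ, div_le_one (by positivity)]
      linarith
    have hRτ : R * τ = ε / 2 := by
      rw [hτ]
      field_simp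
    have hdisj : (t : Set X).PairwiseDisjoint fun x => Metric.closedBall x (R * τ) := by
      intro x hx y hy hxy
      refine Metric.closedBall_disjoint_closedBall ?_
      rw [hRτ, add_halves]
      exact ht x hx y hy hxy
    have hsum : ∑ x ∈ t, μ.real (Metric.closedBall x (R * τ)) ≤ 1 := by
      rw [← measureReal_biUnion_finset hdisj fun x _ =>
        Metric.isClosed_closedBall.measurableSet]
      exact measureReal_le_one
    have hle : (t.card : ℝ) * (c * τ ^ q) ≤ 1 := by
      rw [← nsmul_eq_mul]
      exact (Finset.card_nsmul_le_sum t _ _ fun x _ => h τ hτ0 hτ1 x).trans hsum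
    rw [hτ, Real.div_rpow hε.le (by positivity)] at hle
    rw [Real.rpow_neg hε.le]
    have hεq : 0 < ε ^ q := Real.rpow_pos_of_pos hε q
    have hRq : 0 < (2 * R) ^ q := Real.rpow_pos_of_pos (by positivity) q
    rw [← div_eq_mul_inv, div_div, le_div_iff₀ (by positivity)]
    have := mul_le_mul_of_nonneg_right hle hRq.le
    rw [one_mul] at this
    refine le_trans (le_of_eq ?_) this
    field_simp
  obtain ⟨N, hN⟩ := exists_nat_ge ((2 * R) ^ q / c * ε ^ (-q))
  obtain ⟨t, ht, hmax⟩ : ∃ t, Sep t ∧ ∀ t', Sep t' → t'.card ≤ t.card := by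
    have hbdd : BddAbove {n | ∃ t, Sep t ∧ t.card = n} := by
      refine ⟨N, ?_⟩
      rintro n ⟨t, ht, rfl⟩
      exact_mod_cast (hcard t ht).trans hN
    obtain ⟨t, ht, hts⟩ := Nat.sSup_mem (s := {n | ∃ t, Sep t ∧ t.card = n})
      ⟨0, ∅, by simp [Sep], by simp⟩ hbdd
    exact ⟨t, ht, fun t' ht' => hts ▸ le_csSup hbdd ⟨t', ht', rfl⟩⟩
  refine ⟨t, hcard t ht, fun x => ?_⟩
  by_contra! hfar
  classical
  have hxt : x ∉ t := fun hxt => by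
    have := hfar x hxt
    rw [dist_self] at this
    linarith
  have hsep : Sep (insert x t) := by
    intro y hy z hz hyz
    rcases Finset.mem_insert.1 hy with rfl | hy' <;>
      rcases Finset.mem_insert.1 hz with rfl | hz'
    · exact absurd rfl hyz
    · exact hfar z hz'
    · rw [dist_comm]
      exact hfar y hy'
    · exact ht y hy' z hz' hyz
  have := hmax _ hsep
  rw [Finset.card_insert_of_notMem hxt] at this
  omega

end IsDataSpace

/-! ### Pointwise bounds for Hölder functions -/

theorem abs_sub_le_lipNorm_mul {X : Type*} [MetricSpace X] [MeasurableSpace X] {μ : Measure X}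
    {α : ℝ} (hα : 0 < α) {h : X → ℝ} {L : ℝ≥0∞} (hL : L ≠ ∞) (hlip : lipNorm μ α h ≤ L) (x x' : X) :
    |h x - h x'| ≤ L.toReal * dist x x' ^ α := by
  rcases eq_or_ne x x' with rfl | hx
  · simp [Real.zero_rpow hα.ne']
  · have h1 : ENNReal.ofReal (|h x - h x'| / dist x x' ^ α) ≤ L := by
      refine le_trans ?_ (le_add_self.trans hlip)
      exact le_iSup_of_le x (le_iSup_of_le x' (le_iSup_of_le hx le_rfl))
    have hd : 0 < dist x x' ^ α := Real.rpow_pos_of_pos (dist_pos.2 hx) α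
    rw [ENNReal.ofReal_le_iff_le_toReal hL, div_le_iff₀ hd] at h1
    exact h1

theorem abs_le_of_eLpNorm_top_le {X : Type*} [MetricSpace X] [MeasurableSpace X] {μ : Measure X}
    [μ.IsOpenPosMeasure] {α : ℝ} (hα : 0 < α) {h : X → ℝ} (hlip : lipNorm μ α h < ∞)
    {S : ℝ≥0∞} (hS : S ≠ ∞) (hle : eLpNorm h ∞ μ ≤ S) (x : X) : |h x| ≤ S.toReal := by
  have hcont : Continuous h := by
    rw [continuous_iff_continuousAt]
    intro x
    rw [ContinuousAt, tendsto_iff_dist_tendsto_zero]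
    have hlim : Tendsto (fun y => (lipNorm μ α h).toReal * dist y x ^ α) (𝓝 x) (𝓝 0) := by
      have : Continuous fun y => (lipNorm μ α h).toReal * dist y x ^ α :=
        continuous_const.mul ((continuous_id.dist continuous_const).rpow_const
          fun _ => Or.inr hα.le)
      have h2 := this.tendsto x
      simpa [Real.zero_rpow hα.ne'] using h2
    exact squeeze_zero (fun _ => dist_nonneg)
      (fun y => abs_sub_le_lipNorm_mul hα hlip.ne le_rfl y x) hlim
  have hopen : IsOpen {y | S.toReal < |h y|} := isOpen_lt continuous_const hcont.abs
  have hnull : μ {y | S.toReal < |h y|} = 0 := by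
    have hae : ∀ᵐ y ∂μ, |h y| ≤ S.toReal := by
      filter_upwards [enorm_ae_le_eLpNormEssSup h μ] with y hy
      rw [← eLpNorm_exponent_top] at hy
      have := hy.trans hle
      rwa [Real.enorm_eq_ofReal_abs, ENNReal.ofReal_le_iff_le_toReal hS] at this
    simpa only [ae_iff, not_le] using hae
  have := (hopen.measure_eq_zero_iff μ).1 hnull
  by_contra hx
  exact (Set.eq_empty_iff_forall_notMem.1 this) x (not_le.1 hx)

/-! ### Random sampling from a signed density -/

theorem measurableEmbedding_prodMk_bool {Ω : Type*} [MeasurableSpace Ω] (b : Bool) :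
    MeasurableEmbedding (fun ω : Ω => (ω, b)) :=
  MeasurableEmbedding.of_measurable_inverse_on_range measurable_prodMk_right (by
    have : Set.range (fun ω : Ω => (ω, b)) = Prod.snd ⁻¹' {b} := by
      ext ⟨ω, c⟩
      simp [eq_comm]
    rw [this]
    exact measurable_snd (measurableSet_singleton b)) (measurable_fst.comp measurable_subtype_coe)
    (fun ω => rfl)

/-- Integration against a signed density of total mass at most one is the expectation under a
probability measure on signed points. -/
theorem exists_signed_sampling_measure {Ω : Type*} [MeasurableSpace Ω] {ν : Measure Ω}
    [IsProbabilityMeasure ν] {g : Ω → ℝ} (hg : Integrable g ν) (hg1 : ∫ ω, |g ω| ∂ν ≤ 1) :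
    ∃ P : Measure (Ω × Bool), IsProbabilityMeasure P ∧ ∀ (h : Ω → ℝ) (B : ℝ),
      AEStronglyMeasurable h ν → (∀ ω, |h ω| ≤ B) →
      AEMeasurable (fun z : Ω × Bool => (if z.2 then 1 else -1) * h z.1) P ∧
      ∫ z, (if z.2 then 1 else -1) * h z.1 ∂P = ∫ ω, h ω * g ω ∂ν := by
  set δ := 1 - ∫ ω, |g ω| ∂ν with hδ
  have hδ0 : 0 ≤ δ := sub_nonneg.2 hg1
  -- The positive and negative parts of `g`, with the missing mass `δ` shared equally between the
  -- two signs: the total becomes `1` and the surplus cancels in the expectation.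
  set d : Bool → Ω → ℝ := fun b ω => (|g ω| + δ + (if b then 1 else -1) * g ω) / 2 with hd
  have hd0 : ∀ b ω, 0 ≤ d b ω := fun b ω => by
    have h1 := neg_abs_le (g ω)
    have h2 := le_abs_self (g ω)
    cases b <;> simp only [hd, if_true, Bool.false_eq_true, if_false] <;> linarith
  have hdint : ∀ b, Integrable (d b) ν := fun b =>
    ((hg.abs.add (integrable_const δ)).add (hg.const_mul _)).div_const 2
  have hdm : ∀ b, AEMeasurable (fun ω => ENNReal.ofReal (d b ω)) ν := fun b =>
    (hdint b).aemeasurable.ennreal_ofReal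
  set Q : Bool → Measure Ω := fun b => ν.withDensity fun ω => ENNReal.ofReal (d b ω) with hQ
  have hQuniv : ∀ b, Q b Set.univ = ENNReal.ofReal (∫ ω, d b ω ∂ν) := fun b => by
    rw [hQ, withDensity_apply _ MeasurableSet.univ, Measure.restrict_univ,
      ofReal_integral_eq_lintegral_ofReal (hdint b) (ae_of_all _ (hd0 b))]
  have hQfin : ∀ b, IsFiniteMeasure (Q b) := fun b => ⟨by rw [hQuniv]; exact ENNReal.ofReal_lt_top⟩
  refine ⟨(Q true).map (fun ω => (ω, true)) + (Q false).map (fun ω => (ω, false)), ⟨?_⟩, ?_⟩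
  · rw [Measure.add_apply, Measure.map_apply measurable_prodMk_right MeasurableSet.univ,
      Measure.map_apply measurable_prodMk_right MeasurableSet.univ, Set.preimage_univ,
      Set.preimage_univ, hQuniv, hQuniv,
      ← ENNReal.ofReal_add (integral_nonneg (hd0 _)) (integral_nonneg (hd0 _)),
      ← integral_add (hdint _) (hdint _)]
    have : ∀ ω, d true ω + d false ω = |g ω| + δ := fun ω => by
      simp only [hd, if_true, Bool.false_eq_true, if_false]
      ring
    simp_rw [this]
    rw [integral_add hg.abs (integrable_const δ)]
    simp [hδ]
  · intro h B hh hB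
    set Z : Ω × Bool → ℝ := fun z => (if z.2 then 1 else -1) * h z.1 with hZ
    have hZm : ∀ b, AEStronglyMeasurable Z ((Q b).map fun ω => (ω, b)) := fun b => by
      rw [(measurableEmbedding_prodMk_bool b).aestronglyMeasurable_map_iff]
      have h1 : AEStronglyMeasurable h (Q b) :=
        hh.mono_ac (withDensity_absolutelyContinuous ν fun ω => ENNReal.ofReal (d b ω))
      have h2 : AEStronglyMeasurable (fun ω => (if b then (1 : ℝ) else -1) * h ω) (Q b) :=
        h1.const_mul _
      exact h2
    have hB0 : ∀ z, |Z z| ≤ B := fun z => by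
      have := hB z.1
      simp only [hZ, abs_mul]
      split_ifs <;> simpa
    have hZint : ∀ b, Integrable Z ((Q b).map fun ω => (ω, b)) := fun b => by
      have := hQfin b
      exact Integrable.of_bound (hZm b) B (ae_of_all _ hB0)
    refine ⟨(aestronglyMeasurable_add_measure_iff.2 ⟨hZm true, hZm false⟩).aemeasurable, ?_⟩
    have hone : ∀ b, ∫ z, Z z ∂((Q b).map fun ω => (ω, b)) =
        ∫ ω, d b ω * ((if b then 1 else -1) * h ω) ∂ν := fun b => by
      rw [(measurableEmbedding_prodMk_bool b).integral_map, hQ,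
        integral_withDensity_eq_integral_toReal_smul₀ (hdm b)
          (ae_of_all _ fun _ => ENNReal.ofReal_lt_top)]
      refine integral_congr_ae (ae_of_all _ fun ω => ?_)
      simp only [hZ, smul_eq_mul, ENNReal.toReal_ofReal (hd0 b ω)]
    have hint : ∀ b, Integrable (fun ω => d b ω * ((if b then 1 else -1) * h ω)) ν := fun b => by
      refine (hdint b).mul_bdd (c := B) (hh.const_mul _) (ae_of_all _ fun ω => ?_)
      exact hB0 (ω, b)
    rw [integral_add_measure (hZint true) (hZint false), hone, hone,
      ← integral_add (hint true) (hint false)]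
    refine integral_congr_ae (ae_of_all _ fun ω => ?_)
    simp only [hd, if_true, Bool.false_eq_true, if_false]
    ring

/-- A sampling lemma: signed empirical means approximate finitely many integrals simultaneously. -/
theorem exists_signed_sample {Ω ι : Type*} [MeasurableSpace Ω] {ν : Measure Ω}
    [IsProbabilityMeasure ν] {g : Ω → ℝ} (hg : Integrable g ν) (hg1 : ∫ ω, |g ω| ∂ν ≤ 1)
    (T : Finset ι) {h : ι → Ω → ℝ} (hh : ∀ i ∈ T, AEStronglyMeasurable (h i) ν) {B s : ℝ}
    (hB : 0 < B) (hb : ∀ i ∈ T, ∀ ω, |h i ω| ≤ B) (hs : 0 ≤ s) {M : ℕ} (hM : 1 ≤ M)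
    (hlt : (T.card : ℝ) * (2 * Real.exp (-(M * s ^ 2 / (2 * B ^ 2)))) < 1) :
    ∃ (ω : Fin M → Ω) (w : Fin M → ℝ), (∀ j, w j = 1 ∨ w j = -1) ∧ ∀ i ∈ T,
      |(1 / M) * ∑ j, w j * h i (ω j) - ∫ ω, h i ω * g ω ∂ν| ≤ s := by
  obtain ⟨P, hP, hPint⟩ := exists_signed_sampling_measure hg hg1
  set X : ι → Ω × Bool → ℝ := fun i z => (if z.2 then 1 else -1) * h i z.1 with hX
  set m : ι → ℝ := fun i => ∫ ω, h i ω * g ω ∂ν with hm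
  set PP : Measure (Fin M → Ω × Bool) := Measure.pi fun _ => P with hPP
  have hM0 : (0 : ℝ) < M := by exact_mod_cast hM
  have hbd : ∀ i ∈ T, PP.real {Ξ | M * s < |∑ j, (X i (Ξ j) - m i)|} ≤
      2 * Real.exp (-(M * s ^ 2 / (2 * B ^ 2))) := by
    intro i hi
    obtain ⟨hXm, hXi⟩ := hPint (h i) B (hh i hi) (hb i hi)
    -- Hoeffding's lemma for a variable with values in `[-B, B]`; the mean is the desired integral.
    have hsub : ProbabilityTheory.HasSubgaussianMGF (fun z => X i z - m i)
        ((‖B - -B‖₊ / 2) ^ 2) P := by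
      have := ProbabilityTheory.hasSubgaussianMGF_of_mem_Icc (a := -B) (b := B) hXm
        (ae_of_all _ fun z => by
          have hz := hb i hi z.1
          refine abs_le.1 ?_
          rw [abs_mul]
          split_ifs <;> simpa)
      rwa [hXi] at this
    have hsubj : ∀ j : Fin M, ProbabilityTheory.HasSubgaussianMGF
        (fun Ξ : Fin M → Ω × Bool => X i (Ξ j) - m i) ((‖B - -B‖₊ / 2) ^ 2) PP := fun j => by
      have hmp := measurePreserving_eval (fun _ : Fin M => P) j
      refine ProbabilityTheory.HasSubgaussianMGF.of_map (Y := Function.eval j)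
        (X := fun z => X i z - m i) hmp.measurable.aemeasurable ?_
      rw [hmp.map_eq]
      exact hsub
    have hind : ProbabilityTheory.iIndepFun
        (fun (j : Fin M) (Ξ : Fin M → Ω × Bool) => X i (Ξ j) - m i) PP :=
      ProbabilityTheory.iIndepFun_pi (X := fun _ z => X i z - m i) fun _ => hXm.sub_const _
    have hindneg : ProbabilityTheory.iIndepFun
        (fun (j : Fin M) (Ξ : Fin M → Ω × Bool) => -(X i (Ξ j) - m i)) PP :=
      ProbabilityTheory.iIndepFun_pi (X := fun _ z => -(X i z - m i)) fun _ =>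
        (hXm.sub_const _).neg
    have hexp : -(M * s) ^ 2 / (2 * ((∑ _j : Fin M, (‖B - -B‖₊ / 2) ^ 2 : NNReal) : ℝ)) =
        -(M * s ^ 2 / (2 * B ^ 2)) := by
      simp only [Finset.sum_const, Finset.card_univ, Fintype.card_fin]
      have : ((‖B - -B‖₊ / 2 : NNReal) : ℝ) = B := by
        simp only [sub_neg_eq_add, NNReal.coe_div, coe_nnnorm, NNReal.coe_ofNat]
        rw [Real.norm_of_nonneg (by positivity)]
        ring
      push_cast at this ⊢
      rw [nsmul_eq_mul, this]
      field_simp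
    have h1 := ProbabilityTheory.HasSubgaussianMGF.measure_sum_ge_le_of_iIndepFun hind
      (s := Finset.univ) (fun j _ => hsubj j) (ε := M * s) (by positivity)
    have h2 := ProbabilityTheory.HasSubgaussianMGF.measure_sum_ge_le_of_iIndepFun hindneg
      (s := Finset.univ) (fun j _ => (hsubj j).neg) (ε := M * s) (by positivity)
    rw [hexp] at h1 h2
    rw [two_mul]
    refine le_trans ?_ (add_le_add h1 h2)
    refine le_trans (measureReal_mono ?_) (measureReal_union_le _ _)
    intro Ξ hΞ
    simp only [Set.mem_ofPred_eq, Set.mem_union, Finset.sum_neg_distrib] at hΞ ⊢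
    rcases lt_abs.1 hΞ with h | h
    · exact Or.inl h.le
    · exact Or.inr h.le
  -- Union bound: since the bad set has probability below `1`, some sample avoids it.
  have hbad : PP.real (⋃ i ∈ T, {Ξ | M * s < |∑ j, (X i (Ξ j) - m i)|}) < 1 := by
    refine lt_of_le_of_lt (measureReal_biUnion_finset_le _ _) ?_
    refine lt_of_le_of_lt (Finset.sum_le_sum hbd) ?_
    rwa [Finset.sum_const, nsmul_eq_mul]
  obtain ⟨Ξ, hΞ⟩ : ∃ Ξ : Fin M → Ω × Bool,
      Ξ ∉ ⋃ i ∈ T, {Ξ | M * s < |∑ j, (X i (Ξ j) - m i)|} := by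
    by_contra! hall
    rw [Set.eq_univ_of_forall hall, probReal_univ] at hbad
    exact lt_irrefl _ hbad
  refine ⟨fun j => (Ξ j).1, fun j => if (Ξ j).2 then 1 else -1, fun j => ?_, fun i hi => ?_⟩
  · dsimp only
    split_ifs <;> simp
  · have h1 : |∑ j, (X i (Ξ j) - m i)| ≤ M * s := by
      by_contra hcon
      exact hΞ (Set.mem_iUnion₂.2 ⟨i, hi, not_le.1 hcon⟩)
    have h2 : (1 / M) * ∑ j, X i (Ξ j) - m i = (1 / M) * ∑ j, (X i (Ξ j) - m i) := by
      rw [Finset.sum_sub_distrib, Finset.sum_const, Finset.card_univ, Fintype.card_fin,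
        nsmul_eq_mul]
      field_simp
    change |(1 / M) * ∑ j, X i (Ξ j) - m i| ≤ s
    rw [h2, abs_mul, abs_of_pos (by positivity), one_div, inv_mul_le_iff₀ hM0]
    exact h1

theorem measurableEmbedding_prodMk_of_singleton {α Y : Type*} [MeasurableSpace α]
    [MeasurableSingletonClass α] [MeasurableSpace Y] (a : α) :
    MeasurableEmbedding (fun y : Y => (a, y)) :=
  MeasurableEmbedding.of_measurable_inverse_on_range measurable_prodMk_left (by
    have : Set.range (fun y : Y => (a, y)) = Prod.fst ⁻¹' {a} := by
      ext ⟨b, y⟩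
      simp [eq_comm]
    rw [this]
    exact measurable_fst (measurableSet_singleton a)) (measurable_snd.comp measurable_subtype_coe)
    (fun _ => rfl)

/-- The product of the uniform measure on a finite type with a measure. -/
noncomputable def uniformProd (α : Type*) [Fintype α] [MeasurableSpace α] {Y : Type*}
    [MeasurableSpace Y] (ν : Measure Y) : Measure (α × Y) :=
  ∑ a : α, (Fintype.card α : ℝ≥0∞)⁻¹ • ν.map (fun y => (a, y))

section

variable {α : Type*} [Fintype α] [MeasurableSpace α] {Y : Type*} [MeasurableSpace Y]
  {ν : Measure Y}

theorem isProbabilityMeasure_uniformProd [Nonempty α] [IsProbabilityMeasure ν] :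
    IsProbabilityMeasure (uniformProd α ν) := by
  refine ⟨?_⟩
  rw [uniformProd, Measure.coe_finsetSum, Finset.sum_apply]
  simp only [Measure.smul_apply, Measure.map_apply measurable_prodMk_left MeasurableSet.univ,
    Set.preimage_univ, measure_univ, smul_eq_mul, mul_one, Finset.sum_const, Finset.card_univ,
    nsmul_eq_mul]
  exact ENNReal.mul_inv_cancel (by simp) (by simp)

variable [MeasurableSingletonClass α] {F : α × Y → ℝ}

/-- The measure is a finite sum of push-forwards under measurable embeddings, so almost-everywhere
measurability of each slice is enough. -/
theorem aestronglyMeasurable_uniformProd (hF : ∀ a, AEStronglyMeasurable (fun y => F (a, y)) ν) :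
    AEStronglyMeasurable F (uniformProd α ν) := by
  rw [uniformProd, ← Measure.sum_fintype, aestronglyMeasurable_sum_measure_iff]
  intro a
  refine AEStronglyMeasurable.smul_measure ?_ _
  rw [(measurableEmbedding_prodMk_of_singleton a).aestronglyMeasurable_map_iff]
  exact hF a

theorem integrable_uniformProd [Nonempty α] (hF : ∀ a, Integrable (fun y => F (a, y)) ν) :
    Integrable F (uniformProd α ν) ∧
      ∫ z, F z ∂(uniformProd α ν) = (Fintype.card α : ℝ)⁻¹ * ∑ a, ∫ y, F (a, y) ∂ν := by
  have h : ∀ a ∈ Finset.univ, Integrable F ((Fintype.card α : ℝ≥0∞)⁻¹ • ν.map (fun y => (a, y))) := by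
    intro a _
    refine Integrable.smul_measure ?_ (by simp)
    rw [(measurableEmbedding_prodMk_of_singleton a).integrable_map_iff]
    exact hF a
  refine ⟨integrable_finsetSum_measure.2 h, ?_⟩
  rw [uniformProd, integral_finsetSum_measure h, Finset.mul_sum]
  refine Finset.sum_congr rfl fun a _ => ?_
  rw [integral_smul_measure, (measurableEmbedding_prodMk_of_singleton a).integral_map]
  simp

end

/-- The sampling lemma for finite sums of integrals. -/
theorem exists_signed_sample_sum {Y ι : Type*} [MeasurableSpace Y] {ν : Measure Y}
    [IsProbabilityMeasure ν] {I : Finset ℕ} (hI : I.Nonempty) {c : ℕ → ℝ} {D : ℕ → Y → ℝ}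
    (hD : ∀ l ∈ I, c l ≠ 0 → Integrable (D l) ν) {V : ℝ} (hV : 0 < V)
    (hcV : ∑ l ∈ I, |c l| * ∫ y, |D l y| ∂ν ≤ V)
    (T : Finset ι) {H : ι → ℕ → Y → ℝ} (hH : ∀ i ∈ T, ∀ l ∈ I, AEStronglyMeasurable (H i l) ν)
    {B s : ℝ} (hB : 0 < B) (hb : ∀ i ∈ T, ∀ l ∈ I, ∀ y, |H i l y| ≤ B) (hs : 0 ≤ s) {M : ℕ}
    (hM : 1 ≤ M) (hlt : (T.card : ℝ) * (2 * Real.exp (-(M * s ^ 2 / (2 * B ^ 2)))) < 1) :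
    ∃ (l : Fin M → ℕ) (y : Fin M → Y) (w : Fin M → ℝ), (∀ j, l j ∈ I) ∧
      (∀ j, w j = 1 ∨ w j = -1) ∧ ∀ i ∈ T,
      |V / M * ∑ j, w j * H i (l j) (y j) - ∑ l ∈ I, c l * ∫ y, H i l y * D l y ∂ν| ≤ V * s := by
  have : Nonempty I := hI.to_subtype
  have hprob := isProbabilityMeasure_uniformProd (α := I) (ν := ν)
  set N : ℝ := (Fintype.card I : ℝ) with hN
  have hN0 : 0 < N := by
    rw [hN]
    exact_mod_cast Fintype.card_pos
  have hcD : ∀ l : I, Integrable (fun y => c l * D l y) ν := fun l => by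
    rcases eq_or_ne (c l) 0 with h0 | h0
    · simp [h0]
    · exact (hD l l.2 h0).const_mul _
  -- The factor `N` undoes the uniform weight `1 / N` on the indices, and `1 / V` normalizes the
  -- total variation to at most `1`.
  set g : I × Y → ℝ := fun z => N / V * (c z.1 * D z.1 z.2) with hg
  have hgint := integrable_uniformProd (F := g) fun a => (hcD a).const_mul (N / V)
  have hgabs := integrable_uniformProd (F := fun z => |g z|)
    fun a => ((hcD a).const_mul (N / V)).abs
  have hg1 : ∫ z, |g z| ∂(uniformProd I ν) ≤ 1 := by
    rw [hgabs.2]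
    have : ∀ l : I, ∫ y, |g (l, y)| ∂ν = N / V * (|c l| * ∫ y, |D l y| ∂ν) := fun l => by
      rw [← integral_const_mul, ← integral_const_mul]
      refine integral_congr_ae (ae_of_all _ fun y => ?_)
      simp only [hg, abs_mul, abs_of_pos (div_pos hN0 hV)]
    simp_rw [this]
    rw [← Finset.mul_sum, Finset.sum_coe_sort I fun l => |c l| * ∫ y, |D l y| ∂ν, ← mul_assoc]
    have h2 : (N⁻¹ * (N / V)) = V⁻¹ := by field_simp
    rw [← hN, h2, inv_mul_le_iff₀ hV, mul_one]
    exact hcV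
  obtain ⟨ω, w, hw, hmain⟩ := exists_signed_sample hgint.1 hg1 T
    (h := fun i z => H i z.1 z.2) (fun i hi => aestronglyMeasurable_uniformProd
      fun l => hH i hi l l.2) hB (fun i hi z => hb i hi z.1 z.1.2 z.2) hs hM hlt
  refine ⟨fun j => (ω j).1, fun j => (ω j).2, w, fun j => (ω j).1.2, hw, fun i hi => ?_⟩
  have hint : ∀ l : I, Integrable (fun y => H i l y * (c l * D l y)) ν := fun l =>
    (hcD l).bdd_mul (c := B) (hH i hi l l.2) (ae_of_all _ fun y => hb i hi l l.2 y)
  have hHg := (integrable_uniformProd (F := fun z : I × Y => H i z.1 z.2 * g z) fun l => by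
    have := (hint l).const_mul (N / V)
    refine this.congr (ae_of_all _ fun y => ?_)
    simp only [hg]
    ring).2
  have hval : ∫ z, H i z.1 z.2 * g z ∂(uniformProd I ν) =
      V⁻¹ * ∑ l ∈ I, c l * ∫ y, H i l y * D l y ∂ν := by
    rw [hHg, ← Finset.sum_coe_sort I fun l => c l * ∫ y, H i l y * D l y ∂ν, Finset.mul_sum,
      Finset.mul_sum]
    refine Finset.sum_congr rfl fun l _ => ?_
    rw [← integral_const_mul, ← integral_const_mul, ← integral_const_mul]
    refine integral_congr_ae (ae_of_all _ fun y => ?_)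
    simp only [hg, ← hN]
    field_simp
  have h3 := hmain i hi
  rw [hval] at h3
  have h4 : V / M * ∑ j, w j * H i (ω j).1 (ω j).2 - ∑ l ∈ I, c l * ∫ y, H i l y * D l y ∂ν =
      V * ((1 / M) * ∑ j, w j * H i (ω j).1 (ω j).2 -
        V⁻¹ * ∑ l ∈ I, c l * ∫ y, H i l y * D l y ∂ν) := by
    field_simp
  rw [h4, abs_mul, abs_of_pos hV]
  gcongr

/-! ### Closed operators applied to the block series -/

namespace Sends

variable {X : Type*} [MeasurableSpace X] {μ : Measure X} {p : ℝ≥0∞}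
  {U : Lp ℝ p μ →ₗ.[ℝ] Lp ℝ p μ} {f f' g g' : X → ℝ}

theorem unique (h : Sends U f g) (h' : Sends U f g') : g =ᵐ[μ] g' := by
  obtain ⟨u, v, huv, hu, hv⟩ := h
  obtain ⟨u', v', huv', hu', hv'⟩ := h'
  have : u = u' := Lp.ext (hu.trans hu'.symm)
  have h2 : v = v' := U.mem_graph_snd_inj huv huv' this
  exact hv.symm.trans ((by rw [h2] : (v : X → ℝ) =ᵐ[μ] v').trans hv')

theorem sum {ι : Type*} {F : Finset ι} {f g : ι → X → ℝ} {c : ι → ℝ}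
    (h : ∀ i ∈ F, Sends U (f i) (g i)) :
    Sends U (∑ i ∈ F, c i • f i) (∑ i ∈ F, c i • g i) := by
  classical
  induction F using Finset.induction_on with
  | empty => exact ⟨0, 0, U.graph.zero_mem, by simpa using Lp.coeFn_zero ℝ p μ,
      by simpa using Lp.coeFn_zero ℝ p μ⟩
  | insert i F hi ih =>
    rw [Finset.sum_insert hi, Finset.sum_insert hi]
    obtain ⟨u, v, huv, hu, hv⟩ := h i (Finset.mem_insert_self i F)
    obtain ⟨u', v', huv', hu', hv'⟩ := ih fun j hj => h j (Finset.mem_insert_of_mem hj)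
    refine ⟨c i • u + u', c i • v + v', U.graph.add_mem (U.graph.smul_mem (c i) huv) huv', ?_, ?_⟩
    · filter_upwards [Lp.coeFn_add (c i • u) u', Lp.coeFn_smul (c i) u, hu, hu'] with x h1 h2 h3 h4
      rw [h1]
      simp only [Pi.add_apply, h2, Pi.smul_apply, h3, h4]
    · filter_upwards [Lp.coeFn_add (c i • v) v', Lp.coeFn_smul (c i) v, hv, hv'] with x h1 h2 h3 h4
      rw [h1]
      simp only [Pi.add_apply, h2, Pi.smul_apply, h3, h4]

/-- A closed operator can be applied termwise to a convergent series whose image converges. -/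
theorem of_series [Fact (1 ≤ p)] (hU : U.IsClosed) (hf : MemLp f p μ) {P h : ℕ → X → ℝ}
    (hP : ∀ j, Sends U (P j) (h j))
    (hlim : Tendsto (fun n => eLpNorm (f - ∑ i ∈ Finset.range n, P i) p μ) atTop (𝓝 0))
    {r : ℕ → ℝ} (hr : Summable r) (hr0 : ∀ j, 0 ≤ r j)
    (hle : ∀ j, eLpNorm (h j) p μ ≤ ENNReal.ofReal (r j)) :
    ∃ g, Sends U f g ∧ ∀ n, eLpNorm (g - ∑ i ∈ Finset.range n, h i) p μ ≤
      ENNReal.ofReal (∑' i, r (i + n)) := by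
  choose u v huv hu hv using hP
  have hvn : ∀ j, ‖v j‖ ≤ r j := fun j => by
    rw [Lp.norm_def, eLpNorm_congr_ae (hv j)]
    exact ENNReal.toReal_le_of_le_ofReal (hr0 j) (hle j)
  have hvs : Summable v := Summable.of_norm_bounded hr hvn
  have hcoe : ∀ (w : ℕ → Lp ℝ p μ) (Q : ℕ → X → ℝ), (∀ j, w j =ᵐ[μ] Q j) → ∀ n,
      ((∑ i ∈ Finset.range n, w i : Lp ℝ p μ) : X → ℝ) =ᵐ[μ] ∑ i ∈ Finset.range n, Q i := by
    intro w Q hwQ n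
    induction n with
    | zero => simpa using Lp.coeFn_zero ℝ p μ
    | succ n ih =>
      rw [Finset.sum_range_succ, Finset.sum_range_succ]
      filter_upwards [Lp.coeFn_add (∑ i ∈ Finset.range n, w i) (w n), ih, hwQ n] with x h1 h2 h3
      simp only [h1, Pi.add_apply, h2, h3]
  have hulim : Tendsto (fun n => ∑ i ∈ Finset.range n, u i) atTop (𝓝 (hf.toLp f)) := by
    rw [Lp.tendsto_Lp_iff_tendsto_eLpNorm']
    refine hlim.congr fun n => ?_
    rw [← neg_sub, eLpNorm_neg]
    refine eLpNorm_congr_ae ?_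
    filter_upwards [hcoe u P hu n, hf.coeFn_toLp] with x h1 h2
    simp only [Pi.sub_apply, h1, h2]
  have hgraph : (hf.toLp f, ∑' i, v i) ∈ U.graph := by
    -- The pairs of partial sums lie in the closed graph, and both coordinates converge.
    refine hU.mem_of_tendsto (hulim.prodMk_nhds hvs.hasSum.tendsto_sum_nat)
      (Eventually.of_forall fun n => ?_)
    have : (∑ i ∈ Finset.range n, u i, ∑ i ∈ Finset.range n, v i) =
        ∑ i ∈ Finset.range n, (u i, v i) := by
      rw [Prod.ext_iff]
      simp [Prod.fst_sum, Prod.snd_sum]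
    rw [SetLike.mem_coe, this]
    exact U.graph.sum_mem fun i _ => huv i
  refine ⟨(∑' i, v i : Lp ℝ p μ), ⟨_, _, hgraph, hf.coeFn_toLp, ae_eq_refl _⟩, fun n => ?_⟩
  have h1 : eLpNorm (((∑' i, v i : Lp ℝ p μ) : X → ℝ) - ∑ i ∈ Finset.range n, h i) p μ =
      ‖(∑' i, v i) - ∑ i ∈ Finset.range n, v i‖ₑ := by
    rw [Lp.enorm_def]
    refine eLpNorm_congr_ae ?_
    filter_upwards [hcoe v h hv n, Lp.coeFn_sub (∑' i, v i) (∑ i ∈ Finset.range n, v i)]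
      with x h1 h2
    rw [h2, Pi.sub_apply, Pi.sub_apply, h1]
  rw [h1, ← ofReal_norm, ← hvs.sum_add_tsum_nat_add n, add_sub_cancel_left]
  refine ENNReal.ofReal_le_ofReal ?_
  exact tsum_of_norm_bounded ((summable_nat_add_iff n).2 hr).hasSum fun i => hvn (i + n)

end Sends

/-- Bernstein turns the block size `2 ^ (-jγ)` into `2 ^ (-j(γ - a))`, a convergent geometric series
whose tail is the error. The condition `0 < γ` makes the blocks sum to `f`, and `a < γ` makes their
images converge. Bounds in `L^max(p,2)` pass to `L^p` because `μ` is a probability measure. -/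
theorem IsDerivativeLike.exists_sends_of_blocks {X : Type*} [MetricSpace X] [CompactSpace X]
    [MeasurableSpace X] [BorelSpace X] {μ : Measure X} [IsProbabilityMeasure μ] {lam : ℕ → ℝ}
    {φ : ℕ → X → ℝ} {q : ℝ} (hX : IsDataSpace μ lam φ q) {p : ℝ≥0∞} [Fact (1 ≤ p)]
    {U : Lp ℝ p μ →ₗ.[ℝ] Lp ℝ p μ} {a γ : ℝ} (hU : IsDerivativeLike μ lam φ p U a)
    (hγ : 0 < γ) (ha : a < γ) {b : ℕ → ℕ → ℝ} (hb : ∀ j k, b j k ≠ 0 → k ∈ dyadicBlock lam j)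
    {C : ℝ} (hC : 0 < C) :
    ∃ K : ℝ, 0 < K ∧ ∀ (f : X → ℝ) (W : ℝ), 0 ≤ W → MemLp f (max p 2) μ →
      (∀ j : ℕ, eLpNorm (spectralMult μ φ (b j) f) (max p 2) μ ≤
        ENNReal.ofReal (C * (2 : ℝ) ^ (-(j * γ)) * W)) →
      (∀ j : ℕ, eLpNorm (f - ∑ i ∈ Finset.range (j + 1), spectralMult μ φ (b i) f) (max p 2) μ ≤
        ENNReal.ofReal (C * (2 : ℝ) ^ (-(j * γ)) * W)) →
      ∃ g, Sends U f g ∧ eLpNorm g p μ ≤ ENNReal.ofReal (K * W) ∧ ∀ (n : ℕ) (h : X → ℝ),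
        Sends U (∑ i ∈ Finset.range (n + 1), spectralMult μ φ (b i) f) h →
        eLpNorm (g - h) p μ ≤ ENNReal.ofReal (K * (2 : ℝ) ^ (-(n * (γ - a))) * W) := by
  obtain ⟨C', hC', hbern⟩ := hU.bernstein
  have hbfin : ∀ j, (Function.support (b j)).Finite := fun j =>
    (hX.finite_lam_lt ((2 : ℝ) ^ (j : ℝ))).subset fun k hk => (hb j k hk).2
  set θ : ℝ := (2 : ℝ) ^ (-(γ - a)) with hθ
  have hθ0 : 0 < θ := by positivity
  have hθ1 : θ < 1 := Real.rpow_lt_one_of_one_lt_of_neg one_lt_two (by linarith)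
  have h1θ : 0 < 1 - θ := by linarith
  have hθn : ∀ n : ℕ, (2 : ℝ) ^ (-(n * (γ - a))) = θ ^ n := fun n => by
    rw [hθ, ← Real.rpow_natCast, ← Real.rpow_mul two_pos.le]
    congr 1
    ring
  refine ⟨C' * C / (1 - θ), by positivity, fun f W hW hf hbl hlim => ?_⟩
  have hmem : ∀ j, spectralMult μ φ (b j) f ∈ dyadicPoly lam φ j := fun j =>
    spectralMult_mem_span (hbfin j) (hb j) f
  have hcont : ∀ j, Continuous (spectralMult μ φ (b j) f) := fun j =>
    continuous_of_mem_span hX.phi_continuous (hmem j)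
  have hdef : ∀ j, ∃ h, Sends U (spectralMult μ φ (b j) f) h := fun j =>
    hU.defined ((2 : ℝ) ^ (j : ℝ)) _ (spectralMult_mem_span (hbfin j) (fun k hk => (hb j k hk).2) f)
  choose h hh using hdef
  set r : ℕ → ℝ := fun j => C' * C * W * θ ^ j with hr
  have hr0 : ∀ j, 0 ≤ r j := fun j => by positivity
  have hgeo : Summable r := (summable_geometric_of_lt_one hθ0.le hθ1).mul_left _
  have hle : ∀ j, eLpNorm (h j) p μ ≤ ENNReal.ofReal (r j) := fun j => by
    refine (hbern j _ (hmem j) _ (hh j)).trans ?_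
    refine (mul_le_mul_right ((eLpNorm_le_eLpNorm_of_exponent_le (le_max_left p 2)
      (hcont j).aestronglyMeasurable).trans (hbl j)) _).trans (le_of_eq ?_)
    rw [← ENNReal.ofReal_mul (by positivity)]
    congr 1
    have : (2 : ℝ) ^ (j * a) * (2 : ℝ) ^ (-(j * γ)) = θ ^ j := by
      rw [← hθn, ← Real.rpow_add two_pos]
      congr 1
      ring
    rw [hr]
    simp only
    rw [← this]
    ring
  have hlim0 : Tendsto (fun n => eLpNorm (f - ∑ i ∈ Finset.range n, spectralMult μ φ (b i) f) p μ)
      atTop (𝓝 0) := by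
    rw [← tendsto_add_atTop_iff_nat 1]
    have hz : Tendsto (fun j : ℕ => ENNReal.ofReal (C * (2 : ℝ) ^ (-(j * γ)) * W)) atTop (𝓝 0) := by
      rw [← ENNReal.ofReal_zero]
      refine ENNReal.tendsto_ofReal ?_
      have h2 : ∀ j : ℕ, (2 : ℝ) ^ (-(j * γ)) = ((2 : ℝ) ^ (-γ)) ^ j := fun j => by
        rw [← Real.rpow_natCast, ← Real.rpow_mul two_pos.le]
        congr 1
        ring
      simp_rw [h2]
      have h3 := tendsto_pow_atTop_nhds_zero_of_lt_one (r := (2 : ℝ) ^ (-γ)) (by positivity)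
        (Real.rpow_lt_one_of_one_lt_of_neg one_lt_two (by linarith))
      simpa using (h3.const_mul C).mul_const W
    refine tendsto_of_tendsto_of_tendsto_of_le_of_le tendsto_const_nhds hz (fun _ => zero_le)
      fun j => ?_
    refine (eLpNorm_le_eLpNorm_of_exponent_le (le_max_left p 2) ?_).trans (hlim j)
    exact hf.1.sub (Finset.sum_induction _ Continuous (fun _ _ h h' => h.add h') continuous_const
      fun i _ => hcont i).aestronglyMeasurable
  obtain ⟨g, hg, htail⟩ := Sends.of_series hU.closed
    (hf.mono_exponent (le_max_left p 2)) hh hlim0 hgeo hr0 hle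
  have htsum : ∀ n, ∑' i, r (i + n) = C' * C / (1 - θ) * θ ^ n * W := fun n => by
    have : ∀ i, r (i + n) = C' * C * W * θ ^ n * θ ^ i := fun i => by
      simp only [hr, pow_add]
      ring
    simp_rw [this]
    rw [tsum_mul_left, tsum_geometric_of_lt_one hθ0.le hθ1]
    ring
  refine ⟨g, hg, ?_, fun n h' hh' => ?_⟩
  · have := htail 0
    rw [htsum] at this
    simpa using this
  · have hs : Sends U (∑ i ∈ Finset.range (n + 1), spectralMult μ φ (b i) f)
        (∑ i ∈ Finset.range (n + 1), h i) := by
      have := Sends.sum (F := Finset.range (n + 1)) (c := fun _ => 1) fun i _ => hh i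
      simpa using this
    have hae : g - h' =ᵐ[μ] g - ∑ i ∈ Finset.range (n + 1), h i :=
      (ae_eq_refl g).sub (hh'.unique hs)
    rw [eLpNorm_congr_ae hae, hθn]
    refine (htail (n + 1)).trans (ENNReal.ofReal_le_ofReal ?_)
    rw [htsum]
    gcongr C' * C / (1 - θ) * ?_ * W
    exact pow_le_pow_of_le_one hθ0.le hθ1.le (Nat.le_succ n)

/-! ### Total variation of the representing measure -/

theorem tConst_nonneg (q β γ : ℝ) (n : ℕ) : 0 ≤ tConst q β γ n := by
  unfold tConst
  split_ifs <;> positivity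

theorem eq_zero_of_tConst_eq_zero {q β γ : ℝ} {n : ℕ} (h : tConst q β γ n = 0) : n = 0 := by
  unfold tConst at h
  split_ifs at h
  · exact absurd h (by positivity)
  · exact_mod_cast h
  · exact absurd h one_ne_zero

/-- The three regimes of `T_n` are a growing, a constant and a decaying geometric sum. Positivity is
assumed because the critical value is `n`, which vanishes at `n = 0` while the sum is `1`; for `n ≥
1`, `n + 1 ≤ 2 n`. -/
theorem exists_sum_rpow_le_tConst (q β γ : ℝ) :
    ∃ K : ℝ, 0 < K ∧ ∀ n : ℕ, 0 < tConst q β γ n →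
      ∑ i ∈ Finset.range (n + 1), (2 : ℝ) ^ (i * (q / 2 + β - γ)) ≤ K * tConst q β γ n := by
  set δ := q / 2 + β - γ with hδ
  have hpow : ∀ i : ℕ, (2 : ℝ) ^ (i * δ) = ((2 : ℝ) ^ δ) ^ i := fun i => by
    rw [← Real.rpow_natCast, ← Real.rpow_mul two_pos.le, mul_comm]
  simp_rw [hpow]
  rcases lt_trichotomy γ (q / 2 + β) with h | h | h
  · have hθ : 1 < (2 : ℝ) ^ δ := Real.one_lt_rpow one_lt_two (by linarith)
    have hθ1 : 0 < (2 : ℝ) ^ δ - 1 := by linarith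
    refine ⟨(2 : ℝ) ^ δ / ((2 : ℝ) ^ δ - 1), by positivity, fun n _ => ?_⟩
    rw [tConst, if_pos h, ← hδ, hpow, geom_sum_eq hθ.ne', div_mul_eq_mul_div, ← pow_succ']
    gcongr
    linarith
  · refine ⟨2, two_pos, fun n hn => ?_⟩
    have h0 : δ = 0 := by linarith
    rw [tConst, if_neg (by linarith), if_pos h] at hn ⊢
    have hn1 : (1 : ℝ) ≤ n := by exact_mod_cast Nat.one_le_iff_ne_zero.2 fun h => by simp [h] at hn
    simp only [h0, Real.rpow_zero, one_pow, Finset.sum_const, Finset.card_range, nsmul_eq_mul,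
      mul_one, Nat.cast_add, Nat.cast_one]
    linarith
  · have hθ : (2 : ℝ) ^ δ < 1 := Real.rpow_lt_one_of_one_lt_of_neg one_lt_two (by linarith)
    have hθ0 : 0 < (2 : ℝ) ^ δ := by positivity
    have hθ1 : 0 < 1 - (2 : ℝ) ^ δ := by linarith
    refine ⟨(1 - (2 : ℝ) ^ δ)⁻¹, by positivity, fun n _ => ?_⟩
    rw [tConst, if_neg (by linarith), if_neg (by linarith), mul_one,
      ← tsum_geometric_of_lt_one hθ0.le hθ]
    exact (summable_geometric_of_lt_one hθ0.le hθ).sum_le_tsum _ fun _ _ => by positivity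

theorem integral_abs_le_of_integral_sq_le {Y : Type*} [MeasurableSpace Y] {ν : Measure Y}
    [IsProbabilityMeasure ν] {D : Y → ℝ} (hD : MemLp D 2 ν) {δ : ℝ} (hδ : 0 < δ)
    (h : ∫ y, |D y| ^ 2 ∂ν ≤ δ ^ 2) : ∫ y, |D y| ∂ν ≤ δ := by
  have hsq : Integrable (fun y => |D y| ^ 2) ν := by
    simp_rw [sq_abs]
    exact hD.integrable_sq
  have h1 : ∫ y, |D y| ∂ν ≤ ∫ y, (δ / 2 + (2 * δ)⁻¹ * |D y| ^ 2) ∂ν := by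
    refine integral_mono (hD.integrable one_le_two).abs
      ((integrable_const _).add (hsq.const_mul _)) fun y => ?_
    have : δ / 2 + (2 * δ)⁻¹ * |D y| ^ 2 - |D y| = (2 * δ)⁻¹ * (|D y| - δ) ^ 2 := by
      field_simp
      ring
    have h2 : 0 ≤ (2 * δ)⁻¹ * (|D y| - δ) ^ 2 := by positivity
    simp only
    linarith
  rw [integral_add (integrable_const _) (hsq.const_mul _), integral_const_mul] at h1
  simp only [integral_const, probReal_univ, one_smul] at h1
  refine h1.trans ?_
  calc δ / 2 + (2 * δ)⁻¹ * ∫ y, |D y| ^ 2 ∂ν ≤ δ / 2 + (2 * δ)⁻¹ * δ ^ 2 := by gcongr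
    _ = δ := by
      field_simp
      ring

namespace IsDataSpace

variable {X : Type*} [MetricSpace X] [CompactSpace X] [MeasurableSpace X] [BorelSpace X]
  {μ : Measure X} [IsProbabilityMeasure μ] {lam : ℕ → ℝ} {φ : ℕ → X → ℝ} {q : ℝ}

/-- Cauchy–Schwarz: a block has `O(2 ^ (jq))` indices, and by Parseval the sum of its squared
coefficients is the squared `L^2` norm. -/
theorem exists_sum_abs_coeff_le (hX : IsDataSpace μ lam φ q) {γ : ℝ} {b : ℕ → ℕ → ℝ}
    (hb : ∀ j k, b j k ≠ 0 → k ∈ dyadicBlock lam j) {C : ℝ} (hC : 0 < C) :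
    ∃ K : ℝ, 0 < K ∧ ∀ (f : X → ℝ) (W : ℝ), 0 ≤ W → ∀ j : ℕ,
      eLpNorm (spectralMult μ φ (b j) f) 2 μ ≤ ENNReal.ofReal (C * (2 : ℝ) ^ (-(j * γ)) * W) →
      ∀ F : Finset ℕ, ∑ k ∈ F, |b j k * ∫ x, f x * φ k x ∂μ| ≤
        K * (2 : ℝ) ^ (j * (q / 2 - γ)) * W := by
  obtain ⟨C₀, hC₀, hcard⟩ := hX.exists_card_le
  refine ⟨√C₀ * C, by positivity, fun f W hW j hle F => ?_⟩
  have hfin : (Function.support (b j)).Finite :=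
    (hX.finite_lam_lt ((2 : ℝ) ^ (j : ℝ))).subset fun k hk => (hb j k hk).2
  set S := hfin.toFinset with hS
  have hS0 : ∀ k ∉ S, b j k = 0 := fun k hk => by simpa [hS] using hk
  set d : ℕ → ℝ := fun k => b j k * ∫ x, f x * φ k x ∂μ with hd
  have hFS : ∑ k ∈ F, |d k| ≤ ∑ k ∈ S, |d k| := by
    classical
    calc ∑ k ∈ F, |d k| ≤ ∑ k ∈ F ∪ S, |d k| :=
          Finset.sum_le_sum_of_subset_of_nonneg Finset.subset_union_left fun _ _ _ => abs_nonneg _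
      _ = ∑ k ∈ S, |d k| := (Finset.sum_subset Finset.subset_union_right fun k _ hk => by
          simp [hd, hS0 k hk]).symm
  refine hFS.trans ?_
  rw [spectralMult_eq_sum hS0] at hle
  have hsq := hX.sum_sq_le_of_eLpNorm_le S d (by positivity) hle
  have hcS : (S.card : ℝ) ≤ C₀ * (2 : ℝ) ^ (j * q) := hcard j S fun k hk => by
    have := (hb j k (by simpa [hS] using hk)).2
    rwa [Real.rpow_natCast] at this
  have hcs : (∑ k ∈ S, |d k|) ^ 2 ≤ S.card * ∑ k ∈ S, |d k| ^ 2 := sq_sum_le_card_mul_sum_sq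
  simp_rw [sq_abs] at hcs
  refine (sq_le_sq₀ (Finset.sum_nonneg fun _ _ => abs_nonneg _) (by positivity)).1 (hcs.trans ?_)
  calc (S.card : ℝ) * ∑ k ∈ S, d k ^ 2
      ≤ C₀ * (2 : ℝ) ^ (j * q) * (C * (2 : ℝ) ^ (-(j * γ)) * W) ^ 2 := by gcongr
    _ = (√C₀ * C * (2 : ℝ) ^ (j * (q / 2 - γ)) * W) ^ 2 := by
      have h1 : (2 : ℝ) ^ (j * q) * ((2 : ℝ) ^ (-(j * γ))) ^ 2 =
          ((2 : ℝ) ^ (j * (q / 2 - γ))) ^ 2 := by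
        rw [← Real.rpow_natCast, ← Real.rpow_natCast, ← Real.rpow_mul two_pos.le,
          ← Real.rpow_mul two_pos.le, ← Real.rpow_add two_pos]
        congr 1
        push_cast
        ring
      rw [mul_pow _ W, mul_pow _ W, mul_pow C, mul_pow (√C₀ * C), mul_pow (√C₀),
        Real.sq_sqrt hC₀.le, ← h1]
      ring

/-- The total variation of the signed measure that represents the smooth partial sum. -/
theorem exists_sum_coeff_mul_integral_le (hX : IsDataSpace μ lam φ q) {Y : Type*}
    [MeasurableSpace Y] {ν : Measure Y} [IsProbabilityMeasure ν] {D : ℕ → Y → ℝ} {β : ℝ}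
    (hD : ∃ C : ℝ, 0 < C ∧ ∀ (j : ℕ), ∀ l ∈ dyadicBlock lam j,
      MemLp (D l) 2 ν ∧ ∫ y, |D l y| ^ 2 ∂ν ≤ C * (2 : ℝ) ^ (2 * j * β))
    {γ : ℝ} {b : ℕ → ℕ → ℝ} (hb : ∀ j k, b j k ≠ 0 → k ∈ dyadicBlock lam j) {C : ℝ} (hC : 0 < C) :
    ∃ K : ℝ, 0 < K ∧ ∀ (f : X → ℝ) (W : ℝ), 0 ≤ W →
      (∀ j : ℕ, eLpNorm (spectralMult μ φ (b j) f) 2 μ ≤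
        ENNReal.ofReal (C * (2 : ℝ) ^ (-(j * γ)) * W)) →
      ∀ n : ℕ, 0 < tConst q β γ n → ∀ F : Finset ℕ,
        ∑ l ∈ F, |∑ i ∈ Finset.range (n + 1), b i l * ∫ x, f x * φ l x ∂μ| * ∫ y, |D l y| ∂ν ≤
          K * W * tConst q β γ n := by
  obtain ⟨C', hC', hD⟩ := hD
  obtain ⟨K, hK, hcoef⟩ := hX.exists_sum_abs_coeff_le (γ := γ) hb hC
  obtain ⟨K', hK', hsum⟩ := exists_sum_rpow_le_tConst q β γ
  refine ⟨√C' * K * K', by positivity, fun f W hW hle n hn F => ?_⟩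
  have hDl : ∀ j, ∀ l ∈ dyadicBlock lam j, ∫ y, |D l y| ∂ν ≤ √C' * (2 : ℝ) ^ (j * β) := by
    intro j l hl
    refine integral_abs_le_of_integral_sq_le (hD j l hl).1 (by positivity)
      ((hD j l hl).2.trans (le_of_eq ?_))
    rw [mul_pow, Real.sq_sqrt hC'.le, ← Real.rpow_natCast ((2 : ℝ) ^ (j * β)),
      ← Real.rpow_mul two_pos.le]
    congr 2
    push_cast
    ring
  calc ∑ l ∈ F, |∑ i ∈ Finset.range (n + 1), b i l * ∫ x, f x * φ l x ∂μ| * ∫ y, |D l y| ∂ν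
      ≤ ∑ l ∈ F, ∑ i ∈ Finset.range (n + 1),
          |b i l * ∫ x, f x * φ l x ∂μ| * (√C' * (2 : ℝ) ^ (i * β)) := by
        refine Finset.sum_le_sum fun l _ => ?_
        refine (mul_le_mul_of_nonneg_right (Finset.abs_sum_le_sum_abs _ _)
          (integral_nonneg fun _ => abs_nonneg _)).trans ?_
        rw [Finset.sum_mul]
        refine Finset.sum_le_sum fun i _ => ?_
        rcases eq_or_ne (b i l) 0 with h0 | h0
        · simp [h0]
        · gcongr
          exact hDl i l (hb i l h0)
    _ = ∑ i ∈ Finset.range (n + 1), √C' * (2 : ℝ) ^ (i * β) *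
          ∑ l ∈ F, |b i l * ∫ x, f x * φ l x ∂μ| := by
        rw [Finset.sum_comm]
        refine Finset.sum_congr rfl fun i _ => ?_
        rw [Finset.mul_sum]
        exact Finset.sum_congr rfl fun l _ => mul_comm _ _
    _ ≤ ∑ i ∈ Finset.range (n + 1), √C' * (2 : ℝ) ^ (i * β) *
          (K * (2 : ℝ) ^ (i * (q / 2 - γ)) * W) := by
        gcongr with i _
        exact hcoef f W hW i (hle i) F
    _ = √C' * K * W * ∑ i ∈ Finset.range (n + 1), (2 : ℝ) ^ (i * (q / 2 + β - γ)) := by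
        rw [Finset.mul_sum]
        refine Finset.sum_congr rfl fun i _ => ?_
        have : (2 : ℝ) ^ (i * (q / 2 + β - γ)) =
            (2 : ℝ) ^ (i * β) * (2 : ℝ) ^ (i * (q / 2 - γ)) := by
          rw [← Real.rpow_add two_pos]
          congr 1
          ring
        rw [this]
        ring
    _ ≤ √C' * K * W * (K' * tConst q β γ n) := by
        gcongr
        exact hsum n hn
    _ = _ := by ring

end IsDataSpace

/-! ### Sampling uniformly over the space -/

/-- Uniform approximation of finite sums of integrals of Hölder functions by signed samples. -/
theorem exists_signed_sample_of_holder {X Y κ : Type*} [MetricSpace X] [MeasurableSpace Y]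
    [Fintype κ] {ν : Measure Y} [IsProbabilityMeasure ν] {q α N c₂ : ℝ} (hq : 0 < q) (hα : 0 < α)
    (hN : 0 < N) (hnet : ∀ ε : ℝ, 0 < ε → ε ≤ 1 → ∃ t : Finset X,
      (t.card : ℝ) ≤ N * ε ^ (-q) ∧ ∀ x, ∃ y ∈ t, dist x y ≤ ε)
    (hc₂ : Fintype.card κ * (2 * N) < Real.exp (q / α * c₂))
    {I : Finset ℕ} (hI : I.Nonempty) {c : ℕ → ℝ} {D : ℕ → Y → ℝ}
    (hD : ∀ l ∈ I, c l ≠ 0 → Integrable (D l) ν) {V : ℝ} (hV : 0 < V)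
    (hcV : ∑ l ∈ I, |c l| * ∫ y, |D l y| ∂ν ≤ V) {H : κ → ℕ → X → Y → ℝ}
    (hH : ∀ k l x, AEStronglyMeasurable (H k l x) ν) {S L s : ℝ} (hS0 : 0 ≤ S) (hSL : S ≤ L)
    (hb : ∀ k, ∀ l ∈ I, ∀ x y, |H k l x y| ≤ S)
    (hhol : ∀ k, ∀ l ∈ I, ∀ x x' y, |H k l x y - H k l x' y| ≤ L * dist x x' ^ α)
    (hs : 0 < s) {M : ℕ} (hM : 1 ≤ M)
    (hMle : s < S → 2 * q / α * (S / s) ^ 2 * (c₂ + Real.log (L / s)) ≤ M) :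
    ∃ (l : Fin M → ℕ) (y : Fin M → Y) (w : Fin M → ℝ), (∀ j, w j = 1 ∨ w j = -1) ∧ ∀ k x,
      |V / M * ∑ j, w j * H k (l j) x (y j) - ∑ l ∈ I, c l * ∫ y, H k l x y * D l y ∂ν|
        ≤ 3 * (V * s) := by
  have hM0 : (0 : ℝ) < M := by exact_mod_cast hM
  have hmean : ∀ (h : Fin M → ℝ) (w : Fin M → ℝ) (B : ℝ), (∀ j, w j = 1 ∨ w j = -1) →
      (∀ j, |h j| ≤ B) → |V / M * ∑ j, w j * h j| ≤ V * B := by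
    intro h w B hw hB
    have h1 : |∑ j, w j * h j| ≤ M * B := by
      refine (Finset.abs_sum_le_sum_abs _ _).trans ?_
      refine (Finset.sum_le_card_nsmul _ _ B fun j _ => ?_).trans (by simp)
      rw [abs_mul]
      rcases hw j with h | h <;> simpa [h] using hB j
    rw [abs_mul, abs_of_pos (by positivity)]
    calc V / M * |∑ j, w j * h j| ≤ V / M * (M * B) := by gcongr
      _ = V * B := by field_simp
  have hmass : ∀ (h : ℕ → Y → ℝ) (B : ℝ), 0 ≤ B → (∀ l ∈ I, ∀ y, |h l y| ≤ B) →
      |∑ l ∈ I, c l * ∫ y, h l y * D l y ∂ν| ≤ V * B := by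
    intro h B hB hle
    calc |∑ l ∈ I, c l * ∫ y, h l y * D l y ∂ν|
        ≤ ∑ l ∈ I, |c l * ∫ y, h l y * D l y ∂ν| := Finset.abs_sum_le_sum_abs _ _
      _ ≤ ∑ l ∈ I, |c l| * (∫ y, |D l y| ∂ν) * B := by
          refine Finset.sum_le_sum fun l hl => ?_
          rcases eq_or_ne (c l) 0 with h0 | h0
          · simp [h0]
          rw [abs_mul, mul_assoc, ← integral_mul_const]
          gcongr
          refine abs_integral_le_integral_abs.trans (integral_mono_of_nonneg
            (ae_of_all _ fun _ => abs_nonneg _) ((hD l hl h0).abs.mul_const B)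
            (ae_of_all _ fun y => ?_))
          simp only [abs_mul]
          rw [mul_comm]
          gcongr
          exact hle l hl y
      _ = (∑ l ∈ I, |c l| * ∫ y, |D l y| ∂ν) * B := (Finset.sum_mul _ _ _).symm
      _ ≤ V * B := by gcongr
  -- If the tolerance is at least the uniform bound, any sample works, as the empirical term and the
  -- integral are each at most `V s`. This also covers `S = 0`.
  rcases le_or_gt S s with hSs | hSs
  · obtain ⟨l₀, hl₀⟩ := hI
    obtain ⟨y₀⟩ := nonempty_of_isProbabilityMeasure ν
    refine ⟨fun _ => l₀, fun _ => y₀, fun _ => 1, fun _ => Or.inl rfl, fun k x => ?_⟩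
    have h1 := hmean (fun _ => H k l₀ x y₀) (fun _ => 1) S (fun _ => Or.inl rfl)
      fun _ => hb k l₀ hl₀ x y₀
    have h2 := hmass (fun l => H k l x) S hS0 fun l hl => hb k l hl x
    refine (abs_sub _ _).trans ?_
    have h3 : V * S ≤ V * s := by gcongr
    have h4 : 0 < V * s := by positivity
    linarith
  · have hS : 0 < S := hs.trans hSs
    have hL : 0 < L := hS.trans_le hSL
    -- The mesh at which Hölder continuity moves the functions by at most `s`, that is `L ε ^ α =
    -- s`.
    set ε := (s / L) ^ (1 / α) with hε
    have hε0 : 0 < ε := by positivity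
    have hsL : s / L ≤ 1 := (div_le_one hL).2 (hSs.le.trans hSL)
    have hε1 : ε ≤ 1 := Real.rpow_le_one (by positivity) hsL (by positivity)
    have hεα : L * ε ^ α = s := by
      rw [hε, ← Real.rpow_mul (by positivity), one_div_mul_cancel hα.ne', Real.rpow_one]
      field_simp
    obtain ⟨t, ht, hcov⟩ := hnet ε hε0 hε1
    have hεq : ε ^ (-q) = Real.exp (q / α * Real.log (L / s)) := by
      rw [hε, ← Real.rpow_mul (by positivity), Real.rpow_def_of_pos (by positivity)]
      congr 1
      rw [Real.log_div hs.ne' hL.ne', Real.log_div hL.ne' hs.ne']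
      field_simp
      ring
    -- The net has at most `N exp ((q / α) log (L / s))` points; the lower bound on `M` makes the
    -- Hoeffding exponent exceed this entropy, and `c₂` absorbs the constants `2 N` and the number
    -- of operators.
    have hlt : ((Finset.univ ×ˢ t : Finset (κ × X)).card : ℝ) *
        (2 * Real.exp (-(M * s ^ 2 / (2 * S ^ 2)))) < 1 := by
      rw [Finset.card_product, Finset.card_univ, Nat.cast_mul]
      have h1 : q / α * (c₂ + Real.log (L / s)) ≤ M * s ^ 2 / (2 * S ^ 2) := by
        rw [le_div_iff₀ (by positivity)]
        calc q / α * (c₂ + Real.log (L / s)) * (2 * S ^ 2)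
            = 2 * q / α * (S / s) ^ 2 * (c₂ + Real.log (L / s)) * s ^ 2 := by
              field_simp
          _ ≤ M * s ^ 2 := by
              gcongr
              exact hMle hSs
      have h2 : Real.exp (-(M * s ^ 2 / (2 * S ^ 2))) ≤
          (Real.exp (q / α * c₂) * ε ^ (-q))⁻¹ := by
        rw [hεq, ← Real.exp_add, ← mul_add, ← Real.exp_neg]
        gcongr
      have hεq0 : 0 < ε ^ (-q) := by positivity
      calc (Fintype.card κ : ℝ) * t.card * (2 * Real.exp (-(M * s ^ 2 / (2 * S ^ 2))))
          ≤ (Fintype.card κ : ℝ) * (N * ε ^ (-q)) *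
              (2 * (Real.exp (q / α * c₂) * ε ^ (-q))⁻¹) := by gcongr
        _ = Fintype.card κ * (2 * N) / Real.exp (q / α * c₂) := by
            field_simp
        _ < 1 := by rwa [div_lt_one (Real.exp_pos _)]
    obtain ⟨l, y, w, hlI, hw, hmain⟩ := exists_signed_sample_sum hI hD hV hcV
      (Finset.univ ×ˢ t : Finset (κ × X)) (H := fun i l => H i.1 l i.2)
      (fun i _ l _ => hH i.1 l i.2) hS (fun i _ l hl y => hb i.1 l hl i.2 y) hs.le hM hlt
    refine ⟨l, y, w, hw, fun k x => ?_⟩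
    obtain ⟨x', hx', hxx'⟩ := hcov x
    have hclose : ∀ l ∈ I, ∀ y, |H k l x y - H k l x' y| ≤ s := fun l hl y => by
      refine (hhol k l hl x x' y).trans ?_
      rw [← hεα]
      gcongr
    have hint : ∀ l ∈ I, ∀ x, c l ≠ 0 → Integrable (fun y => H k l x y * D l y) ν :=
      fun l hl x h0 => (hD l hl h0).bdd_mul (c := S) (hH k l x) (ae_of_all _ fun y => hb k l hl x y)
    -- Three errors of size `V s`: sampling at the net point, and moving from `x'` to `x` in the
    -- empirical sum and in the integral.
    have e1 := hmain (k, x') (Finset.mem_product.2 ⟨Finset.mem_univ _, hx'⟩)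
    have e2 := hmean (fun j => H k (l j) x (y j) - H k (l j) x' (y j)) w s hw
      fun j => hclose (l j) (hlI j) (y j)
    have e3 := hmass (fun l y => H k l x y - H k l x' y) s hs.le hclose
    have hsplit1 : V / M * ∑ j, w j * (H k (l j) x (y j) - H k (l j) x' (y j)) =
        V / M * ∑ j, w j * H k (l j) x (y j) - V / M * ∑ j, w j * H k (l j) x' (y j) := by
      rw [← mul_sub, ← Finset.sum_sub_distrib]
      simp_rw [mul_sub]
    have hsplit2 : ∑ l ∈ I, c l * ∫ y, (H k l x y - H k l x' y) * D l y ∂ν =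
        ∑ l ∈ I, c l * ∫ y, H k l x y * D l y ∂ν - ∑ l ∈ I, c l * ∫ y, H k l x' y * D l y ∂ν := by
      rw [← Finset.sum_sub_distrib]
      refine Finset.sum_congr rfl fun l hl => ?_
      rcases eq_or_ne (c l) 0 with h0 | h0
      · simp [h0]
      · rw [← mul_sub, ← integral_sub (hint l hl x h0) (hint l hl x' h0)]
        simp_rw [sub_mul]
    rw [hsplit1] at e2
    rw [hsplit2] at e3
    simp only at e1
    rw [abs_le] at e1 e2 e3 ⊢
    constructor <;> linarith [e1.1, e1.2, e2.1, e2.2, e3.1, e3.2]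

/-! ### Assembly of the theorem -/

theorem Sends.aestronglyMeasurable {X : Type*} [MeasurableSpace X] {μ : Measure X} {p : ℝ≥0∞}
    {U : Lp ℝ p μ →ₗ.[ℝ] Lp ℝ p μ} {f g : X → ℝ} (h : Sends U f g) : AEStronglyMeasurable g μ := by
  obtain ⟨u, v, -, -, hv⟩ := h
  exact (Lp.aestronglyMeasurable v).congr hv

theorem supConst_le_lipConst {X Y : Type*} [MetricSpace X] [MeasurableSpace X] (μ : Measure X)
    (lam : ℕ → ℝ) (α : ℝ) {J : ℕ} (UG : Fin J → ℕ → X → Y → ℝ) (n : ℕ) :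
    supConst μ lam UG n ≤ lipConst μ lam α UG n :=
  iSup_mono fun _ => iSup_mono fun _ => iSup_mono fun _ => iSup_mono fun _ => le_self_add

theorem mainTheorem1 {X Y : Type*} [MetricSpace X] [CompactSpace X] [MeasurableSpace X]
    [BorelSpace X] [MeasurableSpace Y]
    (μ : Measure X) [IsProbabilityMeasure μ] (μY : Measure Y) [IsProbabilityMeasure μY]
    (lam : ℕ → ℝ) (φ : ℕ → X → ℝ) (q : ℝ) (hX : IsDataSpace μ lam φ q)
    (hφ : ∀ x : X, ∃ k, φ k x ≠ 0)
    (G : ℕ → X → Y → ℝ) (D : ℕ → Y → ℝ) (α β : ℝ) (hα : 0 < α) (hα1 : α ≤ 1) (hβ : 0 < β)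
    (hG : IsAsymmetricEignetKernel μ μY lam φ G D α β)
    (p : ℝ≥0∞) [Fact (1 ≤ p)]
    (J : ℕ) (hJ : 1 ≤ J) (U : Fin J → (Lp ℝ p μ →ₗ.[ℝ] Lp ℝ p μ)) (a : Fin J → ℝ)
    (hU : ∀ k, IsDerivativeLike μ lam φ p (U k) (a k))
    (UG : Fin J → ℕ → X → Y → ℝ)
    (hUG : ∀ k, IsCompatible μ μY φ G D p (U k) (UG k))
    (γ : ℝ) (hγ0 : 0 < γ) (hγ : ∀ k, a k < γ) :
    ∃ c₁ c₂ c₃ C : ℝ, 0 < c₁ ∧ 0 < c₂ ∧ 0 < c₃ ∧ 0 < C ∧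
      ∀ f : X → ℝ, MemSobolev μ lam φ (max p 2) γ f →
      ∀ n : ℕ, lipConst μ lam α UG n < ⊤ →
      ∀ M : ℕ, 1 ≤ M →
        c₁ * (2 : ℝ) ^ (2 * n * (γ - ⨅ k, a k)) *
            ((supConst μ lam UG n).toReal * tConst q β γ n) ^ 2 *
            (c₂ + n * (γ - ⨅ k, a k) +
              Real.log ((lipConst μ lam α UG n).toReal * tConst q β γ n)) ≤ M →
        ∃ (ℓ : Fin M → ℕ) (y : Fin M → Y) (w : Fin M → ℝ),
          (∀ j, w j = 1 ∨ w j = -1) ∧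
          ∀ k, ∃ g : X → ℝ, Sends (U k) f g ∧
            eLpNorm
              (fun x => g x -
                c₃ * (sobolevNorm μ lam φ (max p 2) γ f).toReal * tConst q β γ n / M *
                  ∑ j, w j * UG k (ℓ j) x (y j)) p μ ≤
              ENNReal.ofReal (C * (2 : ℝ) ^ (-(n * (γ - a k)))) *
                sobolevNorm μ lam φ (max p 2) γ f := by
  obtain ⟨b, C, hC, hb, hdec⟩ := hX.exists_block_decomposition hγ0
  have hp1 : 1 ≤ p := Fact.out
  have hp2 : 1 ≤ max p 2 := hp1.trans (le_max_left _ _)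
  obtain ⟨c₃, hc₃, htv⟩ := hX.exists_sum_coeff_mul_integral_le hG.square_bound (γ := γ) hb hC
  obtain ⟨N, hN, hnet⟩ := hX.exists_finite_net hφ
  have hopen := hX.isOpenPosMeasure hφ
  choose K hK hser using fun k => (hU k).exists_sends_of_blocks hX hγ0 (hγ k) hb hC
  have hq := hX.exponent_pos
  have hJ0 : Nonempty (Fin J) := ⟨⟨0, hJ⟩⟩
  set a₀ := ⨅ k, a k with ha₀
  have ha₀le : ∀ k, a₀ ≤ a k := fun k => ciInf_le (Set.finite_range a).bddBelow k
  have hδ : 0 ≤ γ - a₀ := sub_nonneg.2 ((ha₀le hJ0.some).trans (hγ hJ0.some).le)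
  -- The `+ 1` gives both strictness in the union bound and `log E > 0`, hence `c₂ > 0`.
  set E := (J : ℝ) * (2 * N) + 1 with hE
  have hE1 : 1 < E := by
    have : (0 : ℝ) < J := by exact_mod_cast hJ
    have : 0 < (J : ℝ) * (2 * N) := by positivity
    linarith
  set c₂ := α / q * Real.log E with hc₂
  have hc₂0 : 0 < c₂ := mul_pos (by positivity) (Real.log_pos hE1)
  have hc₂E : Fintype.card (Fin J) * (2 * N) < Real.exp (q / α * c₂) := by
    have : q / α * c₂ = Real.log E := by
      rw [hc₂]
      field_simp
    rw [this, Real.exp_log (by linarith), Fintype.card_fin]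
    linarith
  have hKle : ∀ k, K k ≤ ∑ k, K k := fun k =>
    Finset.single_le_sum (fun i _ => (hK i).le) (Finset.mem_univ k)
  have hKsum : 0 < ∑ k, K k := (hK hJ0.some).trans_le (hKle _)
  refine ⟨2 * q / α, c₂, c₃, (∑ k, K k) + 3 * c₃, by positivity, hc₂0, hc₃, by positivity,
    fun f hf n hL M hM hMle => ?_⟩
  have hfm : MemLp f (max p 2) μ := hf.1.1
  set W := (sobolevNorm μ lam φ (max p 2) γ f).toReal with hW
  have hW0 : 0 ≤ W := ENNReal.toReal_nonneg
  have hWof : ∀ B : ℝ, 0 ≤ B →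
      ENNReal.ofReal B * sobolevNorm μ lam φ (max p 2) γ f = ENNReal.ofReal (B * W) := fun B hB => by
    rw [ENNReal.ofReal_mul hB, hW, ENNReal.ofReal_toReal hf.2.ne]
  have hbl : ∀ j : ℕ, eLpNorm (spectralMult μ φ (b j) f) (max p 2) μ ≤
      ENNReal.ofReal (C * (2 : ℝ) ^ (-(j * γ)) * W) := fun j => by
    rw [← hWof _ (by positivity)]
    exact (hdec _ hp2 f hfm j).1
  have hlim : ∀ j : ℕ, eLpNorm (f - ∑ i ∈ Finset.range (j + 1), spectralMult μ φ (b i) f)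
      (max p 2) μ ≤ ENNReal.ofReal (C * (2 : ℝ) ^ (-(j * γ)) * W) := fun j => by
    rw [← hWof _ (by positivity)]
    exact (hdec _ hp2 f hfm j).2
  choose g hg hgle hgn using fun k => hser k f W hW0 hfm hbl hlim
  set T := tConst q β γ n with hT
  have hT0 : 0 ≤ T := tConst_nonneg q β γ n
  -- A measure of zero mass cannot be normalized. Here either `W = 0`, or `T = 0` and then `n = 0`;
  -- the approximant vanishes and the norm bound on `U f` suffices.
  rcases eq_or_ne (c₃ * W * T) 0 with hV0 | hV0
  · obtain ⟨y₀⟩ := nonempty_of_isProbabilityMeasure μY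
    refine ⟨fun _ => 0, fun _ => y₀, fun _ => 1, fun _ => Or.inl rfl, fun k => ⟨g k, hg k, ?_⟩⟩
    simp only [hV0, zero_div, zero_mul, sub_zero]
    refine (hgle k).trans ?_
    rw [hWof _ (by positivity)]
    refine ENNReal.ofReal_le_ofReal ?_
    rcases mul_eq_zero.1 hV0 with h | h
    · rcases mul_eq_zero.1 h with h | h
      · exact absurd h hc₃.ne'
      · simp [h]
    · have hn : n = 0 := eq_zero_of_tConst_eq_zero h
      gcongr
      rw [hn]
      simp only [Nat.cast_zero, zero_mul, neg_zero, Real.rpow_zero, mul_one]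
      linarith [hKle k]
  · have hV : 0 < c₃ * W * T := lt_of_le_of_ne (by positivity) hV0.symm
    have hTpos : 0 < T := lt_of_le_of_ne hT0 fun h => hV0 (by rw [← h, mul_zero])
    have hfin := hX.finite_lam_lt ((2 : ℝ) ^ n)
    set I := hfin.toFinset with hI
    have hmemI : ∀ l, l ∈ I ↔ lam l < (2 : ℝ) ^ n := fun l => by simp [hI]
    have hIne : I.Nonempty := ⟨0, (hmemI 0).2 (by rw [hX.lam_zero]; positivity)⟩
    set c : ℕ → ℝ := fun l => ∑ i ∈ Finset.range (n + 1), b i l * ∫ x, f x * φ l x ∂μ with hc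
    have hbI : ∀ i ∈ Finset.range (n + 1), ∀ l ∉ I, b i l = 0 := by
      intro i hi l hl
      by_contra h0
      refine hl ((hmemI l).2 ((hb i l h0).2.trans_le ?_))
      rw [Real.rpow_natCast]
      exact pow_le_pow_right₀ one_le_two (Nat.lt_succ_iff.1 (Finset.mem_range.1 hi))
    have hDint : ∀ l ∈ I, c l ≠ 0 → Integrable (D l) μY := by
      intro l _ hl
      obtain ⟨i, -, hi⟩ := Finset.exists_ne_zero_of_sum_ne_zero hl
      obtain ⟨C', -, hD⟩ := hG.square_bound
      exact (hD i l (hb i l (left_ne_zero_of_mul hi))).1.integrable one_le_two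
    have hcV : ∑ l ∈ I, |c l| * ∫ y, |D l y| ∂μY ≤ c₃ * W * T := by
      refine htv f W hW0 (fun j => ?_) n hTpos I
      have hfinj : (Function.support (b j)).Finite :=
        (hX.finite_lam_lt ((2 : ℝ) ^ (j : ℝ))).subset fun k hk => (hb j k hk).2
      exact (eLpNorm_le_eLpNorm_of_exponent_le (le_max_right p 2) (continuous_of_mem_span
        hX.phi_continuous (spectralMult_mem_span hfinj (hb j) f)).aestronglyMeasurable).trans (hbl j)
    have hlip : ∀ k, ∀ l ∈ I, ∀ y,
        lipNorm μ α (fun x => UG k l x y) ≤ lipConst μ lam α UG n := fun k l hl y =>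
      le_iSup_of_le k (le_iSup_of_le l (le_iSup_of_le ((hmemI l).1 hl)
        (le_iSup (fun y => lipNorm μ α (fun x => UG k l x y)) y)))
    have hsup : ∀ k, ∀ l ∈ I, ∀ y,
        eLpNorm (fun x => UG k l x y) ⊤ μ ≤ supConst μ lam UG n := fun k l hl y =>
      le_iSup_of_le k (le_iSup_of_le l (le_iSup_of_le ((hmemI l).1 hl)
        (le_iSup (fun y => eLpNorm (fun x => UG k l x y) ⊤ μ) y)))
    have hSL := supConst_le_lipConst μ lam α UG n
    have hStop : supConst μ lam UG n ≠ ⊤ := (hSL.trans_lt hL).ne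
    set S := (supConst μ lam UG n).toReal with hS
    set L := (lipConst μ lam α UG n).toReal with hLr
    set P := (2 : ℝ) ^ (n * (γ - a₀)) with hP
    have hP0 : 0 < P := by positivity
    -- With `V = c₃ W T`, the tolerance `s = (P T)⁻¹` gives `V s = c₃ W / P`, the error of the
    -- operator with the smallest exponent and therefore good enough for all of them.
    obtain ⟨l, y, w, hw, hmain⟩ := exists_signed_sample_of_holder (ν := μY) (H := UG) (S := S)
      (L := L) (s := (P * T)⁻¹) hq hα hN hnet hc₂E hIne hDint hV hcV
      (fun k l x => (hUG k).measurable l x) ENNReal.toReal_nonneg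
      (ENNReal.toReal_mono hL.ne hSL)
      (fun k l hl x y => abs_le_of_eLpNorm_top_le hα ((hlip k l hl y).trans_lt hL) hStop
        (hsup k l hl y) x)
      (fun k l hl x x' y => abs_sub_le_lipNorm_mul hα hL.ne (hlip k l hl y) x x')
      (by positivity) hM (by
        intro hs
        refine le_trans ?_ hMle
        have hLpos : 0 < L := lt_of_lt_of_le (lt_trans (by positivity) hs)
          (ENNReal.toReal_mono hL.ne hSL)
        have h1 : (S / (P * T)⁻¹) ^ 2 = (2 : ℝ) ^ (2 * n * (γ - a₀)) * (S * T) ^ 2 := by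
          have : (2 : ℝ) ^ (2 * n * (γ - a₀)) = P ^ 2 := by
            rw [hP, ← Real.rpow_natCast, ← Real.rpow_mul two_pos.le]
            congr 1
            push_cast
            ring
          rw [this, div_inv_eq_mul]
          ring
        have h2 : Real.log (L / (P * T)⁻¹) ≤ n * (γ - a₀) + Real.log (L * T) := by
          have : L / (P * T)⁻¹ = P * (L * T) := by
            rw [div_inv_eq_mul]
            ring
          rw [this, Real.log_mul hP0.ne' (by positivity), hP, Real.log_rpow two_pos]
          -- Allows `n (γ - a₀)` to stand in the hypothesis on `M` without the factor `log 2`.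
          have hlog : Real.log 2 ≤ 1 := by
            have := Real.log_le_sub_one_of_pos (two_pos : (0 : ℝ) < 2)
            linarith
          have hnδ : 0 ≤ (n : ℝ) * (γ - a₀) := by positivity
          nlinarith
        rw [h1, ← mul_assoc, add_assoc c₂]
        gcongr)
    refine ⟨l, y, w, hw, fun k => ⟨g k, hg k, ?_⟩⟩
    set h : X → ℝ := fun x => ∑ l ∈ I, c l * ∫ y, UG k l x y * D l y ∂μY with hh
    have hsum : ∑ i ∈ Finset.range (n + 1), spectralMult μ φ (b i) f = ∑ l ∈ I, c l • φ l := by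
      have : ∀ i ∈ Finset.range (n + 1), spectralMult μ φ (b i) f =
          ∑ l ∈ I, (b i l * ∫ x, f x * φ l x ∂μ) • φ l := fun i hi =>
        spectralMult_eq_sum (hbI i hi) f
      rw [Finset.sum_congr rfl this, Finset.sum_comm]
      exact Finset.sum_congr rfl fun l _ => (Finset.sum_smul).symm
    have hsends : Sends (U k) (∑ i ∈ Finset.range (n + 1), spectralMult μ φ (b i) f) h := by
      have h1 := Sends.sum (F := I) (c := c) fun l _ => (hUG k).sends_phi l
      rw [hsum]
      convert h1 using 1
      ext x
      simp [hh, Finset.sum_apply]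
    have e1 := hgn k n h hsends
    set R : X → ℝ := fun x => c₃ * W * T / M * ∑ j, w j * UG k (l j) x (y j) with hR
    have hRm : AEStronglyMeasurable R μ := by
      refine AEStronglyMeasurable.const_mul ?_ _
      refine Finset.aestronglyMeasurable_fun_sum _ fun j _ => ?_
      exact ((hUG k).sends (l j) (y j)).aestronglyMeasurable.const_mul (w j)
    have hVs : 3 * (c₃ * W * T * (P * T)⁻¹) = 3 * c₃ * P⁻¹ * W := by
      field_simp
    have e2 : eLpNorm (h - R) p μ ≤ ENNReal.ofReal (3 * c₃ * P⁻¹ * W) := by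
      have := eLpNorm_le_of_ae_bound (p := p) (μ := μ) (f := h - R) (C := 3 * c₃ * P⁻¹ * W)
        (ae_of_all _ fun x => by
          have := hmain k x
          rw [hVs, abs_sub_comm] at this
          exact this)
      simpa using this
    have hPk : P⁻¹ ≤ (2 : ℝ) ^ (-(n * (γ - a k))) := by
      rw [hP, ← Real.rpow_neg two_pos.le]
      refine Real.rpow_le_rpow_of_exponent_le one_le_two ?_
      have := mul_le_mul_of_nonneg_left (ha₀le k) (Nat.cast_nonneg (α := ℝ) n)
      linarith
    change eLpNorm (g k - R) p μ ≤ _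
    calc eLpNorm (g k - R) p μ = eLpNorm ((g k - h) + (h - R)) p μ := by rw [sub_add_sub_cancel]
      _ ≤ eLpNorm (g k - h) p μ + eLpNorm (h - R) p μ :=
          eLpNorm_add_le ((hg k).aestronglyMeasurable.sub hsends.aestronglyMeasurable)
            (hsends.aestronglyMeasurable.sub hRm) hp1
      _ ≤ ENNReal.ofReal (K k * (2 : ℝ) ^ (-(n * (γ - a k))) * W) +
            ENNReal.ofReal (3 * c₃ * P⁻¹ * W) := add_le_add e1 e2
      _ = ENNReal.ofReal (K k * (2 : ℝ) ^ (-(n * (γ - a k))) * W + 3 * c₃ * P⁻¹ * W) := by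
          have := (hK k).le
          rw [ENNReal.ofReal_add (by positivity) (by positivity)]
      _ ≤ _ := by
          rw [hWof _ (by positivity)]
          refine ENNReal.ofReal_le_ofReal ?_
          rw [← add_mul, add_mul (∑ k, K k)]
          gcongr
          exact hKle k
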